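/- **Setting.** Let $f=\frac1n\sum_{i=1}^n f_i$ on $\mathbb R^d$ with $n\ge 1$, let $r:\mathbb R^d\to\mathbb R\cup\{+\infty\}$ be proper and lower semicontinuous, and let $F=f+r$. Write $\partial$ for the limiting subdifferential and put $\operatorname{dist}(0,\emptyset)=+\infty$. *Assumption 1.* $F^*=\inf F>-\infty$; each $f_i$ is continuously differentiable; and for some $L>0$, $\frac1n\sum_i\|\nabla f_i(x)-\nabla f_i(y)\|^2\le L^2\|x-y\|^2$ for all $x,y$. *Assumption 2.* $u:\mathbb R^d\times\mathbb R^d\to\mathbb R\cup\{+\infty\}$ is a surrogate of $r$: $u(y,y)=r(y)$ and $u(x,y)\ge r(x)$ for all $x,y$. Moreover $u(x,\cdot)$ is continuous for every $x$; $u(\cdot,y)$ is lower semicontinuous and convex for every $y$; and there is $\bar h:\mathbb R^d\times\mathbb R^d\to\mathbb R\cup\{+\infty\}$ such that, for every $y$, $\bar h(\cdot,y)$ is continuously differentiable at $y$ with $\nabla\bar h(\cdot,y)(y)=0$ and $u(\cdot,y)-r(\cdot)\le\bar h(\cdot,y)$. *Assumption 3.* For every bounded $S\subset\mathbb R^d$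 there is a constant $L_u$, called valid on $S$, such that for all $x,y\in S$ and all $\nu\in\partial u(\cdot,y)(x)$ there is $\zeta\in\partial r(x)$ with $\|\nu-\zeta\|\le L_u\|x-y\|$. (The notion "valid on $S$" is used for arbitrary sets $S$ below.) **Algorithms.** Let $\mu>L/2$, $b\ge1$ and $x^0\in\operatorname{dom}F$. For $k\ge0$ draw a list $I_k$ of $b$ indices of $\{1,\dots,n\}$, independently and uniformly (repetitions allowed), and set $$x^{k+1}=\operatorname*{argmin}_x\ \tfrac\mu2\|x-x^k\|^2+\langle g^k,x\rangle+u(x,x^k).$$ Sums over $I_k$ count repetitions. * MM-SAGA ($b\le n$): $g^k=\frac1b\sum_{i\in I_k}(\nabla f_i(x^k)-\nabla f_i(x_i^{k-1}))+\frac1n\sum_{i=1}^n\nabla f_i(x_i^{k-1})$, where $x_i^{-1}=x^0$, $x_i^k=x^k$ if $i$ occurs in $I_k$, and $x_i^k=x_i^{k-1}$ otherwise. * MM-SVRG ($m\ge1$): $g^k=\frac1b\sum_{i\in I_k}(\nabla f_i(x^k)-\nabla f_i(\tilde x^k))+\nabla f(\tilde x^k)$, where $\tilde x^{-1}=x^0$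 and independently $\tilde x^k=x^k$ with probability $1/m$, $\tilde x^k=\tilde x^{k-1}$ otherwise. * MM-SARAH ($m\ge1$): $x^{-1}=x^0$, $g^{-1}=\nabla f(x^0)$, and independently $g^k=\nabla f(x^k)$ with probability $1/m$, $g^k=\frac1b\sum_{i\in I_k}(\nabla f_i(x^k)-\nabla f_i(x^{k-1}))+g^{k-1}$ otherwise. The constants $(\rho,V_\Upsilon,V)$ are $\left(\frac b{2n},\frac{(2n-b)L^2}{b^2},0\right)$ for MM-SAGA, $\left(\frac1{2m},\frac{(2m-1)L^2}{b},0\right)$ for MM-SVRG, and $\left(\frac1m,\frac{(m-1)L^2}{mb},\frac{L^2}{b}\right)$ for MM-SARAH. **Theorem (iteration complexity).** Let Assumptions 1–3 hold, let $(x^k)$ be generated by one of the three algorithms, and suppose $(2\mu-L)^2-4(V+V_\Upsilon/\rho)>0$. 1. For every $K$ there are a bounded set $S$ containing $x^0,\dots,x^K$ for all realizations and an $L_u\ge0$ that is valid on $S$. 2. For every $K\ge1$, every set $S$ that almost surely contains $x^0,\dots,x^K$, and every $L_u\ge0$ that is valid on $S$, $$\min_{k=1,\dots,K}\mathbb E\operatorname{dist}^2(0,\partial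 F(x^k))\le\frac{C}{K},\qquad C=\frac{8(2\mu-L)\left[(L+\mu+L_u)^2+V_\Upsilon/\rho\right](F(x^0)-F^*)}{(2\mu-L)^2-4(V+V_\Upsilon/\rho)}.$$ 3. If $L_u\ge0$ is valid on a set that almost surely contains all iterates, then $\min_{k\le K}\mathbb E\operatorname{dist}^2(0,\partial F(x^k))=\mathcal O(1/K)$. Moreover $\mathcal O(1/\varepsilon^2)$ iterations suffice, in expectation, to reach an $\varepsilon$-stationary point: for every $\varepsilon>0$ and every integer $K\ge\max\{1,C/\varepsilon^2\}$ there is $k\in\{1,\dots,K\}$ with $\mathbb E\operatorname{dist}^2(0,\partial F(x^k))\le\varepsilon^2$ and $\mathbb E\operatorname{dist}(0,\partial F(x^k))\le\varepsilon$. -/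

import Mathlib

open MeasureTheory ProbabilityTheory Filter Topology
open scoped ENNReal

noncomputable section

namespace SVRMM

/-- The decision space `ℝ^d` with its Euclidean norm. -/
abbrev Space (d : ℕ) : Type := EuclideanSpace ℝ (Fin d)

/-! ### Extended-real-valued functions and subdifferentials

Functions with values in `ℝ ∪ {+∞}` are modelled as `EReal`-valued functions that never take the
value `⊥`. -/

/-- `v` is a Fréchet subgradient of `g` at `x ∈ dom g`. The `ε`-form below is the usual unfolding of
`liminf_{y → x, y ≠ x} (g y - g x - ⟪v, y - x⟫) / ‖y - x‖ ≥ 0`. -/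
def frechetSubdiff {d : ℕ} (g : Space d → EReal) (x : Space d) : Set (Space d) :=
  {v | g x ≠ ⊤ ∧ ∀ ε : ℝ, 0 < ε → ∀ᶠ y in 𝓝 x,
    g x + ((inner ℝ v (y - x) - ε * ‖y - x‖ : ℝ) : EReal) ≤ g y}

/-- The limiting subdifferential of `g` at `x` (empty outside `dom g`). -/
def limitingSubdiff {d : ℕ} (g : Space d → EReal) (x : Space d) : Set (Space d) :=
  {v | g x ≠ ⊤ ∧ ∃ (xs vs : ℕ → Space d),
    Tendsto xs atTop (𝓝 x) ∧ Tendsto (fun k => g (xs k)) atTop (𝓝 (g x)) ∧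
    (∀ k, vs k ∈ frechetSubdiff g (xs k)) ∧ Tendsto vs atTop (𝓝 v)}

/-- `dist (0, ∂g(x))` as an extended nonnegative number (`+∞` if `∂g(x)` is empty). -/
def stationarityGap {d : ℕ} (g : Space d → EReal) (x : Space d) : ℝ≥0∞ :=
  Metric.infEDist 0 (limitingSubdiff g x)

/-- Convexity of an extended-real-valued function. -/
def IsConvexFun {d : ℕ} (g : Space d → EReal) : Prop :=
  ∀ x y : Space d, ∀ s t : ℝ, 0 ≤ s → 0 ≤ t → s + t = 1 →
    g (s • x + t • y) ≤ (s : EReal) * g x + (t : EReal) * g y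

/-! ### The problem `min F = f + r`, `f = (1/n) ∑ f_i` -/

/-- `f = (1/n) ∑ f_i`. -/
def avg {d n : ℕ} (f : Fin n → Space d → ℝ) (x : Space d) : ℝ :=
  (1 / (n : ℝ)) * ∑ i, f i x

/-- `F = f + r`. -/
def objective {d n : ℕ} (f : Fin n → Space d → ℝ) (r : Space d → EReal) (x : Space d) : EReal :=
  (avg f x : EReal) + r x

/-- `F^* = inf F`, as a real number (used only when `F` is proper and bounded below). -/
def optimalValue {d n : ℕ} (f : Fin n → Space d → ℝ) (r : Space d → EReal) : ℝ :=
  (⨅ x, objective f r x).toReal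

/-- `r` maps to `ℝ ∪ {+∞}`, is proper and lower semicontinuous; `F` is bounded below; each `f_i` is
continuously differentiable and the `f_i` are `L`-smooth on average. -/
structure BasicAssumption {d n : ℕ} (f : Fin n → Space d → ℝ) (r : Space d → EReal) (L : ℝ) :
    Prop where
  r_ne_bot : ∀ x, r x ≠ ⊥
  r_lsc : LowerSemicontinuous r
  r_proper : ∃ x, r x ≠ ⊤
  bddBelow : ∃ c : ℝ, ∀ x, (c : EReal) ≤ objective f r x
  contDiff : ∀ i, ContDiff ℝ 1 (f i)
  L_pos : 0 < L
  avg_smooth : ∀ x y : Space d,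
    (1 / (n : ℝ)) * ∑ i, ‖gradient (f i) x - gradient (f i) y‖ ^ 2 ≤ L ^ 2 * ‖x - y‖ ^ 2

/-- `u` is a surrogate of `r`; here `u x y` is `u(x, y)`. -/
structure IsSurrogate {d : ℕ} (u : Space d → Space d → EReal) (r : Space d → EReal) : Prop where
  eq_diag : ∀ y, u y y = r y
  majorizes : ∀ x y, r x ≤ u x y

/-- Regularity of the surrogate. In `error_le` the inequality `u(·,y) - r ≤ h(·,y)` is written
without subtraction, which matters only where `r = +∞`, where it is void. -/
structure SurrogateAssumption {d : ℕ} (u : Space d → Space d → EReal) (r : Space d → EReal) :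
    Prop where
  continuous_right : ∀ x, Continuous (fun y => u x y)
  lsc_left : ∀ y, LowerSemicontinuous (fun x => u x y)
  convex_left : ∀ y, IsConvexFun (fun x => u x y)
  error_le : ∃ h : Space d → Space d → EReal,
    (∀ x y, h x y ≠ ⊥) ∧
    (∀ y, ∃ g : Space d → ℝ, (∀ᶠ x in 𝓝 y, h x y = (g x : EReal)) ∧
      ContDiffAt ℝ 1 g y ∧ gradient g y = 0) ∧
    ∀ x y, u x y ≤ r x + h x y

/-- On the set `S`, every `ν ∈ ∂u(·,y)(x)` is within `Lu * ‖x - y‖` of some `ζ ∈ ∂r(x)`. -/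
def SubdiffGapOn {d : ℕ} (u : Space d → Space d → EReal) (r : Space d → EReal)
    (S : Set (Space d)) (Lu : ℝ) : Prop :=
  ∀ x ∈ S, ∀ y ∈ S, ∀ ν ∈ limitingSubdiff (fun z => u z y) x,
    ∃ ζ ∈ limitingSubdiff r x, ‖ν - ζ‖ ≤ Lu * ‖x - y‖

/-- On every bounded set the gap between `∂u(·,y)(x)` and `∂r(x)` is controlled linearly. -/
def SubdiffGapAssumption {d : ℕ} (u : Space d → Space d → EReal) (r : Space d → EReal) : Prop :=
  ∀ S : Set (Space d), Bornology.IsBounded S → ∃ Lu : ℝ, SubdiffGapOn u r S Lu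

/-! ### The random draws -/

/-- `I 0, I 1, …` are independent random batches: lists of `b` indices, each drawn independently
and uniformly from `Fin n` (repetitions allowed), i.e. each list has probability `n⁻ᵇ`. -/
structure IsBatchSequence {Ω : Type*} [MeasurableSpace Ω] (P : Measure Ω) {n b : ℕ}
    (I : ℕ → Ω → Fin b → Fin n) : Prop where
  measurable : ∀ k, Measurable (I k)
  indep : iIndepFun I P
  law : ∀ k (s : Fin b → Fin n), P {ω | I k ω = s} = ENNReal.ofReal ((1 / (n : ℝ)) ^ b)

/-- Independent random batches together with independent coins, where a coin is `true` with
probability `1/m`; batches and coins are independent of each other. -/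
structure IsBatchCoinSequence {Ω : Type*} [MeasurableSpace Ω] (P : Measure Ω) {n b : ℕ} (m : ℕ)
    (I : ℕ → Ω → Fin b → Fin n) (c : ℕ → Ω → Bool) : Prop where
  measurable_batch : ∀ k, Measurable (I k)
  measurable_coin : ∀ k, Measurable (c k)
  indep : iIndepFun (fun k ω => (I k ω, c k ω)) P
  law : ∀ k (s : Fin b → Fin n) (t : Bool), P {ω | I k ω = s ∧ c k ω = t} =
    ENNReal.ofReal ((1 / (n : ℝ)) ^ b * (if t then 1 / (m : ℝ) else 1 - 1 / (m : ℝ)))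

/-! ### The three algorithms -/

/-- `x' = argmin_z (μ/2) ‖z - x‖² + ⟪g, z⟫ + u(z, x)`. -/
def IsMMStep {d : ℕ} (u : Space d → Space d → EReal) (μ : ℝ) (x g x' : Space d) : Prop :=
  IsMinOn (fun z => ((μ / 2 * ‖z - x‖ ^ 2 + inner ℝ g z : ℝ) : EReal) + u z x) Set.univ x'

/-- MM-SAGA. Here `w k i` is the stored point `x_i^{k-1}`. -/
def IsSagaRun {Ω : Type*} [MeasurableSpace Ω] (P : Measure Ω) {d n : ℕ} (b : ℕ)
    (f : Fin n → Space d → ℝ) (u : Space d → Space d → EReal) (μ : ℝ) (x₀ : Space d)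
    (x : ℕ → Ω → Space d) : Prop :=
  ∃ (I : ℕ → Ω → Fin b → Fin n) (w : ℕ → Fin n → Ω → Space d),
    IsBatchSequence P I ∧
    (∀ ω, x 0 ω = x₀) ∧ (∀ i ω, w 0 i ω = x₀) ∧
    (∀ k i ω, (i ∈ Set.range (I k ω) → w (k + 1) i ω = x k ω) ∧
      (i ∉ Set.range (I k ω) → w (k + 1) i ω = w k i ω)) ∧
    ∀ k ω, IsMMStep u μ (x k ω)
      ((1 / (b : ℝ)) • ∑ j, (gradient (f (I k ω j)) (x k ω) -
          gradient (f (I k ω j)) (w k (I k ω j) ω)) +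
        (1 / (n : ℝ)) • ∑ i, gradient (f i) (w k i ω))
      (x (k + 1) ω)

/-- Loop-less MM-SVRG. Here `w k` is the reference point `x̃^{k-1}`. -/
def IsSvrgRun {Ω : Type*} [MeasurableSpace Ω] (P : Measure Ω) {d n : ℕ} (b m : ℕ)
    (f : Fin n → Space d → ℝ) (u : Space d → Space d → EReal) (μ : ℝ) (x₀ : Space d)
    (x : ℕ → Ω → Space d) : Prop :=
  ∃ (I : ℕ → Ω → Fin b → Fin n) (c : ℕ → Ω → Bool) (w : ℕ → Ω → Space d),
    IsBatchCoinSequence P m I c ∧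
    (∀ ω, x 0 ω = x₀) ∧ (∀ ω, w 0 ω = x₀) ∧
    (∀ k ω, w (k + 1) ω = if c k ω then x k ω else w k ω) ∧
    ∀ k ω, IsMMStep u μ (x k ω)
      ((1 / (b : ℝ)) • ∑ j, (gradient (f (I k ω j)) (x k ω) -
          gradient (f (I k ω j)) (w (k + 1) ω)) +
        gradient (avg f) (w (k + 1) ω))
      (x (k + 1) ω)

/-- Loop-less MM-SARAH. Here `w k` is `x^{k-1}` and `v k` is the gradient estimate at `x^{k-1}`. -/
def IsSarahRun {Ω : Type*} [MeasurableSpace Ω] (P : Measure Ω) {d n : ℕ} (b m : ℕ)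
    (f : Fin n → Space d → ℝ) (u : Space d → Space d → EReal) (μ : ℝ) (x₀ : Space d)
    (x : ℕ → Ω → Space d) : Prop :=
  ∃ (I : ℕ → Ω → Fin b → Fin n) (c : ℕ → Ω → Bool) (w v : ℕ → Ω → Space d),
    IsBatchCoinSequence P m I c ∧
    (∀ ω, x 0 ω = x₀) ∧ (∀ ω, w 0 ω = x₀) ∧ (∀ k ω, w (k + 1) ω = x k ω) ∧
    (∀ ω, v 0 ω = gradient (avg f) x₀) ∧
    (∀ k ω, v (k + 1) ω =
      if c k ω then gradient (avg f) (x k ω)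
      else (1 / (b : ℝ)) • ∑ j, (gradient (f (I k ω j)) (x k ω) -
          gradient (f (I k ω j)) (w k ω)) + v k ω) ∧
    ∀ k ω, IsMMStep u μ (x k ω) (v (k + 1) ω) (x (k + 1) ω)

/-- The three methods; `m` is the parameter of the loop-less estimators. -/
inductive Method : Type
  | saga : Method
  | svrg (m : ℕ) : Method
  | sarah (m : ℕ) : Method

/-- Admissible integer parameters: `b ≤ n` for SAGA, `m ≥ 1` for SVRG and SARAH. -/
def Method.Admissible (n b : ℕ) : Method → Prop
  | .saga => b ≤ n
  | .svrg m => 1 ≤ m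
  | .sarah m => 1 ≤ m

/-- The sequence `x` of random points is generated by the given method. -/
def Method.IsRun {Ω : Type*} [MeasurableSpace Ω] (P : Measure Ω) {d n : ℕ} (b : ℕ)
    (f : Fin n → Space d → ℝ) (u : Space d → Space d → EReal) (μ : ℝ) (x₀ : Space d)
    (x : ℕ → Ω → Space d) : Method → Prop
  | .saga => IsSagaRun P b f u μ x₀ x
  | .svrg m => IsSvrgRun P b m f u μ x₀ x
  | .sarah m => IsSarahRun P b m f u μ x₀ x

/-- The constant `ρ`. -/
def Method.rho (n b : ℕ) : Method → ℝ
  | .saga => (b : ℝ) / (2 * n)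
  | .svrg m => 1 / (2 * (m : ℝ))
  | .sarah m => 1 / (m : ℝ)

/-- The constant `V_Υ`. -/
def Method.VUps (n b : ℕ) (L : ℝ) : Method → ℝ
  | .saga => (2 * (n : ℝ) - b) * L ^ 2 / (b : ℝ) ^ 2
  | .svrg m => (2 * (m : ℝ) - 1) * L ^ 2 / b
  | .sarah m => ((m : ℝ) - 1) * L ^ 2 / (m * b)

/-- The constant `V`. -/
def Method.V (b : ℕ) (L : ℝ) : Method → ℝ
  | .saga => 0
  | .svrg _ => 0
  | .sarah _ => L ^ 2 / b

/-- `(2μ - L)² - 4 (V + V_Υ/ρ)`. -/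
def Method.margin (n b : ℕ) (L μ : ℝ) (M : Method) : ℝ :=
  (2 * μ - L) ^ 2 - 4 * (M.V b L + M.VUps n b L / M.rho n b)

/-- `8 (2μ - L) [(L + μ + L_u)² + V_Υ/ρ] (F(x⁰) - F^*) / [(2μ - L)² - 4 (V + V_Υ/ρ)]`, where `gap`
stands for `F(x⁰) - F^*`. -/
def Method.complexityConst (n b : ℕ) (L μ Lu gap : ℝ) (M : Method) : ℝ :=
  8 * (2 * μ - L) * ((L + μ + Lu) ^ 2 + M.VUps n b L / M.rho n b) * gap / M.margin n b L μ

/-- `min_{k = 1, …, K} 𝔼 dist²(0, ∂F(x^k))`. -/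
def minExpSqGap {Ω : Type*} [MeasurableSpace Ω] (P : Measure Ω) {d : ℕ} (F : Space d → EReal)
    (x : ℕ → Ω → Space d) (K : ℕ) : ℝ≥0∞ :=
  ⨅ k ∈ Finset.Icc 1 K, ∫⁻ ω, stationarityGap F (x k ω) ^ 2 ∂P

end SVRMM

end

/-! The proof is a potential argument. Put `B = L + μ + Lu`. Optimality of `x^{k+1}` yields an
element of `∂u(·, x^k)(x^{k+1})`; the subdifferential gap moves it into `∂r(x^{k+1})`, and adding
`∇f(x^{k+1})` gives an element of `∂F(x^{k+1})` of norm at most `B ‖x^{k+1} - x^k‖ + ‖g^k -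
∇f(x^k)‖`. So `dist² ≤ N η` with `η = (2B²/N) ‖x^{k+1} - x^k‖² + (2/N) ‖g^k - ∇f(x^k)‖²`
(`stepCost`). For each method there is a potential, `F` plus a nonnegative measure of how stale the
gradient estimate is, that drops on average by at least `η` in every step. The staleness vanishes at
the start, so the expected squared gaps sum to at most `N (F(x⁰) - F^*)`. With `N = 8(2μ - L)(B² +
V_Υ/ρ)/margin` this number is `C`, independently of `K`. The rate and the complexity follow since a
minimum is at most an average.

For SVRG and SARAH the descent inequality and Young's inequality suffice (`svrgStep_potential_le`,
`sarahStep_potential_le`).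

For SAGA put `q = (1 - 1/n)^b` and `h = 2n/b`. The same argument would need `(1 - √q)⁻² ≤ h² - h`,
but `(1 - √q)⁻¹` is about `h + 1/2 - 1/b`, so this fails for `b ≥ 2` and large `n`. Three savings
close the gap. The iterate is compared with the step that uses the exact gradient: the noise enters
linearly there and averages to zero, and the rest costs only `‖e‖²/μ`. The noise depends only on the
variance of the gradient differences, which the potential tracks separately from their mean square.
The smoothness inequalities `avg_add_meanSq_le` and `avg_add_meanSq_le'` absorb the growth of both
quantities in one step. What remains is a numerical problem in `b` and `h`, solved by
`exists_saga_parameters`.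

The draws come from a finite set, so every iterate has finitely many values; this gives the bounded
sets of the first claim and removes all measurability questions about the minimization step. -/

namespace SVRMM

/-! ### Real inequalities behind the choice of parameters for MM-SAGA -/

/-- An upper bound for `(1 - 1/n)^(b/2)`, with `t = b/n`. -/
theorem one_sub_div_pow_le {b : ℕ} (hb : 1 ≤ b) {t : ℝ} (ht0 : 0 < t) (ht1 : t ≤ 1) :
    (1 - t / b) ^ b ≤
      ((2 - (1 / 2 + 1 / (b : ℝ)) * t + t ^ 2 / 20) /
        (2 + (1 / 2 - 1 / (b : ℝ)) * t + t ^ 2 / 20)) ^ 2 := by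
  have hb1 : (1 : ℝ) ≤ b := by exact_mod_cast hb
  have hb0 : (0 : ℝ) < b := by linarith
  set β : ℝ := 1 / (b : ℝ) with hβ
  have hβ0 : 0 < β := by positivity
  have hβ1 : β ≤ 1 := by rw [hβ, div_le_one hb0]; exact hb1
  have htb : ∀ s : ℝ, s / b = s * β := fun s => by rw [hβ]; ring
  have hNpos : ∀ s : ℝ, 0 ≤ s → s ≤ 1 → 0 < 2 - (1 / 2 + β) * s + s ^ 2 / 20 := by
    intro s h0 h1; nlinarith [mul_nonneg h0 hβ0.le, mul_le_mul hβ1 h1 h0 zero_le_one]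
  have hDpos : ∀ s : ℝ, 0 ≤ s → s ≤ 1 → 0 < 2 + (1 / 2 - β) * s + s ^ 2 / 20 := by
    intro s h0 h1; nlinarith [mul_nonneg h0 hβ0.le, mul_le_mul hβ1 h1 h0 zero_le_one]
  -- Equality means `b = 1` and `t = 1`: the left side is then zero and has no logarithm.
  rcases eq_or_lt_of_le (show t * β ≤ 1 by nlinarith) with h | h
  · rw [htb, h, sub_self, zero_pow (by omega)]; positivity
  have hLpos : ∀ s : ℝ, 0 ≤ s → s ≤ t → 0 < 1 - s * β := by intro s h0 h1; nlinarith
  -- `φ` is the logarithm of the right side over the left side. It vanishes at `0`, and its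
  -- derivative is `s²` times a sum of nonnegative terms over positive factors.
  let φ : ℝ → ℝ := fun s => 2 * Real.log (2 - (1 / 2 + β) * s + s ^ 2 / 20)
    - 2 * Real.log (2 + (1 / 2 - β) * s + s ^ 2 / 20) - b * Real.log (1 - s * β)
  have hder : ∀ s : ℝ, 0 ≤ s → s ≤ t → HasDerivAt φ
      (2 * ((-(1 / 2 + β) + s / 10) / (2 - (1 / 2 + β) * s + s ^ 2 / 20))
        - 2 * (((1 / 2 - β) + s / 10) / (2 + (1 / 2 - β) * s + s ^ 2 / 20))
        - b * ((-β) / (1 - s * β))) s := by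
    intro s h0 h1
    have hs1 : s ≤ 1 := h1.trans ht1
    have e1 : HasDerivAt (fun s : ℝ => 2 - (1 / 2 + β) * s + s ^ 2 / 20)
        (-(1 / 2 + β) + s / 10) s := by
      refine ((((hasDerivAt_id' s).const_mul (1 / 2 + β)).const_sub 2).add
        ((hasDerivAt_pow 2 s).div_const 20)).congr_deriv ?_
      norm_num; ring
    have e2 : HasDerivAt (fun s : ℝ => 2 + (1 / 2 - β) * s + s ^ 2 / 20)
        ((1 / 2 - β) + s / 10) s := by
      refine ((((hasDerivAt_id' s).const_mul (1 / 2 - β)).const_add 2).add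
        ((hasDerivAt_pow 2 s).div_const 20)).congr_deriv ?_
      norm_num; ring
    have e3 : HasDerivAt (fun s : ℝ => 1 - s * β) (-β) s := by
      simpa using ((hasDerivAt_id s).mul_const β).const_sub 1
    exact (((e1.log (hNpos s h0 hs1).ne').const_mul 2).sub
      ((e2.log (hDpos s h0 hs1).ne').const_mul 2)).sub
      ((e3.log (hLpos s h0 h1).ne').const_mul (b : ℝ))
  have hmono : MonotoneOn φ (Set.Icc 0 t) := by
    apply monotoneOn_of_deriv_nonneg (convex_Icc 0 t)
    · exact fun s hs => (hder s hs.1 hs.2).continuousAt.continuousWithinAt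
    · intro s hs
      rw [interior_Icc] at hs
      exact (hder s hs.1.le hs.2.le).differentiableAt.differentiableWithinAt
    · intro s hs
      rw [interior_Icc] at hs
      rw [(hder s hs.1.le hs.2.le).deriv]
      have hs0 := hs.1.le
      have hs1 : s ≤ 1 := hs.2.le.trans ht1
      have hN := hNpos s hs0 hs1
      have hD := hDpos s hs0 hs1
      have hL := hLpos s hs0 hs.2.le
      have hbβ : (b : ℝ) * β = 1 := by rw [hβ]; field_simp
      have key : 2 * ((-(1 / 2 + β) + s / 10) / (2 - (1 / 2 + β) * s + s ^ 2 / 20))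
        - 2 * (((1 / 2 - β) + s / 10) / (2 + (1 / 2 - β) * s + s ^ 2 / 20))
        - b * ((-β) / (1 - s * β)) =
        s ^ 2 * ((β - s / 10) ^ 2 + (1 / 20 - 3 / 400 * s ^ 2)) /
          ((2 - (1 / 2 + β) * s + s ^ 2 / 20) * (2 + (1 / 2 - β) * s + s ^ 2 / 20) *
            (1 - s * β)) := by
        have : (b : ℝ) * ((-β) / (1 - s * β)) = -1 / (1 - s * β) := by
          rw [← mul_div_assoc, mul_neg, hbβ]
        rw [this]
        have e : 2 * (-(1 / 2 + β) + s / 10) * (2 + (1 / 2 - β) * s + s ^ 2 / 20) * (1 - s * β)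
            - 2 * ((1 / 2 - β) + s / 10) * (2 - (1 / 2 + β) * s + s ^ 2 / 20) * (1 - s * β)
            + (2 - (1 / 2 + β) * s + s ^ 2 / 20) * (2 + (1 / 2 - β) * s + s ^ 2 / 20) =
            s ^ 2 * ((β - s / 10) ^ 2 + (1 / 20 - 3 / 400 * s ^ 2)) := by ring
        rw [← e]
        generalize 2 - (1 / 2 + β) * s + s ^ 2 / 20 = N at hN
        generalize 2 + (1 / 2 - β) * s + s ^ 2 / 20 = D at hD
        generalize 1 - s * β = Λ at hL
        field_simp
        ring
      rw [key]
      have : (0 : ℝ) ≤ 1 / 20 - 3 / 400 * s ^ 2 := by nlinarith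
      positivity
  have h0 : φ 0 = 0 := by simp [φ]
  have hfin : 0 ≤ φ t := by
    rw [← h0]; exact hmono ⟨le_rfl, ht0.le⟩ ⟨ht0.le, le_rfl⟩ ht0.le
  have hN := hNpos t ht0.le ht1
  have hD := hDpos t ht0.le ht1
  have hL := hLpos t ht0.le le_rfl
  rw [htb]
  rw [← Real.log_le_log_iff (by positivity) (by positivity), Real.log_pow, Real.log_pow,
    Real.log_div hN.ne' hD.ne']
  simp only [φ] at hfin
  push_cast
  linarith

/-- `√(h² - h)` is nearly `h - 1/2`. -/
theorem sub_le_sqrt_sq_sub {h : ℝ} (hh : 2 ≤ h) :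
    h - 1 / 2 - 172 / 1000 / h ≤ Real.sqrt (h ^ 2 - h) := by
  -- The expansion at infinity has `1/8` in place of `172/1000`; the larger constant makes the bound
  -- hold down to `h = 2`, where it is nearly sharp.
  apply Real.le_sqrt_of_sq_le
  have h0 : 0 < h := by linarith
  rw [show h - 1 / 2 - 172 / 1000 / h = (h ^ 2 - h / 2 - 172 / 1000) / h by field_simp, div_pow,
    div_le_iff₀ (by positivity)]
  nlinarith [mul_nonneg (sub_nonneg.2 hh) (sub_nonneg.2 hh)]

end SVRMM

/-! ### Polynomial inequalities in `h = 2n/b`, for fixed batch sizes and for large ones. -/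

namespace SVRMM

/-- Polynomial inequality for batch sizes `1` and `6, …, 19`; here `β` is a lower bound of `√b`. -/
theorem exists_sqrt_lower_bound_poly {b : ℕ} (hb : b = 1 ∨ (6 ≤ b ∧ b < 20)) :
    ∃ β : ℝ, 0 ≤ β ∧ β ^ 2 ≤ b ∧ ∀ h : ℝ, 2 ≤ h →
      (h ^ 2 + (1 / 2 - 1 / (b : ℝ)) * h + 1 / 10) ^ 6 ≤
        (h ^ 2 + (β / 2 - 1 / 2) * h - 172 / 1000) ^ 2 *
          ((h ^ 2 + (1 / 2 - 1 / (b : ℝ)) * h + 1 / 10) ^ 4 -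
            b * h ^ 2 * ((h ^ 2 + (1 / 2 - 1 / (b : ℝ)) * h + 1 / 10) ^ 2 / 24 +
              (3 * (h ^ 2 + (1 / 2 - 1 / (b : ℝ)) * h + 1 / 10) ^ 2 -
                3 * (h ^ 2 + (1 / 2 - 1 / (b : ℝ)) * h + 1 / 10) * h + h ^ 2) / 16)) := by
  -- The polynomial is `Γ₁ + 1/(24 Γ₁) + 1/(16 Γ₂) ≤ y + 1/2` for the weights of
  -- `exists_isSagaWeight`, with denominators cleared and `√b`, `√(h² - h)` replaced by lower
  -- bounds. The substitution `h = 2 + z` moves the range to `z ≥ 0`.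
  have aux : ∀ (b' : ℕ) (β : ℝ), b = b' → 0 ≤ β → β ^ 2 ≤ b' → (∀ z : ℝ, 0 ≤ z →
      0 ≤ ((2 + z) ^ 2 + (β / 2 - 1 / 2) * (2 + z) - 172 / 1000) ^ 2 *
          (((2 + z) ^ 2 + (1 / 2 - 1 / (b' : ℝ)) * (2 + z) + 1 / 10) ^ 4 -
            b' * (2 + z) ^ 2 * (((2 + z) ^ 2 + (1 / 2 - 1 / (b' : ℝ)) * (2 + z) + 1 / 10) ^ 2 / 24 +
              (3 * ((2 + z) ^ 2 + (1 / 2 - 1 / (b' : ℝ)) * (2 + z) + 1 / 10) ^ 2 -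
                3 * ((2 + z) ^ 2 + (1 / 2 - 1 / (b' : ℝ)) * (2 + z) + 1 / 10) * (2 + z) +
                (2 + z) ^ 2) / 16)) -
          ((2 + z) ^ 2 + (1 / 2 - 1 / (b' : ℝ)) * (2 + z) + 1 / 10) ^ 6) →
      ∃ β : ℝ, 0 ≤ β ∧ β ^ 2 ≤ b ∧ ∀ h : ℝ, 2 ≤ h →
      (h ^ 2 + (1 / 2 - 1 / (b : ℝ)) * h + 1 / 10) ^ 6 ≤
        (h ^ 2 + (β / 2 - 1 / 2) * h - 172 / 1000) ^ 2 *
          ((h ^ 2 + (1 / 2 - 1 / (b : ℝ)) * h + 1 / 10) ^ 4 -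
            b * h ^ 2 * ((h ^ 2 + (1 / 2 - 1 / (b : ℝ)) * h + 1 / 10) ^ 2 / 24 +
              (3 * (h ^ 2 + (1 / 2 - 1 / (b : ℝ)) * h + 1 / 10) ^ 2 -
                3 * (h ^ 2 + (1 / 2 - 1 / (b : ℝ)) * h + 1 / 10) * h + h ^ 2) / 16)) := by
    rintro b' β rfl h0 h1 h2
    refine ⟨β, h0, h1, fun h hh => sub_nonneg.1 ?_⟩
    have := h2 (h - 2) (by linarith)
    rwa [show 2 + (h - 2) = h by ring] at this
  rcases hb with rfl | ⟨h1, h2⟩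
  on_goal 2 => interval_cases b
  refine aux 1 (1) rfl (by norm_num) (by norm_num) ?_
  rotate_left
  refine aux 6 (244 / 100) rfl (by norm_num) (by norm_num) ?_
  rotate_left
  refine aux 7 (264 / 100) rfl (by norm_num) (by norm_num) ?_
  rotate_left
  refine aux 8 (282 / 100) rfl (by norm_num) (by norm_num) ?_
  rotate_left
  refine aux 9 (3) rfl (by norm_num) (by norm_num) ?_
  rotate_left
  refine aux 10 (316 / 100) rfl (by norm_num) (by norm_num) ?_
  rotate_left
  refine aux 11 (331 / 100) rfl (by norm_num) (by norm_num) ?_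
  rotate_left
  refine aux 12 (346 / 100) rfl (by norm_num) (by norm_num) ?_
  rotate_left
  refine aux 13 (36 / 10) rfl (by norm_num) (by norm_num) ?_
  rotate_left
  refine aux 14 (374 / 100) rfl (by norm_num) (by norm_num) ?_
  rotate_left
  refine aux 15 (387 / 100) rfl (by norm_num) (by norm_num) ?_
  rotate_left
  refine aux 16 (4) rfl (by norm_num) (by norm_num) ?_
  rotate_left
  refine aux 17 (412 / 100) rfl (by norm_num) (by norm_num) ?_
  rotate_left
  refine aux 18 (424 / 100) rfl (by norm_num) (by norm_num) ?_
  rotate_left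
  refine aux 19 (435 / 100) rfl (by norm_num) (by norm_num) ?_
  rotate_left
  all_goals
    -- After expansion in `z` no negative coefficient is left.
    intro z hz
    push_cast
    ring_nf
    positivity

/-- Polynomial inequality for batch sizes `2, …, 5`; here `β` is a lower bound of `√b`. -/
theorem exists_sqrt_lower_bound_poly_of_le_five {b : ℕ} (hb : 2 ≤ b) (hb' : b ≤ 5) :
    ∃ β : ℝ, 0 ≤ β ∧ β ^ 2 ≤ b ∧ ∀ h : ℝ, 2 ≤ h → ∀ u v m : ℝ,
      u = h ^ 2 + (1 / 2 - 1 / (b : ℝ)) * h + 1 / 10 → v = u ^ 2 * (h - 4 / (5 * b)) →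
      m = h ^ 2 + (β / 2 - 1 / 2) * h - 172 / 1000 →
      16 * u * v ^ 2 + 2 * b / 3 * u * m ^ 2 * h ^ 4 ≤ m ^ 2 * (16 * u - b * h) * v * h := by
  have aux : ∀ (b' : ℕ) (β : ℝ), b = b' → 0 ≤ β → β ^ 2 ≤ b' → (∀ h z u v m : ℝ, 0 ≤ z → h = 2 + z →
      u = h ^ 2 + (1 / 2 - 1 / (b' : ℝ)) * h + 1 / 10 → v = u ^ 2 * (h - 4 / (5 * b')) →
      m = h ^ 2 + (β / 2 - 1 / 2) * h - 172 / 1000 →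
      0 ≤ m ^ 2 * (16 * u - b' * h) * v * h - (16 * u * v ^ 2 + 2 * b' / 3 * u * m ^ 2 * h ^ 4)) →
      ∃ β : ℝ, 0 ≤ β ∧ β ^ 2 ≤ b ∧ ∀ h : ℝ, 2 ≤ h → ∀ u v m : ℝ,
      u = h ^ 2 + (1 / 2 - 1 / (b : ℝ)) * h + 1 / 10 → v = u ^ 2 * (h - 4 / (5 * b)) →
      m = h ^ 2 + (β / 2 - 1 / 2) * h - 172 / 1000 →
      16 * u * v ^ 2 + 2 * b / 3 * u * m ^ 2 * h ^ 4 ≤ m ^ 2 * (16 * u - b * h) * v * h := by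
    rintro b' β rfl h0 h1 h2
    refine ⟨β, h0, h1, fun h hh u v m hu hv hm => sub_nonneg.1 ?_⟩
    exact h2 h (h - 2) u v m (by linarith) (by ring) hu hv hm
  interval_cases b
  refine aux 2 (141 / 100) rfl (by norm_num) (by norm_num) ?_
  rotate_left
  refine aux 3 (173 / 100) rfl (by norm_num) (by norm_num) ?_
  rotate_left
  refine aux 4 2 rfl (by norm_num) (by norm_num) ?_
  rotate_left
  refine aux 5 (223 / 100) rfl (by norm_num) (by norm_num) ?_
  rotate_left
  all_goals
    rintro h z u v m hz rfl rfl rfl rfl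
    push_cast
    ring_nf
    positivity

/-- Polynomial inequality for batch sizes from `20` on, where `447 / 100` is below `√b`. -/
theorem poly_of_twenty_le {h u y m : ℝ} (hh : 2 ≤ h) (hu : u = h ^ 2 + 1 / 2 * h + 1 / 10)
    (hy : y = h ^ 2 - 1 / 2 * h - 172 / 1000) (hm : m = y + 447 / 200 * h) :
    u ^ 2 * (4 * u ^ 4 + (2 * u ^ 2 - 3 * u * h + h ^ 2) * (m * (447 / 100) * h)) ≤
      y * m * (4 * u ^ 4 + (3 * u ^ 2 - 3 * u * h + h ^ 2) * (m * (447 / 100) * h)) := by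
  obtain ⟨z, hz, rfl⟩ : ∃ z : ℝ, 0 ≤ z ∧ h = 2 + z := ⟨h - 2, by linarith, by ring⟩
  rw [← sub_nonneg]
  subst hm hy hu
  ring_nf
  positivity

end SVRMM

/-! ### Weights of the MM-SAGA potential. -/

namespace SVRMM

/-- Weights `a`, `g` and a Young parameter `c` that make `a W + g G` a potential: `s` is the noise
weight, `Γ₁` and `Γ₂` bound what one step can add. -/
def IsSagaWeight (s q A₁ A₂ Γ₁ Γ₂ a g c : ℝ) : Prop :=
  0 ≤ a ∧ 0 ≤ g ∧ 0 < c ∧ s + (1 + c) * (a * A₂) ≤ a ∧ (1 + c) * (a * A₁ + g * q) ≤ g ∧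
    (1 + 1 / c) * (a + g) ≤ Γ₁ ∧ Γ₂ ≤ (1 + 1 / c) * a

/-- With `w = 1 - 1/U` the worst case is `q = w²`. The choice `c = 1/w - 1` gives `1 + c = 1/w` and
`1 + 1/c = U`; then `a` and `g` solve the two stability conditions with equality at `q = w²`, and
`Γ₁`, `Γ₂` are the resulting values of `U (a + g)` and `U a`. -/
theorem exists_isSagaWeight {s q U : ℝ} (hs : 0 < s) (hq : 0 ≤ q) (hU : 1 < U)
    (hqU : q ≤ (1 - 1 / U) ^ 2) :
    ∃ a g c, IsSagaWeight s q (q * (1 - q)) (q ^ 2) (U ^ 2 * s)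
      (U ^ 4 * s / (3 * U ^ 2 - 3 * U + 1)) a g c := by
  have hU0 : 0 < U := by linarith
  obtain ⟨w, hw⟩ : ∃ w, w = 1 - 1 / U := ⟨_, rfl⟩
  rw [← hw] at hqU
  have hU1 : 1 / U < 1 := by rw [div_lt_one hU0]; exact hU
  have hw0 : 0 < w := by linarith
  have hw1 : w < 1 := by have : 0 < 1 / U := by positivity
                         linarith
  have hUw : U = 1 / (1 - w) := by rw [hw]; field_simp; ring
  have h1w : 0 < 1 - w := by linarith
  have hw3 : 0 < 1 - w ^ 3 := by nlinarith [mul_pos hw0 h1w, mul_pos (mul_pos hw0 hw0) h1w]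
  have hT : 0 < 1 + w + w ^ 2 := by positivity
  refine ⟨s / (1 - w ^ 3), s / (1 - w ^ 3) * (w * (1 + w)), 1 / w - 1, by positivity, by positivity,
    ?_, ?_, ?_, ?_, ?_⟩
  · rw [sub_pos, lt_div_iff₀ hw0]; linarith
  · have : q ^ 2 ≤ w ^ 4 := by nlinarith
    have e : s / (1 - w ^ 3) = s + 1 / w * (s / (1 - w ^ 3) * w ^ 4) := by field_simp; ring
    have e2 : 1 / w * (s / (1 - w ^ 3) * q ^ 2) ≤ 1 / w * (s / (1 - w ^ 3) * w ^ 4) := by gcongr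
    rw [add_sub_cancel]
    linarith
  -- The difference of the two sides is `(w² - q)(1 + w - q)`.
  · have hf : q * (1 - q) + w * (1 + w) * q ≤ w ^ 2 * (1 + w) := by
      nlinarith [mul_nonneg (sub_nonneg.2 hqU) (show 0 ≤ 1 + w - q by nlinarith)]
    have e : 1 / w * (s / (1 - w ^ 3) * (q * (1 - q)) + s / (1 - w ^ 3) * (w * (1 + w)) * q) =
        1 / w * (s / (1 - w ^ 3)) * (q * (1 - q) + w * (1 + w) * q) := by ring
    have e2 : s / (1 - w ^ 3) * (w * (1 + w)) = 1 / w * (s / (1 - w ^ 3)) * (w ^ 2 * (1 + w)) := by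
      field_simp
    rw [add_sub_cancel, e, e2]
    gcongr
  · have e : 1 + 1 / (1 / w - 1) = U := by rw [hUw]; field_simp; ring
    rw [e, hUw]
    refine le_of_eq ?_
    rw [show 1 - w ^ 3 = (1 - w) * (1 + w + w ^ 2) by ring]
    field_simp
    ring
  · have e : 1 + 1 / (1 / w - 1) = U := by rw [hUw]; field_simp; ring
    have e3 : 3 * U ^ 2 - 3 * U + 1 = U ^ 2 * (1 + w + w ^ 2) := by rw [hw]; field_simp; ring
    rw [e, e3]
    refine le_of_eq ?_
    rw [show 1 - w ^ 3 = (1 - w) * (1 + w + w ^ 2) by ring, hUw]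
    field_simp

/-- Here `q₂` stands for the probability `(1 - 2/n)^b` that a batch avoids two given indices, and
`x` for `1/n`. Keeping both instead of bounding `q₂` by `q²` gains the factor `1 - 2x/5` in `Γ₁`. As
before, `a` and `g` are the fixed points of the stability conditions at `q = w²`. -/
theorem exists_isSagaWeight_exact {s q q₂ x U : ℝ} (hs : 0 < s) (hq : 0 ≤ q) (hU : 2 ≤ U)
    (hqU : q ≤ (1 - 1 / U) ^ 2) (hq₂ : 0 ≤ q₂) (hqq : q₂ ≤ q ^ 2) (hx : 0 ≤ x) (hx1 : x ≤ 1) :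
    ∃ a g c, IsSagaWeight s q ((q - q₂) * (1 - x)) q₂ (U ^ 2 * (1 - 2 / 5 * x) * s) (U * s) a g c := by
  have hU0 : 0 < U := by linarith
  obtain ⟨w, hw⟩ : ∃ w, w = 1 - 1 / U := ⟨_, rfl⟩
  rw [← hw] at hqU
  have hU1 : 1 / U ≤ 1 / 2 := by gcongr
  have hw2 : 1 / 2 ≤ w := by linarith
  have hw0 : 0 < w := by linarith
  have hw1 : w < 1 := by have : 0 < 1 / U := by positivity
                         linarith
  have hUw : U = 1 / (1 - w) := by rw [hw]; field_simp; ring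
  have h1w : 0 < 1 - w := by linarith
  have hq4 : q₂ ≤ w ^ 4 := by nlinarith
  have hw42 : w ^ 4 ≤ w ^ 2 := by nlinarith [mul_pos hw0 hw0, mul_pos (mul_pos hw0 hw0) h1w]
  have hw21 : w ^ 2 < w := by nlinarith
  have hwq : 0 < w - q₂ := by linarith
  have hwq2 : 0 ≤ w ^ 2 - q₂ := by linarith
  have h1x : 0 ≤ 1 - x := by linarith
  have e : 1 + 1 / (1 / w - 1) = U := by rw [hUw]; field_simp; ring
  refine ⟨s * w / (w - q₂), s * ((w ^ 2 - q₂) * (1 - x)) / ((w - q₂) * (1 - w)), 1 / w - 1,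
    by positivity, by positivity, ?_, ?_, ?_, ?_, ?_⟩
  · rw [sub_pos, lt_div_iff₀ hw0]; linarith
  · rw [add_sub_cancel]
    refine le_of_eq ?_
    field_simp
    ring
  · rw [add_sub_cancel]
    have e1 : s * ((w ^ 2 - q₂) * (1 - x)) / ((w - q₂) * (1 - w)) =
        1 / w * (s * w / (w - q₂) * ((w ^ 2 - q₂) * (1 - x)) +
          s * ((w ^ 2 - q₂) * (1 - x)) / ((w - q₂) * (1 - w)) * w ^ 2) := by
      field_simp; ring
    refine le_trans ?_ e1.symm.le
    gcongr
  · rw [e]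
    have e2 : U * (s * w / (w - q₂) + s * ((w ^ 2 - q₂) * (1 - x)) / ((w - q₂) * (1 - w))) =
        U ^ 2 * (1 - (w ^ 2 - q₂) / (w - q₂) * x) * s := by
      rw [hUw]; field_simp; ring
    -- The quotient decreases in `q₂ ≤ w⁴`, so it is at least `w(1 + w)/(1 + w + w²)`, which is
    -- `3/7` at `w = 1/2` and increases with `w`.
    have e3 : 2 / 5 ≤ (w ^ 2 - q₂) / (w - q₂) := by
      rw [le_div_iff₀ hwq]
      nlinarith [mul_nonneg hw0.le (mul_nonneg h1w.le (show 0 ≤ 3 * w ^ 2 + 3 * w - 2 by nlinarith))]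
    rw [e2]
    gcongr
  · rw [e]
    have : s ≤ s * w / (w - q₂) := by rw [le_div_iff₀ hwq]; nlinarith
    gcongr

set_option maxHeartbeats 2000000 in
/-- Choice of the parameters of the MM-SAGA potential; `y + 1/2` is the smallest admissible `μ/L`. -/
theorem exists_saga_parameters {n b : ℕ} (hb : 1 ≤ b) (hbn : b ≤ n) {y : ℝ}
    (hy : y = Real.sqrt (2 * n * (2 * n - b) / b ^ 3)) :
    ∃ A₁ A₂ Γ₁ Γ₂ a g c : ℝ, 0 < Γ₁ ∧ 0 < Γ₂ ∧
      IsSagaWeight (1 / (b * (y + 1 / 2))) ((1 - 1 / (n : ℝ)) ^ b) A₁ A₂ Γ₁ Γ₂ a g c ∧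
      ((A₁ = (1 - 1 / (n : ℝ)) ^ b * (1 - (1 - 1 / (n : ℝ)) ^ b) ∧
          A₂ = ((1 - 1 / (n : ℝ)) ^ b) ^ 2) ∨
        (A₁ = ((1 - 1 / (n : ℝ)) ^ b - (1 - 2 / (n : ℝ)) ^ b) * (1 - 1 / (n : ℝ)) ∧
          A₂ = (1 - 2 / (n : ℝ)) ^ b)) ∧
      (Γ₁ + 1 / (24 * Γ₁) + 1 / (16 * Γ₂) ≤ y + 1 / 2 ∨
        Γ₁ + 1 / 4 + 1 / (16 * (Γ₂ + 1 / 4)) ≤ y + 1 / 2) := by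
  have hb1 : (1 : ℝ) ≤ b := by exact_mod_cast hb
  have hb0 : (0 : ℝ) < b := by linarith
  have hbn' : (b : ℝ) ≤ n := by exact_mod_cast hbn
  have hn0 : (0 : ℝ) < n := by linarith
  set q : ℝ := (1 - 1 / (n : ℝ)) ^ b with hqdef
  have hn1 : 1 / (n : ℝ) ≤ 1 := by rw [div_le_one hn0]; linarith
  have hq : 0 ≤ q := pow_nonneg (by linarith) b
  -- In terms of `h` one has `y = √(h² - h)/√b`, hence `b μ² = (√(h² - h) + √b/2)²`. The bound on
  -- `q` will be `(1 - 1/U)²` with `U = h + 1/2 - 1/b + 1/(10h)`, so the target is essentially `U² ≤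
  -- b μ²` with some room for the lower-order terms.
  obtain ⟨h, hh⟩ : ∃ h : ℝ, h = 2 * n / b := ⟨_, rfl⟩
  have hh2 : 2 ≤ h := by rw [hh, le_div_iff₀ hb0]; linarith
  have hh0 : 0 < h := by linarith
  have hnh : (n : ℝ) = b * h / 2 := by rw [hh]; field_simp
  obtain ⟨Y, hY⟩ : ∃ Y, Y = Real.sqrt (h ^ 2 - h) := ⟨_, rfl⟩
  have hYlow : h - 1 / 2 - 172 / 1000 / h ≤ Y := hY ▸ sub_le_sqrt_sq_sub hh2
  have hYlow' : (h ^ 2 - 1 / 2 * h - 172 / 1000) / h ≤ Y := by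
    refine le_trans (le_of_eq ?_) hYlow
    field_simp
  obtain ⟨r, hr⟩ : ∃ r, r = Real.sqrt b := ⟨_, rfl⟩
  have hr0 : 0 < r := hr ▸ Real.sqrt_pos.2 hb0
  have hrr : r ^ 2 = b := by rw [hr]; exact Real.sq_sqrt hb0.le
  have hy' : y = Y / r := by
    rw [hy, hY, hr, ← Real.sqrt_div (by nlinarith only [hh2]), hnh]
    congr 1
    field_simp
  have hYnum : 0 < h ^ 2 - 1 / 2 * h - 172 / 1000 := by nlinarith only [hh2]
  have hY0 : 0 < Y := lt_of_lt_of_le (by positivity) hYlow'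
  have hy0 : 0 < y := hy' ▸ by positivity
  obtain ⟨μ, hμ⟩ : ∃ μ, μ = y + 1 / 2 := ⟨_, rfl⟩
  have hμ0 : 0 < μ := by linarith
  rw [← hμ]
  have hM : (b : ℝ) * μ ^ 2 = (Y + r / 2) ^ 2 := by rw [hμ, hy', ← hrr]; field_simp
  -- the bound for `q`
  obtain ⟨U, hU⟩ : ∃ U : ℝ, U = (h ^ 2 + (1 / 2 - 1 / (b : ℝ)) * h + 1 / 10) / h := ⟨_, rfl⟩
  have hib : 1 / (b : ℝ) ≤ 1 := by rw [div_le_one hb0]; exact hb1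
  have hib0 : 0 < 1 / (b : ℝ) := by positivity
  have hnum : 0 < h ^ 2 + (1 / 2 - 1 / (b : ℝ)) * h + 1 / 10 := by
    linarith [mul_pos hh0 (show 0 < h + (1 / 2 - 1 / (b : ℝ)) by linarith)]
  have hU32 : h - 1 / 2 ≤ U := by
    rw [hU, le_div_iff₀ hh0]; linarith [mul_nonneg hh0.le (sub_nonneg.2 hib)]
  have hU0 : 0 < U := by linarith
  have hqU : q ≤ (1 - 1 / U) ^ 2 := by
    have := one_sub_div_pow_le hb (t := 2 / h) (by positivity) (by rw [div_le_one hh0]; exact hh2)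
    have e1 : 2 / h / b = 1 / (n : ℝ) := by rw [hnh]; field_simp
    rw [e1] at this
    refine this.trans (le_of_eq ?_)
    congr 1
    have e2 : 2 + (1 / 2 - 1 / (b : ℝ)) * (2 / h) + (2 / h) ^ 2 / 20 = 2 / h * U := by
      rw [hU]; field_simp; ring
    have e3 : 2 - (1 / 2 + 1 / (b : ℝ)) * (2 / h) + (2 / h) ^ 2 / 20 = 2 / h * (U - 1) := by
      rw [hU]; field_simp; ring
    rw [e2, e3]
    field_simp
  have hs : 0 < 1 / (b * μ) := by positivity
  have hsmul : ∀ β : ℝ, 0 ≤ β → β ^ 2 ≤ b →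
      ((h ^ 2 + (β / 2 - 1 / 2) * h - 172 / 1000) / h) ^ 2 ≤ b * μ ^ 2 := by
    intro β hβ0 hβ
    rw [hM]
    have h1 : β ≤ r := by rw [hr]; exact Real.le_sqrt_of_sq_le hβ
    have h2 : (h ^ 2 + (β / 2 - 1 / 2) * h - 172 / 1000) / h =
        (h ^ 2 - 1 / 2 * h - 172 / 1000) / h + β / 2 := by field_simp; ring
    rw [h2]
    gcongr
  -- For `b = 1` and `6 ≤ b < 20` the Jensen bound on the variance suffices; for `2 ≤ b ≤ 5` the
  -- exact variance is used. For large `b` the value `Γ₁` can be small, so that `1/(24 Γ₁)` is too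
  -- costly; the second smoothness inequality has no such term and its constant tends to `1/2` as
  -- `Γ₁, Γ₂ → 0`.
  rcases lt_or_ge b 20 with hb20 | hb20
  · by_cases hcase : b = 1 ∨ 6 ≤ b
    · -- one-parameter weights
      obtain ⟨β, hβ0, hβ, hpoly⟩ := exists_sqrt_lower_bound_poly (b := b) (by omega)
      have hp := hpoly h hh2
      have hm := hsmul β hβ0 hβ
      obtain ⟨a, g, c, hw⟩ := exists_isSagaWeight hs hq (by linarith) hqU
      have hT : 0 < 3 * U ^ 2 - 3 * U + 1 := by
        rw [show 3 * U ^ 2 - 3 * U + 1 = 3 * (U - 1 / 2) ^ 2 + 1 / 4 by ring]; positivity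
      refine ⟨_, _, _, _, a, g, c, by positivity, by positivity, hw, Or.inl ⟨rfl, rfl⟩, Or.inl ?_⟩
      have huU : h ^ 2 + (1 / 2 - 1 / (b : ℝ)) * h + 1 / 10 = U * h := by rw [hU]; field_simp
      rw [huU] at hp
      obtain ⟨m, hm'⟩ : ∃ m, m = h ^ 2 + (β / 2 - 1 / 2) * h - 172 / 1000 := ⟨_, rfl⟩
      rw [← hm'] at hp hm
      have hp2 : U ^ 6 ≤ (m / h) ^ 2 *
          (U ^ 4 - b * (U ^ 2 / 24 + (3 * U ^ 2 - 3 * U + 1) / 16)) := by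
        have e : m ^ 2 * ((U * h) ^ 4 - b * h ^ 2 * ((U * h) ^ 2 / 24 + (3 * (U * h) ^ 2 -
            3 * (U * h) * h + h ^ 2) / 16)) = h ^ 6 * ((m / h) ^ 2 *
          (U ^ 4 - b * (U ^ 2 / 24 + (3 * U ^ 2 - 3 * U + 1) / 16))) := by
          field_simp
        rw [e, mul_pow, mul_comm (U ^ 6)] at hp
        exact le_of_mul_le_mul_left hp (by positivity)
      have hin : 0 < U ^ 4 - b * (U ^ 2 / 24 + (3 * U ^ 2 - 3 * U + 1) / 16) := by
        by_contra hcon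
        have : U ^ 6 ≤ 0 := hp2.trans (mul_nonpos_of_nonneg_of_nonpos (sq_nonneg _) (not_lt.1 hcon))
        have : 0 < U ^ 6 := by positivity
        linarith
      have hp3 := hp2.trans (mul_le_mul_of_nonneg_right hm hin.le)
      have e : U ^ 2 * (1 / (b * μ)) + 1 / (24 * (U ^ 2 * (1 / (b * μ)))) +
          1 / (16 * (U ^ 4 * (1 / (b * μ)) / (3 * U ^ 2 - 3 * U + 1))) =
          (U ^ 6 + b * μ ^ 2 * (b * (U ^ 2 / 24 + (3 * U ^ 2 - 3 * U + 1) / 16))) /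
            (b * μ * U ^ 4) := by
        field_simp
        ring
      have e2 : b * μ ^ 2 * (U ^ 4 - b * (U ^ 2 / 24 + (3 * U ^ 2 - 3 * U + 1) / 16)) =
          μ * (b * μ * U ^ 4) - b * μ ^ 2 * (b * (U ^ 2 / 24 + (3 * U ^ 2 - 3 * U + 1) / 16)) := by
        ring
      rw [e, div_le_iff₀ (by positivity)]
      linarith
    · push Not at hcase
      have hb2 : 2 ≤ b := by omega
      have hb2' : (2 : ℝ) ≤ b := by exact_mod_cast hb2
      obtain ⟨β, hβ0, hβ, hpoly⟩ := exists_sqrt_lower_bound_poly_of_le_five hb2 (by omega)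
      obtain ⟨m, hm'⟩ : ∃ m, m = h ^ 2 + (β / 2 - 1 / 2) * h - 172 / 1000 := ⟨_, rfl⟩
      have hp := hpoly h hh2 _ _ m rfl rfl hm'
      have hm := hsmul β hβ0 hβ
      rw [← hm'] at hm
      have hib2 : 1 / (b : ℝ) ≤ 1 / 2 := by gcongr
      have hU2 : 2 ≤ U := by
        refine le_trans hh2 ?_
        rw [hU, le_div_iff₀ hh0]; linarith [mul_nonneg hh0.le (sub_nonneg.2 hib2)]
      have hn2 : 2 / (n : ℝ) ≤ 1 := by rw [div_le_one hn0]; linarith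
      have hq₂ : 0 ≤ (1 - 2 / (n : ℝ)) ^ b := pow_nonneg (by linarith) b
      have hqq : (1 - 2 / (n : ℝ)) ^ b ≤ q ^ 2 := by
        rw [hqdef, ← pow_mul, mul_comm b 2, pow_mul]
        refine pow_le_pow_left₀ (by linarith) ?_ b
        have : 2 / (n : ℝ) = 2 * (1 / n) := by ring
        rw [this]; linarith [sq_nonneg (1 / (n : ℝ)), show (1 - 1 / (n : ℝ)) ^ 2 = 1 - 2 * (1 / n) + (1 / n) ^ 2 by ring]
      obtain ⟨a, g, c, hw⟩ := exists_isSagaWeight_exact (x := 1 / (n : ℝ)) hs hq hU2 hqU hq₂ hqq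
        (by positivity) hn1
      have hr5 : 0 < 1 - 2 / 5 * (1 / (n : ℝ)) := by linarith
      refine ⟨_, _, _, _, a, g, c, by positivity, by positivity, hw, Or.inr ⟨rfl, rfl⟩, Or.inl ?_⟩
      have huU : h ^ 2 + (1 / 2 - 1 / (b : ℝ)) * h + 1 / 10 = U * h := by rw [hU]; field_simp
      rw [huU] at hp
      obtain ⟨v, hv⟩ : ∃ v, v = U ^ 2 * (1 - 2 / 5 * (1 / (n : ℝ))) := ⟨_, rfl⟩
      have hv0 : 0 < v := by rw [hv]; positivity
      have hvh : (U * h) ^ 2 * (h - 4 / (5 * (b : ℝ))) = v * h ^ 3 := by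
        rw [hv, hnh]; field_simp; ring
      rw [hvh] at hp
      rw [← hv]
      have hp2 : 16 * U * v ^ 2 + 2 * b / 3 * U * (m / h) ^ 2 ≤ (m / h) ^ 2 * ((16 * U - b) * v) := by
        have e1 : 16 * (U * h) * (v * h ^ 3) ^ 2 + 2 * b / 3 * (U * h) * m ^ 2 * h ^ 4 =
            h ^ 7 * (16 * U * v ^ 2 + 2 * b / 3 * U * (m / h) ^ 2) := by field_simp
        have e2 : m ^ 2 * (16 * (U * h) - b * h) * (v * h ^ 3) * h =
            h ^ 7 * ((m / h) ^ 2 * ((16 * U - b) * v)) := by field_simp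
        rw [e1, e2] at hp
        exact le_of_mul_le_mul_left hp (by positivity)
      have hin : 0 < (16 * U - b) * v - 2 * b / 3 * U := by
        by_contra hcon
        have h1 : 0 < 16 * U * v ^ 2 := by positivity
        have h2 := mul_nonpos_of_nonneg_of_nonpos (sq_nonneg (m / h)) (not_lt.1 hcon)
        have e : (m / h) ^ 2 * ((16 * U - b) * v - 2 * b / 3 * U) =
          (m / h) ^ 2 * ((16 * U - b) * v) - 2 * b / 3 * U * (m / h) ^ 2 := by ring
        linarith
      have hp3 : 16 * U * v ^ 2 ≤ b * μ ^ 2 * ((16 * U - b) * v - 2 * b / 3 * U) := by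
        refine le_trans ?_ (mul_le_mul_of_nonneg_right hm hin.le)
        have e : (m / h) ^ 2 * ((16 * U - b) * v - 2 * b / 3 * U) =
          (m / h) ^ 2 * ((16 * U - b) * v) - 2 * b / 3 * U * (m / h) ^ 2 := by ring
        linarith
      have e : v * (1 / (b * μ)) + 1 / (24 * (v * (1 / (b * μ)))) +
          1 / (16 * (U * (1 / (b * μ)))) =
          (16 * U * v ^ 2 + b * μ ^ 2 * (2 * b / 3 * U + b * v)) / (b * μ * (16 * U * v)) := by
        field_simp
        ring
      have e2 : b * μ ^ 2 * ((16 * U - b) * v - 2 * b / 3 * U) =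
          μ * (b * μ * (16 * U * v)) - b * μ ^ 2 * (2 * b / 3 * U + b * v) := by ring
      rw [e, div_le_iff₀ (by positivity)]
      linarith
  · -- large batches
    have hb20' : (20 : ℝ) ≤ b := by exact_mod_cast hb20
    obtain ⟨Z, hZ⟩ : ∃ Z : ℝ, Z = (h ^ 2 + 1 / 2 * h + 1 / 10) / h := ⟨_, rfl⟩
    have hUZ : U ≤ Z := by rw [hU, hZ]; gcongr; linarith
    have hZ0 : 0 < Z := by linarith
    have hZ1 : 1 < Z := by linarith
    have hqZ : q ≤ (1 - 1 / Z) ^ 2 := by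
      refine hqU.trans ?_
      have h1 : 1 / U ≤ 1 := by rw [div_le_one hU0]; linarith
      have h2 : 1 / Z ≤ 1 / U := by gcongr
      gcongr
    obtain ⟨a, g, c, hw⟩ := exists_isSagaWeight hs hq hZ1 hqZ
    obtain ⟨T, hT⟩ : ∃ T, T = 3 * Z ^ 2 - 3 * Z + 1 := ⟨_, rfl⟩
    have hT0 : 0 < T := by
      rw [hT, show 3 * Z ^ 2 - 3 * Z + 1 = 3 * (Z - 1 / 2) ^ 2 + 1 / 4 by ring]; positivity
    have hTZ : Z ^ 2 ≤ T := by
      have : T - Z ^ 2 = (2 * Z - 1) * (Z - 1) := by rw [hT]; ring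
      have h1 : 0 ≤ (2 * Z - 1) * (Z - 1) := mul_nonneg (by linarith) (by linarith)
      linarith
    rw [← hT] at hw
    refine ⟨_, _, _, _, a, g, c, by positivity, by positivity, hw, Or.inl ⟨rfl, rfl⟩, Or.inr ?_⟩
    obtain ⟨η, hη⟩ : ∃ η : ℝ, η = h ^ 2 - 1 / 2 * h - 172 / 1000 := ⟨_, rfl⟩
    obtain ⟨m, hm⟩ : ∃ m : ℝ, m = η + 447 / 200 * h := ⟨_, rfl⟩
    have hp := poly_of_twenty_le hh2 rfl hη hm
    have huZ : h ^ 2 + 1 / 2 * h + 1 / 10 = Z * h := by rw [hZ]; field_simp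
    rw [huZ] at hp
    rw [← hη] at hYnum hYlow'
    have hm0 : 0 < m := by rw [hm]; positivity
    obtain ⟨E₀, hE₀⟩ : ∃ E₀, E₀ = m / h * (447 / 100) := ⟨_, rfl⟩
    have hE₀0 : 0 < E₀ := by rw [hE₀]; positivity
    have hp2 : Z ^ 2 * (4 * Z ^ 4 + (T - Z ^ 2) * E₀) ≤ η / h * (m / h) * (4 * Z ^ 4 + T * E₀) := by
      have e1 : (Z * h) ^ 2 * (4 * (Z * h) ^ 4 + (2 * (Z * h) ^ 2 - 3 * (Z * h) * h + h ^ 2) *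
          (m * (447 / 100) * h)) = h ^ 6 * (Z ^ 2 * (4 * Z ^ 4 + (T - Z ^ 2) * E₀)) := by
        rw [hE₀, hT]; field_simp; ring
      have e2 : η * m * (4 * (Z * h) ^ 4 + (3 * (Z * h) ^ 2 - 3 * (Z * h) * h + h ^ 2) *
          (m * (447 / 100) * h)) = h ^ 6 * (η / h * (m / h) * (4 * Z ^ 4 + T * E₀)) := by
        rw [hE₀, hT]; field_simp
      rw [e1, e2] at hp
      exact le_of_mul_le_mul_left hp (by positivity)
    obtain ⟨E, hE⟩ : ∃ E, E = b * μ := ⟨_, rfl⟩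
    have hr447 : 447 / 100 ≤ r := by
      rw [hr]; exact Real.le_sqrt_of_sq_le (by norm_num; linarith)
    have hmY : m / h ≤ Y + r / 2 := by
      have : m / h = η / h + 447 / 200 := by rw [hm]; field_simp
      rw [this]; linarith
    have hEr : E = (Y + r / 2) * r := by rw [hE, hμ, hy', ← hrr]; field_simp
    have hEE : E₀ ≤ E := by
      rw [hE₀, hEr]; gcongr
    have hE0 : 0 < E := by linarith
    have hyE : η / h * (m / h) ≤ y * E := by
      have : y * E = Y * (Y + r / 2) := by rw [hEr, hy']; field_simp
      rw [this]; gcongr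
    have hTZ' : 0 ≤ T - Z ^ 2 := by linarith
    have hp3 : Z ^ 2 * (4 * Z ^ 4 + (T - Z ^ 2) * E) ≤ y * E * (4 * Z ^ 4 + T * E) := by
      -- The quotient `(4Z⁴ + (T - Z²)E)/(4Z⁴ + TE)` decreases in `E`, so the inequality passes from
      -- the lower bound `E₀` to `E`; it is cross-multiplied here.
      have h1 : (4 * Z ^ 4 + (T - Z ^ 2) * E) * (4 * Z ^ 4 + T * E₀) ≤
          (4 * Z ^ 4 + (T - Z ^ 2) * E₀) * (4 * Z ^ 4 + T * E) := by
        have h0 : 0 ≤ 4 * Z ^ 6 * (E - E₀) := mul_nonneg (by positivity) (sub_nonneg.2 hEE)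
        have e : (4 * Z ^ 4 + (T - Z ^ 2) * E₀) * (4 * Z ^ 4 + T * E) -
          (4 * Z ^ 4 + (T - Z ^ 2) * E) * (4 * Z ^ 4 + T * E₀) = 4 * Z ^ 6 * (E - E₀) := by ring
        linarith
      have h2 : 0 < 4 * Z ^ 4 + T * E₀ := by positivity
      have h3 : 0 < 4 * Z ^ 4 + T * E := by positivity
      have h4 : Z ^ 2 * (4 * Z ^ 4 + (T - Z ^ 2) * E) * (4 * Z ^ 4 + T * E₀) ≤
          y * E * (4 * Z ^ 4 + T * E) * (4 * Z ^ 4 + T * E₀) := by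
        calc Z ^ 2 * (4 * Z ^ 4 + (T - Z ^ 2) * E) * (4 * Z ^ 4 + T * E₀)
            = Z ^ 2 * ((4 * Z ^ 4 + (T - Z ^ 2) * E) * (4 * Z ^ 4 + T * E₀)) := by ring
          _ ≤ Z ^ 2 * ((4 * Z ^ 4 + (T - Z ^ 2) * E₀) * (4 * Z ^ 4 + T * E)) := by gcongr
          _ = Z ^ 2 * (4 * Z ^ 4 + (T - Z ^ 2) * E₀) * (4 * Z ^ 4 + T * E) := by ring
          _ ≤ η / h * (m / h) * (4 * Z ^ 4 + T * E₀) * (4 * Z ^ 4 + T * E) := by gcongr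
          _ ≤ y * E * (4 * Z ^ 4 + T * E₀) * (4 * Z ^ 4 + T * E) := by gcongr
          _ = _ := by ring
      exact le_of_mul_le_mul_right h4 h2
    rw [← hE, hμ]
    have e : Z ^ 2 * (1 / E) + 1 / 4 + 1 / (16 * (Z ^ 4 * (1 / E) / T + 1 / 4)) =
        1 / 2 + Z ^ 2 * (4 * Z ^ 4 + (T - Z ^ 2) * E) / (E * (4 * Z ^ 4 + T * E)) := by
      have h3 : 4 * Z ^ 4 + T * E ≠ 0 := by positivity
      have h5 : Z ^ 4 * (1 / E) / T + 1 / 4 = (4 * Z ^ 4 + T * E) / (4 * (E * T)) := by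
        field_simp
      rw [h5]
      field_simp
      ring
    have h6 : Z ^ 2 * (4 * Z ^ 4 + (T - Z ^ 2) * E) / (E * (4 * Z ^ 4 + T * E)) ≤ y := by
      rw [div_le_iff₀ (by positivity)]; linarith
    rw [e]; linarith

end SVRMM

namespace SVRMM

/-! ### The majorization-minimization step -/

variable {d : ℕ}

/-- A minimizer of `μ/2 ‖z - x‖² + ⟪g, z⟫ + u(z, x)` is finite and satisfies the strong convexity
inequality. -/
theorem IsMMStep.strong {u : Space d → Space d → EReal} {μ : ℝ} {x g x' : Space d}
    (hconv : IsConvexFun fun z => u z x) (hbot : ∀ z, u z x ≠ ⊥) (hx : u x x ≠ ⊤)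
    (h : IsMMStep u μ x g x') :
    u x' x ≠ ⊤ ∧ ∀ z, u z x ≠ ⊤ →
      μ / 2 * ‖x' - x‖ ^ 2 + inner ℝ g x' + (u x' x).toReal + μ / 2 * ‖z - x'‖ ^ 2 ≤
        μ / 2 * ‖z - x‖ ^ 2 + inner ℝ g z + (u z x).toReal := by
  have hfin : u x' x ≠ ⊤ := by
    intro htop
    have h1 := h (Set.mem_univ x)
    simp only [Set.mem_ofPred_eq] at h1
    rw [htop, EReal.coe_add_top, top_le_iff] at h1
    lift u x x to ℝ using ⟨hx, hbot x⟩ with a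
    rw [← EReal.coe_add] at h1
    exact EReal.coe_ne_top _ h1
  refine ⟨hfin, fun z hz => ?_⟩
  obtain ⟨B, hB⟩ : ∃ B : ℝ, u x' x = B := ⟨_, (EReal.coe_toReal hfin (hbot x')).symm⟩
  obtain ⟨A, hA⟩ : ∃ A : ℝ, u z x = A := ⟨_, (EReal.coe_toReal hz (hbot z)).symm⟩
  rw [hA, hB, EReal.toReal_coe, EReal.toReal_coe]
  -- Compare `x'` with a point of the segment towards `z`: strong convexity of the quadratic leaves
  -- a factor `1 - t` after division by `t`, and `t → 0` removes it.
  have key : ∀ t : ℝ, 0 < t → t < 1 →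
      μ / 2 * ‖x' - x‖ ^ 2 + inner ℝ g x' + B + μ / 2 * ‖z - x'‖ ^ 2 * (1 - t) ≤
        μ / 2 * ‖z - x‖ ^ 2 + inner ℝ g z + A := by
    intro t ht0 ht1
    have h1 := h (Set.mem_univ ((1 - t) • x' + t • z))
    have h2 := hconv x' z (1 - t) t (by linarith) ht0.le (by ring)
    simp only [Set.mem_ofPred_eq] at h1
    simp only [hA, hB] at h1 h2
    have h3 := h1.trans (add_le_add_right h2 _)
    norm_cast at h3
    have e : μ / 2 * ‖(1 - t) • x' + t • z - x‖ ^ 2 =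
        (1 - t) * (μ / 2 * ‖x' - x‖ ^ 2) + t * (μ / 2 * ‖z - x‖ ^ 2) -
          t * (1 - t) * (μ / 2 * ‖z - x'‖ ^ 2) := by
      have e1 : (1 - t) • x' + t • z - x = (1 - t) • (x' - x) + t • (z - x) := by module
      have e2 : z - x' = (z - x) - (x' - x) := by abel
      rw [e1, e2, norm_add_sq_real, norm_sub_sq_real (z - x), norm_smul, norm_smul, mul_pow,
        mul_pow, inner_smul_left, inner_smul_right, real_inner_comm (x' - x) (z - x)]
      simp only [Real.norm_eq_abs, sq_abs, RCLike.conj_to_real]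
      ring
    rw [e, inner_add_right, inner_smul_right, inner_smul_right] at h3
    have h4 : t * (μ / 2 * ‖x' - x‖ ^ 2 + inner ℝ g x' + B + μ / 2 * ‖z - x'‖ ^ 2 * (1 - t)) ≤
        t * (μ / 2 * ‖z - x‖ ^ 2 + inner ℝ g z + A) := by linarith
    exact le_of_mul_le_mul_left h4 ht0
  have hlim : Tendsto (fun t : ℝ => μ / 2 * ‖x' - x‖ ^ 2 + inner ℝ g x' + B +
      μ / 2 * ‖z - x'‖ ^ 2 * (1 - t)) (𝓝[>] 0) (𝓝 (μ / 2 * ‖x' - x‖ ^ 2 + inner ℝ g x' + B +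
      μ / 2 * ‖z - x'‖ ^ 2 * (1 - 0))) := by
    apply Tendsto.mono_left _ nhdsWithin_le_nhds
    apply Continuous.tendsto
    fun_prop
  rw [sub_zero, mul_one] at hlim
  refine le_of_tendsto hlim ?_
  filter_upwards [Ioo_mem_nhdsGT (show (0 : ℝ) < 1 by norm_num)] with t ht
  exact key t ht.1 ht.2

/-- Each minimizer is tested against the other in the strong convexity inequality, and the two
results are added. Uniqueness and the `1/μ`-Lipschitz dependence on the gradient estimate follow. -/
theorem IsMMStep.mul_norm_sq_le {u : Space d → Space d → EReal} {μ : ℝ} {x g g' y y' : Space d}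
    (hconv : IsConvexFun fun z => u z x) (hbot : ∀ z, u z x ≠ ⊥) (hx : u x x ≠ ⊤)
    (h : IsMMStep u μ x g y) (h' : IsMMStep u μ x g' y') :
    μ * ‖y - y'‖ ^ 2 ≤ inner ℝ (g - g') (y' - y) := by
  obtain ⟨f1, s1⟩ := h.strong hconv hbot hx
  obtain ⟨f2, s2⟩ := h'.strong hconv hbot hx
  have a1 := s1 y' f2
  have a2 := s2 y f1
  rw [norm_sub_rev y' y] at a1
  simp only [inner_sub_left, inner_sub_right]
  linarith

theorem IsMMStep.unique {u : Space d → Space d → EReal} {μ : ℝ} {x g y y' : Space d} (hμ : 0 < μ)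
    (hconv : IsConvexFun fun z => u z x) (hbot : ∀ z, u z x ≠ ⊥) (hx : u x x ≠ ⊤)
    (h : IsMMStep u μ x g y) (h' : IsMMStep u μ x g y') : y = y' := by
  have := h.mul_norm_sq_le hconv hbot hx h'
  rw [sub_self, inner_zero_left] at this
  have h2 : ‖y - y'‖ ^ 2 ≤ 0 := by nlinarith
  rwa [sq_nonpos_iff, norm_eq_zero, sub_eq_zero] at h2

theorem IsMMStep.norm_sub_le {u : Space d → Space d → EReal} {μ : ℝ} {x g g' y y' : Space d}
    (hμ : 0 < μ) (hconv : IsConvexFun fun z => u z x) (hbot : ∀ z, u z x ≠ ⊥) (hx : u x x ≠ ⊤)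
    (h : IsMMStep u μ x g y) (h' : IsMMStep u μ x g' y') : ‖y - y'‖ ≤ ‖g - g'‖ / μ := by
  have h1 := h.mul_norm_sq_le hconv hbot hx h'
  have h2 := real_inner_le_norm (g - g') (y' - y)
  rw [norm_sub_rev y' y] at h2
  rw [le_div_iff₀ hμ]
  rcases eq_or_lt_of_le (norm_nonneg (y - y')) with h0 | h0
  · rw [← h0, zero_mul]; exact norm_nonneg _
  · exact le_of_mul_le_mul_right (by nlinarith) h0

/-- A lower semicontinuous convex function that is finite somewhere has an affine lower bound in
the norm. -/
theorem IsConvexFun.exists_norm_lower_bound {φ : Space d → EReal} (hconv : IsConvexFun φ)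
    (hlsc : LowerSemicontinuous φ) (hbot : ∀ z, φ z ≠ ⊥) {x : Space d} (hx : φ x ≠ ⊤) :
    ∃ C : ℝ, 0 ≤ C ∧ ∀ z, ((-C * (1 + ‖z - x‖) : ℝ) : EReal) ≤ φ z := by
  obtain ⟨p, -, hp⟩ := (hlsc.lowerSemicontinuousOn (Metric.closedBall x 1)).exists_isMinOn
    (Metric.nonempty_closedBall.2 zero_le_one) (isCompact_closedBall x 1)
  obtain ⟨a, ha⟩ : ∃ a : ℝ, φ x = a := ⟨_, (EReal.coe_toReal hx (hbot x)).symm⟩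
  have hpx : φ p ≤ φ x := hp (Metric.mem_closedBall_self zero_le_one)
  obtain ⟨m, hm⟩ : ∃ m : ℝ, φ p = m :=
    ⟨_, (EReal.coe_toReal (ne_top_of_le_ne_top hx hpx) (hbot p)).symm⟩
  have hball : ∀ z, ‖z - x‖ ≤ 1 → (m : EReal) ≤ φ z := by
    intro z hz
    rw [← hm]
    exact hp (by rwa [Metric.mem_closedBall, dist_eq_norm])
  have hC1 : -(|m| + |a|) ≤ m := by linarith [neg_abs_le m, abs_nonneg a]
  refine ⟨|m| + |a|, by positivity, fun z => ?_⟩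
  rcases le_or_gt ‖z - x‖ 1 with hz | hz
  · refine le_trans (EReal.coe_le_coe_iff.2 ?_) (hball z hz)
    nlinarith [norm_nonneg (z - x), abs_nonneg m, abs_nonneg a]
  · by_cases hzt : φ z = ⊤
    · rw [hzt]; exact le_top
    obtain ⟨b, hb⟩ : ∃ b : ℝ, φ z = b := ⟨_, (EReal.coe_toReal hzt (hbot z)).symm⟩
    obtain ⟨R, hR⟩ : ∃ R, R = ‖z - x‖ := ⟨_, rfl⟩
    rw [← hR] at hz ⊢
    have hR0 : 0 < R := by linarith
    -- The point of the segment from `x` to `z` at distance `1` from `x` lies in the ball where `m`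
    -- is a lower bound; convexity turns this into a bound at `z`.
    have h1 := hconv x z (1 - 1 / R) (1 / R)
      (by rw [sub_nonneg, div_le_one hR0]; exact hz.le) (by positivity) (by ring)
    have h2 := hball ((1 - 1 / R) • x + (1 / R) • z) (by
      rw [show (1 - 1 / R) • x + (1 / R) • z - x = (1 / R) • (z - x) by module, norm_smul, ← hR,
        Real.norm_of_nonneg (by positivity)]
      exact le_of_eq (by field_simp))
    have h3 := h2.trans h1
    rw [ha, hb] at h3
    norm_cast at h3
    rw [hb]
    refine EReal.coe_le_coe_iff.2 ?_
    have h4 : R * m ≤ (R - 1) * a + b := by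
      have := mul_le_mul_of_nonneg_left h3 hR0.le
      have e : R * ((1 - 1 / R) * a + 1 / R * b) = (R - 1) * a + b := by field_simp
      linarith
    have h5 : (R - 1) * a ≤ (R - 1) * |a| := mul_le_mul_of_nonneg_left (le_abs_self a) (by linarith)
    have h6 : -(R * |m|) ≤ R * m := by nlinarith [neg_abs_le m]
    nlinarith [abs_nonneg m, abs_nonneg a]

/-- The quadratic dominates the norm-affine lower bound of `u(·, x)`, so outside a large ball the
objective exceeds its value at `x`; inside, lower semicontinuity and compactness give a minimizer.
-/
theorem exists_isMMStep {u : Space d → Space d → EReal} {μ : ℝ} (hμ : 0 < μ) {x : Space d}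
    (g : Space d) (hconv : IsConvexFun fun z => u z x) (hlsc : LowerSemicontinuous fun z => u z x)
    (hbot : ∀ z, u z x ≠ ⊥) (hx : u x x ≠ ⊤) : ∃ x', IsMMStep u μ x g x' := by
  obtain ⟨C, hC0, hC⟩ := hconv.exists_norm_lower_bound hlsc hbot hx
  obtain ⟨a, ha⟩ : ∃ a : ℝ, u x x = a := ⟨_, (EReal.coe_toReal hx (hbot x)).symm⟩
  set Q : Space d → ℝ := fun z => μ / 2 * ‖z - x‖ ^ 2 + inner ℝ g z with hQ
  have hQc : Continuous Q := by fun_prop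
  have hΨ : LowerSemicontinuous fun z => (Q z : EReal) + u z x := by
    refine LowerSemicontinuous.add' (continuous_coe_real_ereal.comp hQc).lowerSemicontinuous hlsc ?_
    intro z
    exact EReal.continuousAt_add (Or.inl (EReal.coe_ne_top _)) (Or.inl (EReal.coe_ne_bot _))
  obtain ⟨ρ, hρ0, hρ⟩ : ∃ ρ : ℝ, 0 < ρ ∧ ∀ s : ℝ, ρ < s → a + C < μ / 2 * s ^ 2 - (‖g‖ + C) * s := by
    refine ⟨2 / μ * (‖g‖ + C + 1 + |a + C|) + 1, by positivity, fun s hs => ?_⟩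
    have hs1 : 1 < s := by
      have : 0 ≤ 2 / μ * (‖g‖ + C + 1 + |a + C|) := by positivity
      linarith
    have h1 : ‖g‖ + C + 1 + |a + C| < μ / 2 * s := by
      have : 2 / μ * (‖g‖ + C + 1 + |a + C|) < s := by linarith
      calc ‖g‖ + C + 1 + |a + C| = μ / 2 * (2 / μ * (‖g‖ + C + 1 + |a + C|)) := by field_simp
        _ < _ := by gcongr
    have h2 : (1 + |a + C|) * s < (μ / 2 * s - (‖g‖ + C)) * s := by gcongr; linarith
    have h3 : |a + C| ≤ |a + C| * s := le_mul_of_one_le_right (abs_nonneg _) hs1.le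
    nlinarith [le_abs_self (a + C)]
  obtain ⟨p, -, hp⟩ := (hΨ.lowerSemicontinuousOn (Metric.closedBall x ρ)).exists_isMinOn
    (Metric.nonempty_closedBall.2 hρ0.le) (isCompact_closedBall x ρ)
  refine ⟨p, fun z _ => ?_⟩
  rcases le_or_gt ‖z - x‖ ρ with hz | hz
  · exact hp (by rwa [Metric.mem_closedBall, dist_eq_norm])
  · have h1 : (Q p : EReal) + u p x ≤ (Q x : EReal) + u x x :=
      hp (Metric.mem_closedBall_self hρ0.le)
    refine h1.trans ?_
    have h2 : (Q z : EReal) + ((-C * (1 + ‖z - x‖) : ℝ) : EReal) ≤ Q z + u z x :=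
      add_le_add_right (hC z) _
    refine le_trans ?_ h2
    rw [ha]
    norm_cast
    have h3 := hρ _ hz
    have h4 : -(‖g‖ * ‖z - x‖) ≤ inner ℝ g (z - x) := by
      have := abs_real_inner_le_norm g (z - x)
      rw [abs_le] at this
      exact this.1
    rw [inner_sub_right] at h4
    simp only [hQ, sub_self, norm_zero]
    nlinarith

end SVRMM

noncomputable section

namespace SVRMM

variable {d n : ℕ}

/-! ### Means of finite families of vectors -/

/-- The mean of a family of vectors. -/
def mean (D : Fin n → Space d) : Space d := (1 / (n : ℝ)) • ∑ i, D i

/-- The mean squared norm of a family of vectors. -/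
def meanSq (D : Fin n → Space d) : ℝ := (1 / (n : ℝ)) * ∑ i, ‖D i‖ ^ 2

theorem meanSq_nonneg (D : Fin n → Space d) : 0 ≤ meanSq D := by unfold meanSq; positivity

theorem meanSq_sub_mean (hn : 1 ≤ n) (D : Fin n → Space d) :
    meanSq (fun i => D i - mean D) = meanSq D - ‖mean D‖ ^ 2 := by
  have hn0 : (n : ℝ) ≠ 0 := by positivity
  have h1 : ∑ i, inner ℝ (D i) (mean D) = n * ‖mean D‖ ^ 2 := by
    rw [← sum_inner, ← real_inner_self_eq_norm_sq]
    nth_rw 2 [mean]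
    rw [real_inner_smul_left]
    field_simp
  simp only [meanSq, norm_sub_sq_real, Finset.sum_add_distrib, Finset.sum_sub_distrib,
    ← Finset.mul_sum, h1, Finset.sum_const, Finset.card_univ, Fintype.card_fin, nsmul_eq_mul]
  field_simp
  ring

theorem norm_mean_sq_le (hn : 1 ≤ n) (D : Fin n → Space d) : ‖mean D‖ ^ 2 ≤ meanSq D := by
  have := meanSq_nonneg fun i => D i - mean D
  rw [meanSq_sub_mean hn] at this
  linarith

theorem mean_add (X Y : Fin n → Space d) : mean (fun i => X i + Y i) = mean X + mean Y := by
  simp [mean, Finset.sum_add_distrib]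

theorem mean_sub (X Y : Fin n → Space d) : mean (fun i => X i - Y i) = mean X - mean Y := by
  simp [mean, Finset.sum_sub_distrib, smul_sub]

theorem norm_add_sq_le_young {E : Type*} [NormedAddCommGroup E] [InnerProductSpace ℝ E] {c : ℝ}
    (hc : 0 < c) (x y : E) : ‖x + y‖ ^ 2 ≤ (1 + 1 / c) * ‖x‖ ^ 2 + (1 + c) * ‖y‖ ^ 2 := by
  rw [norm_add_sq_real]
  have h1 := real_inner_le_norm x y
  have h2 : 2 * (‖x‖ * ‖y‖) ≤ 1 / c * ‖x‖ ^ 2 + c * ‖y‖ ^ 2 := by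
    have h3 : 0 ≤ 1 / c * (‖x‖ - c * ‖y‖) ^ 2 := by positivity
    have h4 : 1 / c * (‖x‖ - c * ‖y‖) ^ 2 =
        1 / c * ‖x‖ ^ 2 - 2 * (‖x‖ * ‖y‖) + c * ‖y‖ ^ 2 := by field_simp; ring
    linarith
  linarith

theorem meanSq_add_le {c : ℝ} (hc : 0 < c) (X Y : Fin n → Space d) :
    meanSq (fun i => X i + Y i) ≤ (1 + 1 / c) * meanSq X + (1 + c) * meanSq Y := by
  have : ∑ i, ‖X i + Y i‖ ^ 2 ≤ (1 + 1 / c) * ∑ i, ‖X i‖ ^ 2 + (1 + c) * ∑ i, ‖Y i‖ ^ 2 := by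
    rw [Finset.mul_sum, Finset.mul_sum, ← Finset.sum_add_distrib]
    exact Finset.sum_le_sum fun i _ => norm_add_sq_le_young hc _ _
  unfold meanSq
  calc _ ≤ 1 / (n : ℝ) * _ := mul_le_mul_of_nonneg_left this (by positivity)
    _ = _ := by ring

/-- The mean squared deviation from the mean. -/
def meanVar (D : Fin n → Space d) : ℝ := meanSq D - ‖mean D‖ ^ 2

theorem meanVar_nonneg (hn : 1 ≤ n) (D : Fin n → Space d) : 0 ≤ meanVar D :=
  sub_nonneg.2 (norm_mean_sq_le hn D)

theorem meanVar_add_le (hn : 1 ≤ n) {c : ℝ} (hc : 0 < c) (X Y : Fin n → Space d) :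
    meanVar (fun i => X i + Y i) ≤ (1 + 1 / c) * meanVar X + (1 + c) * meanVar Y := by
  simp only [meanVar, ← meanSq_sub_mean hn]
  refine le_trans (le_of_eq ?_) (meanSq_add_le hc _ _)
  congr 1
  funext i
  rw [mean_add]
  abel

/-! ### Smoothness -/

variable {f : Fin n → Space d → ℝ} {r : Space d → EReal} {L : ℝ}

theorem BasicAssumption.hasGradientAt (h : BasicAssumption f r L) (i : Fin n) (x : Space d) :
    HasGradientAt (f i) (gradient (f i) x) x :=
  ((h.contDiff i).differentiable one_ne_zero x).hasGradientAt

theorem BasicAssumption.hasGradientAt_avg (h : BasicAssumption f r L) (x : Space d) :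
    HasGradientAt (avg f) (mean fun i => gradient (f i) x) x := by
  have h1 : HasFDerivAt (fun x => ∑ i, f i x)
      (∑ i, (InnerProductSpace.toDual ℝ (Space d)) (gradient (f i) x)) x :=
    HasFDerivAt.fun_sum fun i _ => (h.hasGradientAt i x).hasFDerivAt
  have h2 := h1.const_mul (1 / (n : ℝ))
  rw [hasGradientAt_iff_hasFDerivAt]
  refine h2.congr_fderiv ?_
  simp [mean]

theorem BasicAssumption.gradient_avg (h : BasicAssumption f r L) (x : Space d) :
    gradient (avg f) x = mean fun i => gradient (f i) x := (h.hasGradientAt_avg x).gradient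

theorem BasicAssumption.meanSq_le (h : BasicAssumption f r L) (x y : Space d) :
    meanSq (fun i => gradient (f i) x - gradient (f i) y) ≤ L ^ 2 * ‖x - y‖ ^ 2 :=
  h.avg_smooth x y

theorem BasicAssumption.norm_gradient_avg_sub_le (hn : 1 ≤ n) (h : BasicAssumption f r L)
    (x y : Space d) : ‖gradient (avg f) x - gradient (avg f) y‖ ≤ L * ‖x - y‖ := by
  rw [h.gradient_avg, h.gradient_avg, ← mean_sub]
  refine abs_le_of_sq_le_sq' ?_ (mul_nonneg h.L_pos.le (norm_nonneg _)) |>.2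
  rw [mul_pow]
  exact (norm_mean_sq_le hn _).trans (h.meanSq_le x y)

/-- Integrated form of a quadratic bound for a derivative on `[0, 1]`. -/
theorem sub_le_of_deriv_le_quadratic {φ φ' : ℝ → ℝ} {A B C : ℝ} (hφ : ∀ s, HasDerivAt φ (φ' s) s)
    (hle : ∀ s, 0 < s → s < 1 → φ' s ≤ A + B * s + C * (s * (1 - s))) :
    φ 1 - φ 0 ≤ A + B / 2 + C / 6 := by
  have hd : ∀ s, HasDerivAt
      (fun s => φ s - (A * s + B / 2 * s ^ 2 + C * (s ^ 2 / 2 - s ^ 3 / 3)))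
      (φ' s - (A + B * s + C * (s * (1 - s)))) s := by
    intro s
    refine ((hφ s).sub ((((hasDerivAt_id' s).const_mul A).add
      ((hasDerivAt_pow 2 s).const_mul (B / 2))).add
      ((((hasDerivAt_pow 2 s).div_const 2).sub
        ((hasDerivAt_pow 3 s).div_const 3)).const_mul C))).congr_deriv ?_
    norm_num
    ring
  have hanti : AntitoneOn
      (fun s => φ s - (A * s + B / 2 * s ^ 2 + C * (s ^ 2 / 2 - s ^ 3 / 3))) (Set.Icc 0 1) := by
    apply antitoneOn_of_deriv_nonpos (convex_Icc 0 1)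
    · exact fun s _ => (hd s).continuousAt.continuousWithinAt
    · exact fun s _ => (hd s).differentiableAt.differentiableWithinAt
    · intro s hs
      rw [interior_Icc] at hs
      rw [(hd s).deriv]
      linarith [hle s hs.1 hs.2]
  have := hanti (Set.left_mem_Icc.2 zero_le_one) (Set.right_mem_Icc.2 zero_le_one) zero_le_one
  norm_num at this
  linarith

theorem BasicAssumption.hasDerivAt_line (h : BasicAssumption f r L) (x v : Space d) (s : ℝ) :
    HasDerivAt (fun s : ℝ => avg f (x + s • v)) (inner ℝ (gradient (avg f) (x + s • v)) v) s := by
  have h1 := (h.hasGradientAt_avg (x + s • v)).hasFDerivAt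
  have h2 : HasDerivAt (fun s : ℝ => x + s • v) v s := by
    simpa using ((hasDerivAt_id' s).smul_const v).const_add x
  have h3 := h1.comp_hasDerivAt s h2
  rw [h.gradient_avg]
  exact h3

theorem BasicAssumption.avg_le (hn : 1 ≤ n) (h : BasicAssumption f r L) (x y : Space d) :
    avg f y ≤ avg f x + inner ℝ (gradient (avg f) x) (y - x) + L / 2 * ‖y - x‖ ^ 2 := by
  have := sub_le_of_deriv_le_quadratic (A := inner ℝ (gradient (avg f) x) (y - x))
    (B := L * ‖y - x‖ ^ 2) (C := 0) (h.hasDerivAt_line x (y - x)) (by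
      intro s hs0 hs1
      have h1 := real_inner_le_norm (gradient (avg f) (x + s • (y - x)) - gradient (avg f) x)
        (y - x)
      have h2 := h.norm_gradient_avg_sub_le hn (x + s • (y - x)) x
      rw [add_sub_cancel_left, norm_smul, Real.norm_of_nonneg hs0.le] at h2
      have h3 := mul_le_mul_of_nonneg_right h2 (norm_nonneg (y - x))
      rw [inner_sub_left] at h1
      nlinarith)
  simp only [one_smul, zero_smul, add_zero, add_sub_cancel] at this
  linarith

theorem BasicAssumption.le_avg (hn : 1 ≤ n) (h : BasicAssumption f r L) (x y : Space d) :
    avg f x + inner ℝ (gradient (avg f) x) (y - x) - L / 2 * ‖y - x‖ ^ 2 ≤ avg f y := by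
  have := sub_le_of_deriv_le_quadratic (A := -inner ℝ (gradient (avg f) x) (y - x))
    (B := L * ‖y - x‖ ^ 2) (C := 0) (fun s => (h.hasDerivAt_line x (y - x) s).neg) (by
      intro s hs0 hs1
      have h1 := real_inner_le_norm (-(gradient (avg f) (x + s • (y - x)) - gradient (avg f) x))
        (y - x)
      have h2 := h.norm_gradient_avg_sub_le hn (x + s • (y - x)) x
      rw [add_sub_cancel_left, norm_smul, Real.norm_of_nonneg hs0.le] at h2
      have h3 := mul_le_mul_of_nonneg_right h2 (norm_nonneg (y - x))
      rw [norm_neg, inner_neg_left, inner_sub_left] at h1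
      nlinarith)
  simp only [Pi.neg_apply, one_smul, zero_smul, add_zero, add_sub_cancel] at this
  linarith

/-- Smoothness inequality that gains from the spread of the gradient increments. -/
theorem BasicAssumption.avg_add_meanSq_le (hn : 1 ≤ n) (h : BasicAssumption f r L)
    {Γ₁ Γ₂ : ℝ} (h1 : 0 < Γ₁) (h2 : 0 < Γ₂) (x y : Space d) :
    avg f y - avg f x - inner ℝ (gradient (avg f) x) (y - x) +
      Γ₁ / L * meanSq (fun i => gradient (f i) y - gradient (f i) x) -
      Γ₂ / L * ‖mean fun i => gradient (f i) y - gradient (f i) x‖ ^ 2 ≤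
    (Γ₁ + 1 / (24 * Γ₁) + 1 / (16 * Γ₂)) * L * ‖y - x‖ ^ 2 := by
  have hL := h.L_pos
  obtain ⟨v, hv⟩ : ∃ v, v = y - x := ⟨_, rfl⟩
  obtain ⟨δ, hδ⟩ : ∃ δ : Fin n → Space d, δ = fun i => gradient (f i) y - gradient (f i) x :=
    ⟨_, rfl⟩
  -- The gradient at `x + s v` is compared with the linear interpolation of the end gradients. The
  -- terms in `s` and `s(1 - s)` integrate to `1/2` and `1/6`, whence the constants `1/16` and
  -- `1/24`.
  have key := sub_le_of_deriv_le_quadratic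
    (A := inner ℝ (gradient (avg f) x) v + Γ₁ / L * (L ^ 2 * ‖v‖ ^ 2 - meanSq δ))
    (B := inner ℝ (mean δ) v) (C := L * ‖v‖ ^ 2 / (4 * Γ₁)) (h.hasDerivAt_line x v) (by
      intro s hs0 hs1
      obtain ⟨X, hX⟩ : ∃ X : Fin n → Space d,
        X = fun i => gradient (f i) (x + s • v) - gradient (f i) x := ⟨_, rfl⟩
      have hs1' : 0 < 1 - s := by linarith
      have hXs : meanSq X ≤ L ^ 2 * (s ^ 2 * ‖v‖ ^ 2) := by
        have := h.meanSq_le (x + s • v) x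
        rwa [add_sub_cancel_left, norm_smul, mul_pow, Real.norm_eq_abs, sq_abs, ← hX] at this
      have hXd : meanSq (fun i => δ i - X i) ≤ L ^ 2 * ((1 - s) ^ 2 * ‖v‖ ^ 2) := by
        have := h.meanSq_le y (x + s • v)
        rw [show y - (x + s • v) = (1 - s) • v by rw [hv]; module, norm_smul, mul_pow,
          Real.norm_eq_abs, sq_abs] at this
        refine le_trans (le_of_eq ?_) this
        rw [hδ, hX]
        congr 1
        funext i
        exact sub_sub_sub_cancel_right _ _ _
      -- With this identity, smoothness towards both end points bounds the interpolation error by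
      -- `s(1 - s)(L²‖v‖² - meanSq δ)`: a large spread of the increments forces a small error.
      have hid : meanSq (fun i => X i - s • δ i) = (1 - s) * meanSq X +
          s * meanSq (fun i => δ i - X i) - s * (1 - s) * meanSq δ := by
        simp only [meanSq, norm_sub_sq_real, inner_smul_right, norm_smul, mul_pow,
          Real.norm_eq_abs, sq_abs, Finset.sum_add_distrib, Finset.sum_sub_distrib,
          ← Finset.mul_sum, real_inner_comm]
        ring
      have hvar : meanSq (fun i => X i - s • δ i) ≤
          s * (1 - s) * (L ^ 2 * ‖v‖ ^ 2 - meanSq δ) := by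
        rw [hid]
        nlinarith [mul_le_mul_of_nonneg_left hXs hs1'.le, mul_le_mul_of_nonneg_left hXd hs0.le]
      have hm := (norm_mean_sq_le hn _).trans hvar
      have hmean : mean (fun i => X i - s • δ i) =
          gradient (avg f) (x + s • v) - gradient (avg f) x - s • mean δ := by
        rw [h.gradient_avg, h.gradient_avg, hX]
        simp only [mean]
        rw [Finset.sum_sub_distrib, Finset.sum_sub_distrib, ← Finset.smul_sum, smul_sub, smul_sub,
          smul_comm s]
      rw [hmean] at hm
      obtain ⟨e, he⟩ : ∃ e, e = gradient (avg f) (x + s • v) - gradient (avg f) x - s • mean δ :=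
        ⟨_, rfl⟩
      rw [← he] at hm
      have e1 : inner ℝ (gradient (avg f) (x + s • v)) v =
          inner ℝ (gradient (avg f) x) v + s * inner ℝ (mean δ) v + inner ℝ e v := by
        rw [he, inner_sub_left, inner_sub_left, real_inner_smul_left]; ring
      have hσ : 0 < s * (1 - s) := mul_pos hs0 hs1'
      have e2 : inner ℝ e v ≤ Γ₁ / L * (‖e‖ ^ 2 / (s * (1 - s))) +
          L * ‖v‖ ^ 2 / (4 * Γ₁) * (s * (1 - s)) := by
        refine (real_inner_le_norm e v).trans ?_
        have : 0 ≤ Γ₁ / L * (‖e‖ - L * ‖v‖ / (2 * Γ₁) * (s * (1 - s))) ^ 2 / (s * (1 - s)) := by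
          positivity
        have e3 : Γ₁ / L * (‖e‖ - L * ‖v‖ / (2 * Γ₁) * (s * (1 - s))) ^ 2 / (s * (1 - s)) =
            Γ₁ / L * (‖e‖ ^ 2 / (s * (1 - s))) + L * ‖v‖ ^ 2 / (4 * Γ₁) * (s * (1 - s)) -
              ‖e‖ * ‖v‖ := by
          generalize s * (1 - s) = τ at hσ
          field_simp
          ring
        linarith
      have e4 : Γ₁ / L * (‖e‖ ^ 2 / (s * (1 - s))) ≤
          Γ₁ / L * (L ^ 2 * ‖v‖ ^ 2 - meanSq δ) := by
        have : ‖e‖ ^ 2 / (s * (1 - s)) ≤ L ^ 2 * ‖v‖ ^ 2 - meanSq δ := by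
          rw [div_le_iff₀ hσ]; linarith
        gcongr
      rw [e1]
      linarith)
  simp only [one_smul, zero_smul, add_zero] at key
  rw [show x + v = y by rw [hv]; abel] at key
  rw [← hδ, ← hv]
  have hin : inner ℝ (mean δ) v / 2 ≤ Γ₂ / L * ‖mean δ‖ ^ 2 + L * ‖v‖ ^ 2 / (16 * Γ₂) := by
    have h3 := real_inner_le_norm (mean δ) v
    have h4 : 0 ≤ Γ₂ / L * (‖mean δ‖ - L * ‖v‖ / (4 * Γ₂)) ^ 2 := by positivity
    have h5 : Γ₂ / L * (‖mean δ‖ - L * ‖v‖ / (4 * Γ₂)) ^ 2 =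
        Γ₂ / L * ‖mean δ‖ ^ 2 + L * ‖v‖ ^ 2 / (16 * Γ₂) - ‖mean δ‖ * ‖v‖ / 2 := by
      field_simp; ring
    linarith
  have e5 : (Γ₁ + 1 / (24 * Γ₁) + 1 / (16 * Γ₂)) * L * ‖v‖ ^ 2 =
      Γ₁ / L * (L ^ 2 * ‖v‖ ^ 2) + L * ‖v‖ ^ 2 / (4 * Γ₁) / 6 + L * ‖v‖ ^ 2 / (16 * Γ₂) := by
    field_simp; ring
  rw [e5]
  linarith

/-- A second smoothness inequality of the same kind, better for large batches. -/
theorem BasicAssumption.avg_add_meanSq_le' (hn : 1 ≤ n) (h : BasicAssumption f r L)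
    {Γ₁ Γ₂ : ℝ} (h1 : 0 < Γ₁) (h2 : 0 < Γ₂) (x y : Space d) :
    avg f y - avg f x - inner ℝ (gradient (avg f) x) (y - x) +
      Γ₁ / L * meanSq (fun i => gradient (f i) y - gradient (f i) x) -
      Γ₂ / L * ‖mean fun i => gradient (f i) y - gradient (f i) x‖ ^ 2 ≤
    (Γ₁ + 1 / 4 + 1 / (16 * (Γ₂ + 1 / 4))) * L * ‖y - x‖ ^ 2 := by
  have hL := h.L_pos
  have hsm := h.meanSq_le y x
  rw [mean_sub, ← h.gradient_avg, ← h.gradient_avg]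
  obtain ⟨v, hv⟩ : ∃ v, v = y - x := ⟨_, rfl⟩
  obtain ⟨e, he⟩ : ∃ e, e = gradient (avg f) y - gradient (avg f) x := ⟨_, rfl⟩
  -- The intermediate point makes the upper model of `f` at `x` minus the lower model at `y` as
  -- small as possible. The outcome is `f(y) - f(x) - ⟪∇f(x), v⟫ ≤ ⟪e, v⟫/2 + (L/4)‖v‖² -
  -- ‖e‖²/(4L)`.
  have a1 := h.avg_le hn x (x + (1 / 2 : ℝ) • (v + (1 / L) • e))
  have a2 := h.le_avg hn y (x + (1 / 2 : ℝ) • (v + (1 / L) • e))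
  rw [← he]
  rw [show x + (1 / 2 : ℝ) • (v + (1 / L) • e) - x = (1 / 2 : ℝ) • (v + (1 / L) • e) by abel] at a1
  rw [show x + (1 / 2 : ℝ) • (v + (1 / L) • e) - y = (-(1 / 2 : ℝ)) • (v - (1 / L) • e) by
    rw [show y = x + v by rw [hv]; abel]; module] at a2
  rw [show gradient (avg f) y = gradient (avg f) x + e by rw [he]; abel] at a2
  rw [← hv] at hsm ⊢
  simp only [inner_smul_right, inner_add_right, inner_sub_right, inner_add_left, norm_smul,
    mul_pow, norm_add_sq_real, norm_sub_sq_real, real_inner_self_eq_norm_sq, Real.norm_eq_abs,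
    sq_abs] at a1 a2
  have hc := real_inner_comm e v
  have hLi : 1 / L * L = 1 := by field_simp
  have hin : inner ℝ e v / 2 ≤ (Γ₂ + 1 / 4) / L * ‖e‖ ^ 2 + L * ‖v‖ ^ 2 / (16 * (Γ₂ + 1 / 4)) := by
    have h3 := real_inner_le_norm e v
    have h4 : 0 ≤ (Γ₂ + 1 / 4) / L * (‖e‖ - L * ‖v‖ / (4 * (Γ₂ + 1 / 4))) ^ 2 := by positivity
    have h5 : (Γ₂ + 1 / 4) / L * (‖e‖ - L * ‖v‖ / (4 * (Γ₂ + 1 / 4))) ^ 2 =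
        (Γ₂ + 1 / 4) / L * ‖e‖ ^ 2 + L * ‖v‖ ^ 2 / (16 * (Γ₂ + 1 / 4)) - ‖e‖ * ‖v‖ / 2 := by
      field_simp; ring
    linarith
  have e1 : Γ₁ / L * meanSq (fun i => gradient (f i) y - gradient (f i) x) ≤
      Γ₁ / L * (L ^ 2 * ‖v‖ ^ 2) := mul_le_mul_of_nonneg_left hsm (by positivity)
  have e2 : (Γ₁ + 1 / 4 + 1 / (16 * (Γ₂ + 1 / 4))) * L * ‖v‖ ^ 2 =
      Γ₁ / L * (L ^ 2 * ‖v‖ ^ 2) + L / 4 * ‖v‖ ^ 2 + L * ‖v‖ ^ 2 / (16 * (Γ₂ + 1 / 4)) := by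
    field_simp
  have e3 : (Γ₂ + 1 / 4) / L * ‖e‖ ^ 2 = Γ₂ / L * ‖e‖ ^ 2 + 1 / 4 * (1 / L * ‖e‖ ^ 2) := by
    field_simp
  have e4 : L * ((1 / L) ^ 2 * ‖e‖ ^ 2) = 1 / L * ‖e‖ ^ 2 := by field_simp
  rw [e2]
  have e5 : avg f y - avg f x - inner ℝ (gradient (avg f) x) v ≤
      inner ℝ e v / 2 + L / 4 * ‖v‖ ^ 2 - 1 / 4 * (1 / L * ‖e‖ ^ 2) := by
    rw [real_inner_comm v e] at *
    nlinarith
  linarith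

end SVRMM

end

noncomputable section

namespace SVRMM

variable {d n : ℕ} {f : Fin n → Space d → ℝ} {r : Space d → EReal} {L : ℝ}

/-! ### Values of the objective -/

theorem BasicAssumption.coe_toReal (h : BasicAssumption f r L) {x : Space d} (hx : r x ≠ ⊤) :
    ((r x).toReal : EReal) = r x := EReal.coe_toReal hx (h.r_ne_bot x)

theorem BasicAssumption.objective_eq (h : BasicAssumption f r L) {x : Space d} (hx : r x ≠ ⊤) :
    objective f r x = ((avg f x + (r x).toReal : ℝ) : EReal) := by
  rw [objective, EReal.coe_add, h.coe_toReal hx]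

theorem BasicAssumption.toReal_objective (h : BasicAssumption f r L) {x : Space d}
    (hx : r x ≠ ⊤) : (objective f r x).toReal = avg f x + (r x).toReal := by
  rw [h.objective_eq hx, EReal.toReal_coe]

theorem BasicAssumption.optimalValue_le (h : BasicAssumption f r L) {x : Space d} (hx : r x ≠ ⊤) :
    optimalValue f r ≤ (objective f r x).toReal := by
  obtain ⟨c, hc⟩ := h.bddBelow
  refine EReal.toReal_le_toReal (iInf_le _ x) ?_ ?_
  · exact ne_bot_of_le_ne_bot (EReal.coe_ne_bot c) (le_iInf hc)
  · rw [h.objective_eq hx]; exact EReal.coe_ne_top _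

/-! ### One step -/

variable {u : Space d → Space d → EReal} {μ : ℝ} {x g x' : Space d}

theorem IsSurrogate.ne_bot (hs : IsSurrogate u r) (h : BasicAssumption f r L) (z y : Space d) :
    u z y ≠ ⊥ := ne_bot_of_le_ne_bot (h.r_ne_bot z) (hs.majorizes z y)

theorem IsMMStep.ne_top (h : BasicAssumption f r L) (hs : IsSurrogate u r)
    (hu : SurrogateAssumption u r) (hx : r x ≠ ⊤) (hstep : IsMMStep u μ x g x') : r x' ≠ ⊤ :=
  ne_top_of_le_ne_top (hstep.strong (hu.convex_left x) (fun z => hs.ne_bot h z x)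
    (by rwa [hs.eq_diag])).1 (hs.majorizes x' x)

/-- Descent of the objective along one step. -/
theorem IsMMStep.objective_le (h : BasicAssumption f r L) (hs : IsSurrogate u r)
    (hu : SurrogateAssumption u r) (hx : r x ≠ ⊤) (hstep : IsMMStep u μ x g x') :
    (objective f r x').toReal ≤ (objective f r x).toReal - μ * ‖x' - x‖ ^ 2 +
      (avg f x' - avg f x - inner ℝ (gradient (avg f) x) (x' - x)) -
      inner ℝ (g - gradient (avg f) x) (x' - x) := by
  have hxx : u x x ≠ ⊤ := by rwa [hs.eq_diag]
  obtain ⟨h1, h2⟩ := hstep.strong (hu.convex_left x) (fun z => hs.ne_bot h z x) hxx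
  have h3 := h2 x hxx
  have h4 : (r x').toReal ≤ (u x' x).toReal :=
    EReal.toReal_le_toReal (hs.majorizes x' x) (h.r_ne_bot x') h1
  rw [hs.eq_diag, sub_self, norm_zero, norm_sub_rev x x'] at h3
  rw [h.toReal_objective hx, h.toReal_objective (hstep.ne_top h hs hu hx), inner_sub_left,
    inner_sub_right g]
  linarith

/-- Descent of the objective, with the error of the gradient estimate split off. -/
theorem IsMMStep.objective_le_young (hn : 1 ≤ n) (hμ : L / 2 < μ) (h : BasicAssumption f r L)
    (hs : IsSurrogate u r) (hu : SurrogateAssumption u r) (hx : r x ≠ ⊤)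
    (hstep : IsMMStep u μ x g x') :
    (objective f r x').toReal ≤ (objective f r x).toReal -
      (2 * μ - L) / 4 * ‖x' - x‖ ^ 2 + 1 / (2 * μ - L) * ‖g - gradient (avg f) x‖ ^ 2 := by
  have h1 := hstep.objective_le h hs hu hx
  have h2 := h.avg_le hn x x'
  have hs0 : 0 < 2 * μ - L := by linarith
  have h3 := real_inner_le_norm (-(g - gradient (avg f) x)) (x' - x)
  rw [inner_neg_left, norm_neg] at h3
  generalize ‖g - gradient (avg f) x‖ = a at *
  generalize ‖x' - x‖ = D at *
  have h4 : a * D ≤ (2 * μ - L) / 4 * D ^ 2 + 1 / (2 * μ - L) * a ^ 2 := by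
    have h5 : 0 ≤ (2 * μ - L) * (D / 2 - 1 / (2 * μ - L) * a) ^ 2 := by positivity
    have h6 : (2 * μ - L) * (D / 2 - 1 / (2 * μ - L) * a) ^ 2 =
        (2 * μ - L) / 4 * D ^ 2 + 1 / (2 * μ - L) * a ^ 2 - a * D := by
      have := hs0.ne'
      field_simp
      ring
    linarith
  linarith

/-! ### Stationarity -/

theorem frechetSubdiff_subset_limitingSubdiff (φ : Space d → EReal) (x : Space d) :
    frechetSubdiff φ x ⊆ limitingSubdiff φ x := fun v hv =>
  ⟨hv.1, fun _ => x, fun _ => v, tendsto_const_nhds, tendsto_const_nhds, fun _ => hv,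
    tendsto_const_nhds⟩

/-- Expanding `‖z - x‖²` around `x'` produces `(μ/2)‖z - x'‖²`, which the strong convexity
inequality cancels, so the subgradient inequality holds for every `z` and without remainder. -/
theorem IsMMStep.mem_frechetSubdiff (h : BasicAssumption f r L) (hs : IsSurrogate u r)
    (hu : SurrogateAssumption u r) (hx : r x ≠ ⊤) (hstep : IsMMStep u μ x g x') :
    -(μ • (x' - x) + g) ∈ frechetSubdiff (fun z => u z x) x' := by
  have hxx : u x x ≠ ⊤ := by rwa [hs.eq_diag]
  have hbot := fun z => hs.ne_bot h z x
  obtain ⟨h1, h2⟩ := hstep.strong (hu.convex_left x) hbot hxx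
  refine ⟨h1, fun ε hε => Eventually.of_forall fun z => ?_⟩
  by_cases hz : u z x = ⊤
  · exact le_of_le_of_eq le_top hz.symm
  have h3 := h2 z hz
  show u x' x + _ ≤ u z x
  rw [← EReal.coe_toReal h1 (hbot x'), ← EReal.coe_toReal hz (hbot z), ← EReal.coe_add,
    EReal.coe_le_coe_iff]
  have h4 : ‖z - x‖ ^ 2 = ‖z - x'‖ ^ 2 + 2 * inner ℝ (z - x') (x' - x) + ‖x' - x‖ ^ 2 := by
    rw [← norm_add_sq_real, sub_add_sub_cancel]
  have h5 : inner ℝ g z = inner ℝ g x' + inner ℝ g (z - x') := by rw [inner_sub_right]; ring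
  rw [inner_neg_left, inner_add_left, real_inner_smul_left, real_inner_comm]
  have h6 : 0 ≤ ε * ‖z - x'‖ := by positivity
  rw [h4, h5] at h3
  linarith

theorem BasicAssumption.add_mem_frechetSubdiff (h : BasicAssumption f r L) {z w : Space d}
    (hw : w ∈ frechetSubdiff r z) :
    gradient (avg f) z + w ∈ frechetSubdiff (objective f r) z := by
  refine ⟨by rw [h.objective_eq hw.1]; exact EReal.coe_ne_top _, fun ε hε => ?_⟩
  have h1 := (h.gradient_avg z ▸ h.hasGradientAt_avg z).hasFDerivAt.isLittleO.bound (half_pos hε)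
  filter_upwards [h1, hw.2 (ε / 2) (half_pos hε)] with y hy1 hy2
  have h2 : avg f z + inner ℝ (gradient (avg f) z) (y - z) - ε / 2 * ‖y - z‖ ≤ avg f y := by
    have := neg_le_of_abs_le hy1
    rw [InnerProductSpace.toDual_apply_apply] at this
    linarith
  have h3 := add_le_add (EReal.coe_le_coe_iff.2 h2) hy2
  refine le_trans (le_of_eq ?_) h3
  rw [h.objective_eq hw.1, ← h.coe_toReal hw.1, EReal.toReal_coe, ← EReal.coe_add,
    ← EReal.coe_add, ← EReal.coe_add, inner_add_left]
  congr 1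
  ring

/-- This half of the sum rule is enough, because the stationarity gap is bounded from above by the
norm of a single element. It passes to the limit since `∇f` is Lipschitz. -/
theorem BasicAssumption.add_mem_limitingSubdiff (hn : 1 ≤ n) (h : BasicAssumption f r L)
    {z w : Space d} (hw : w ∈ limitingSubdiff r z) :
    gradient (avg f) z + w ∈ limitingSubdiff (objective f r) z := by
  obtain ⟨hz, xs, vs, h1, h2, h3, h4⟩ := hw
  refine ⟨by rw [h.objective_eq hz]; exact EReal.coe_ne_top _, xs,
    fun k => gradient (avg f) (xs k) + vs k, h1, ?_, fun k => h.add_mem_frechetSubdiff (h3 k),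
    Tendsto.add ?_ h4⟩
  · have hc : Tendsto (fun k => (avg f (xs k) : EReal)) atTop (𝓝 (avg f z)) :=
      (continuous_coe_real_ereal.tendsto _).comp
        ((h.hasGradientAt_avg z).continuousAt.tendsto.comp h1)
    exact Tendsto.comp (f := fun k => ((avg f (xs k) : EReal), r (xs k)))
      (g := fun p : EReal × EReal => p.1 + p.2)
      (EReal.continuousAt_add (p := ((avg f z : EReal), r z)) (Or.inl (EReal.coe_ne_top _))
        (Or.inl (EReal.coe_ne_bot _))) (hc.prodMk_nhds h2)
  · rw [tendsto_iff_norm_sub_tendsto_zero]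
    refine squeeze_zero (fun _ => norm_nonneg _)
      (fun k => h.norm_gradient_avg_sub_le hn (xs k) z) ?_
    simpa using (tendsto_iff_norm_sub_tendsto_zero.1 h1).const_mul L

/-- The stationarity gap after one step. -/
theorem IsMMStep.stationarityGap_le (hn : 1 ≤ n) (h : BasicAssumption f r L)
    (hs : IsSurrogate u r) (hu : SurrogateAssumption u r) (hμ : 0 < μ) (hx : r x ≠ ⊤)
    (hstep : IsMMStep u μ x g x') {S : Set (Space d)} {Lu : ℝ} (hS : SubdiffGapOn u r S Lu)
    (hxS : x ∈ S) (hxS' : x' ∈ S) :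
    stationarityGap (objective f r) x' ≤ ENNReal.ofReal
      ((L + μ + Lu) * ‖x' - x‖ + ‖g - gradient (avg f) x‖) := by
  obtain ⟨ζ, hζ, hζ'⟩ := hS x' hxS' x hxS _
    (frechetSubdiff_subset_limitingSubdiff _ _ (hstep.mem_frechetSubdiff h hs hu hx))
  refine (Metric.infEDist_le_edist_of_mem (h.add_mem_limitingSubdiff hn hζ)).trans ?_
  rw [edist_dist, dist_zero_left]
  refine ENNReal.ofReal_le_ofReal ?_
  have e1 : gradient (avg f) x' + ζ = (gradient (avg f) x' - gradient (avg f) x) -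
      (-(μ • (x' - x) + g) - ζ) - μ • (x' - x) - (g - gradient (avg f) x) := by abel
  rw [e1]
  refine (_root_.norm_sub_le _ _).trans (add_le_add_left ?_ _)
  refine (_root_.norm_sub_le _ _).trans ?_
  have e2 := _root_.norm_sub_le (gradient (avg f) x' - gradient (avg f) x) (-(μ • (x' - x) + g) - ζ)
  have e3 := h.norm_gradient_avg_sub_le hn x' x
  rw [norm_smul μ, Real.norm_of_nonneg hμ.le]
  linarith

theorem IsMMStep.stationarityGap_sq_le (hn : 1 ≤ n) (h : BasicAssumption f r L)
    (hs : IsSurrogate u r) (hu : SurrogateAssumption u r) (hμ : 0 < μ) (hx : r x ≠ ⊤)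
    (hstep : IsMMStep u μ x g x') {S : Set (Space d)} {Lu : ℝ} (hS : SubdiffGapOn u r S Lu)
    (hxS : x ∈ S) (hxS' : x' ∈ S) :
    stationarityGap (objective f r) x' ^ 2 ≤ ENNReal.ofReal
      (2 * (L + μ + Lu) ^ 2 * ‖x' - x‖ ^ 2 + 2 * ‖g - gradient (avg f) x‖ ^ 2) := by
  refine (pow_le_pow_left₀ zero_le (hstep.stationarityGap_le hn h hs hu hμ hx hS hxS hxS')
    2).trans ?_
  obtain ⟨t, ht⟩ : ∃ t, t = (L + μ + Lu) * ‖x' - x‖ + ‖g - gradient (avg f) x‖ := ⟨_, rfl⟩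
  rw [← ht]
  rcases le_total 0 t with h0 | h0
  · rw [← ENNReal.ofReal_pow h0]
    refine ENNReal.ofReal_le_ofReal ?_
    rw [ht]
    nlinarith only [sq_nonneg ((L + μ + Lu) * ‖x' - x‖ - ‖g - gradient (avg f) x‖)]
  -- `Lu` is an arbitrary real here, so `t` may be negative; `ENNReal.ofReal` then truncates to
  -- zero.
  · rw [ENNReal.ofReal_of_nonpos h0]
    simp

end SVRMM

end

noncomputable section

namespace SVRMM

/-! ### Recursions driven by independent draws from a finite set -/

section Draws

variable {Ω α σ : Type*}

/-- The states `Z` follow the recursion `Z (k + 1) = T (Z k) (ξ k)` started at `z₀`. -/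
structure IsDrivenBy (T : σ → α → σ) (z₀ : σ) (ξ : ℕ → Ω → α) (Z : ℕ → Ω → σ) : Prop where
  init : ∀ ω, Z 0 ω = z₀
  step : ∀ k ω, Z (k + 1) ω = T (Z k ω) (ξ k ω)

variable {ξ : ℕ → Ω → α} {T : σ → α → σ} {z₀ : σ} {Z : ℕ → Ω → σ}

/-- This is the source of both finiteness and independence: the state at time `k` depends only on
the draws before `k`, of which there are finitely many combinations when `α` is finite. -/
theorem IsDrivenBy.exists_history (h : IsDrivenBy T z₀ ξ Z) (k : ℕ) :
    ∃ H : (Finset.range k → α) → σ, ∀ ω, Z k ω = H fun i => ξ i ω := by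
  induction k with
  | zero => exact ⟨fun _ => z₀, h.init⟩
  | succ k ih =>
    obtain ⟨H, hH⟩ := ih
    refine ⟨fun a => T (H fun i => a ⟨i, Finset.mem_range.2
      ((Finset.mem_range.1 i.2).trans k.lt_succ_self)⟩) (a ⟨k, Finset.self_mem_range_succ k⟩),
      fun ω => ?_⟩
    rw [h.step, hH]

theorem IsDrivenBy.finite_range [Finite α] (h : IsDrivenBy T z₀ ξ Z) (k : ℕ) : (Set.range (Z k)).Finite := by
  obtain ⟨H, hH⟩ := h.exists_history k
  refine (Set.finite_range H).subset ?_
  rintro _ ⟨ω, rfl⟩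
  exact ⟨_, (hH ω).symm⟩

theorem IsDrivenBy.forall_of_step (h : IsDrivenBy T z₀ ξ Z) {good : σ → Prop} (h0 : good z₀)
    (hT : ∀ z s, good z → good (T z s)) (k : ℕ) (ω : Ω) : good (Z k ω) := by
  induction k with
  | zero => rwa [h.init]
  | succ k ih => rw [h.step]; exact hT _ _ ih

/-- Independent draws from a finite set, with common law `p`. -/
structure IsDrawSequence [MeasurableSpace Ω] [MeasurableSpace α] (P : Measure Ω) (p : α → ℝ) (ξ : ℕ → Ω → α) : Prop where
  nonneg : ∀ s, 0 ≤ p s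
  measurable : ∀ k, Measurable (ξ k)
  indep : iIndepFun ξ P
  law : ∀ k s, P {ω | ξ k ω = s} = ENNReal.ofReal (p s)

variable [MeasurableSpace Ω] [Fintype α] [MeasurableSpace α] [MeasurableSingletonClass α]
  {P : Measure Ω} {p : α → ℝ}

theorem IsDrawSequence.sum_eq_one [IsProbabilityMeasure P]
    (h : IsDrawSequence P p ξ) : ∑ s, p s = 1 := by
  have h1 : ∑ s, P (ξ 0 ⁻¹' {s}) = P (ξ 0 ⁻¹' (Finset.univ : Finset α)) :=
    sum_measure_preimage_singleton _ fun s _ => h.measurable 0 (measurableSet_singleton s)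
  rw [Finset.coe_univ, Set.preimage_univ, measure_univ] at h1
  have h2 : ∀ s, P (ξ 0 ⁻¹' {s}) = ENNReal.ofReal (p s) := h.law 0
  simp only [h2] at h1
  rw [← ENNReal.ofReal_sum_of_nonneg fun s _ => h.nonneg s] at h1
  exact ENNReal.ofReal_eq_one.1 h1

theorem IsDrawSequence.measurable_comp (hξ : IsDrawSequence P p ξ) (hZ : IsDrivenBy T z₀ ξ Z)
    (k : ℕ) (φ : σ → α → ℝ≥0∞) : Measurable fun ω => φ (Z k ω) (ξ k ω) := by
  obtain ⟨H, hH⟩ := hZ.exists_history k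
  have hm : Measurable fun ω => fun i : Finset.range k => ξ i ω :=
    measurable_pi_lambda _ fun i => hξ.measurable i
  -- Any function of finitely many draws from a finite set is measurable, so nothing is asked of `T`
  -- or `φ`.
  have h2 : Measurable fun q : (Finset.range k → α) × α => φ (H q.1) q.2 := .of_discrete
  simp only [hH]
  exact h2.comp (hm.prodMk (hξ.measurable k))

/-- The next draw is independent of the current state. -/
theorem IsDrawSequence.lintegral_comp [IsProbabilityMeasure P] (hξ : IsDrawSequence P p ξ)
    (hZ : IsDrivenBy T z₀ ξ Z) (k : ℕ) (φ : σ → α → ℝ≥0∞) :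
    ∫⁻ ω, φ (Z k ω) (ξ k ω) ∂P = ∫⁻ ω, ∑ s, ENNReal.ofReal (p s) * φ (Z k ω) s ∂P := by
  obtain ⟨H, hH⟩ := hZ.exists_history k
  have hm : Measurable fun ω => fun i : Finset.range k => ξ i ω :=
    measurable_pi_lambda _ fun i => hξ.measurable i
  have hind : IndepFun (fun ω => fun i : Finset.range k => ξ i ω) (ξ k) P := by
    have := hξ.indep.indepFun_finset (Finset.range k) {k} (by simp) hξ.measurable
    exact this.comp (φ := id) (ψ := fun a : ({k} : Finset ℕ) → α => a ⟨k, by simp⟩)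
      measurable_id (measurable_pi_apply _)
  rw [indepFun_iff_map_prod_eq_prod_map_map hm.aemeasurable (hξ.measurable k).aemeasurable]
    at hind
  have h2 : Measurable fun q : (Finset.range k → α) × α => φ (H q.1) q.2 := .of_discrete
  have h3 : Measurable fun a : Finset.range k → α => ∑ s, ENNReal.ofReal (p s) * φ (H a) s :=
    .of_discrete
  have : IsProbabilityMeasure (P.map (ξ k)) :=
    Measure.isProbabilityMeasure_map (hξ.measurable k).aemeasurable
  simp only [hH]
  rw [← lintegral_map (f := fun q : (Finset.range k → α) × α => φ (H q.1) q.2) h2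
    (hm.prodMk (hξ.measurable k)), hind, lintegral_prod _ h2.aemeasurable,
    ← lintegral_map (f := fun a : Finset.range k → α => ∑ s, ENNReal.ofReal (p s) * φ (H a) s)
      h3 hm]
  refine lintegral_congr fun a => ?_
  rw [lintegral_fintype]
  refine Finset.sum_congr rfl fun s _ => ?_
  rw [Measure.map_apply (hξ.measurable k) (measurableSet_singleton s), mul_comm]
  congr 1
  exact hξ.law k s

/-- A potential that decreases on average by `η` bounds the expected sum of `η`. -/
theorem IsDrawSequence.sum_lintegral_le [IsProbabilityMeasure P] (hξ : IsDrawSequence P p ξ)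
    (hZ : IsDrivenBy T z₀ ξ Z) {good : σ → Prop} (h0 : good z₀)
    (hT : ∀ z s, good z → good (T z s)) {Φ : σ → ℝ} {η : σ → α → ℝ} {c : ℝ}
    (hΦ : ∀ z, good z → c ≤ Φ z) (hη : ∀ z s, good z → 0 ≤ η z s)
    (hdec : ∀ z, good z → ∑ s, p s * (Φ (T z s) + η z s) ≤ Φ z) (K : ℕ) :
    ∑ k ∈ Finset.range K, ∫⁻ ω, ENNReal.ofReal (η (Z k ω) (ξ k ω)) ∂P ≤
      ENNReal.ofReal (Φ z₀ - c) := by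
  have hgood := hZ.forall_of_step h0 hT
  have hdec' : ∀ z, good z → ∑ s, ENNReal.ofReal (p s) *
      (ENNReal.ofReal (Φ (T z s) - c) + ENNReal.ofReal (η z s)) ≤ ENNReal.ofReal (Φ z - c) := by
    intro z hz
    have h1 : ∀ s, 0 ≤ Φ (T z s) - c := fun s => sub_nonneg.2 (hΦ _ (hT z s hz))
    have h2 : ∀ s, 0 ≤ p s * (Φ (T z s) - c + η z s) := fun s =>
      mul_nonneg (hξ.nonneg s) (add_nonneg (h1 s) (hη z s hz))
    simp only [← ENNReal.ofReal_add (h1 _) (hη z _ hz), ← ENNReal.ofReal_mul (hξ.nonneg _)]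
    rw [← ENNReal.ofReal_sum_of_nonneg fun s _ => h2 s]
    refine ENNReal.ofReal_le_ofReal ?_
    have h3 : ∑ s, p s * (Φ (T z s) - c + η z s) =
        ∑ s, p s * (Φ (T z s) + η z s) - (∑ s, p s) * c := by
      rw [Finset.sum_mul, ← Finset.sum_sub_distrib]
      exact Finset.sum_congr rfl fun s _ => by ring
    rw [h3, hξ.sum_eq_one, one_mul]
    linarith [hdec z hz]
  -- The induction carries the remaining potential at time `K`; subtracting `c` keeps it
  -- nonnegative.
  have key : ∑ k ∈ Finset.range K, ∫⁻ ω, ENNReal.ofReal (η (Z k ω) (ξ k ω)) ∂P +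
      ∫⁻ ω, ENNReal.ofReal (Φ (Z K ω) - c) ∂P ≤ ENNReal.ofReal (Φ z₀ - c) := by
    induction K with
    | zero => simp [hZ.init]
    | succ K ih =>
      refine le_trans ?_ ih
      rw [Finset.sum_range_succ, add_assoc]
      refine add_le_add_right ?_ _
      rw [← lintegral_add_left (hξ.measurable_comp hZ K fun z s => ENNReal.ofReal (η z s))]
      simp only [hZ.step]
      rw [hξ.lintegral_comp hZ K fun z s =>
        ENNReal.ofReal (η z s) + ENNReal.ofReal (Φ (T z s) - c)]
      refine lintegral_mono fun ω => le_trans (le_of_eq ?_) (hdec' _ (hgood K ω))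
      exact Finset.sum_congr rfl fun s _ => by rw [add_comm]
  exact le_self_add.trans key

/-- Complexity of a recursion whose average decrease of a potential controls the squared
stationarity gap. -/
theorem IsDrawSequence.sum_lintegral_gap_le [IsProbabilityMeasure P] {d : ℕ}
    {F : Space d → EReal} (hξ : IsDrawSequence P p ξ)
    (hZ : IsDrivenBy T z₀ ξ Z) {good : σ → Prop} (h0 : good z₀)
    (hT : ∀ z s, good z → good (T z s)) {Φ : σ → ℝ} {η : σ → α → ℝ} {c : ℝ}
    (hΦ : ∀ z, good z → c ≤ Φ z) (hη : ∀ z s, good z → 0 ≤ η z s)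
    (hdec : ∀ z, good z → ∑ s, p s * (Φ (T z s) + η z s) ≤ Φ z)
    {pos : σ → Space d} {S : Set (Space d)} {N : ℝ} (hN : 0 ≤ N)
    (hgap : ∀ z s, good z → pos z ∈ S → pos (T z s) ∈ S →
      stationarityGap F (pos (T z s)) ^ 2 ≤ ENNReal.ofReal (N * η z s))
    {K : ℕ} (hS : ∀ k ≤ K, ∀ᵐ ω ∂P, pos (Z k ω) ∈ S) :
    ∑ k ∈ Finset.Icc 1 K, ∫⁻ ω, stationarityGap F (pos (Z k ω)) ^ 2 ∂P ≤
      ENNReal.ofReal (N * (Φ z₀ - c)) := by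
  have hgood := hZ.forall_of_step h0 hT
  rw [ENNReal.ofReal_mul hN]
  refine le_trans ?_ (mul_le_mul_right (hξ.sum_lintegral_le hZ h0 hT hΦ hη hdec K) _)
  -- The gap at iterate `k + 1` is paid for by the cost of step `k`, hence the shift from `1, …, K`
  -- to `0, …, K - 1`.
  rw [← Finset.Ico_add_one_right_eq_Icc, Finset.sum_Ico_eq_sum_range, Finset.mul_sum,
    Nat.add_sub_cancel]
  refine Finset.sum_le_sum fun k hk => ?_
  rw [← lintegral_const_mul _ (hξ.measurable_comp hZ k fun z s => ENNReal.ofReal (η z s))]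
  refine lintegral_mono_ae ?_
  have hk' := Finset.mem_range.1 hk
  filter_upwards [hS k hk'.le, hS (k + 1) hk'] with ω h1 h2
  rw [hZ.step] at h2
  rw [add_comm 1 k, hZ.step, ← ENNReal.ofReal_mul hN]
  exact hgap _ _ (hgood k ω) h1 h2

end Draws

end SVRMM

end

noncomputable section

namespace SVRMM

variable {d n : ℕ}

/-! ### Averages over random batches -/

/-- The average over all batches of `b` indices. -/
def batchAvg (n b : ℕ) (φ : (Fin b → Fin n) → ℝ) : ℝ := (1 / (n : ℝ)) ^ b * ∑ s, φ s

theorem batchAvg_zero (φ : (Fin 0 → Fin n) → ℝ) : batchAvg n 0 φ = φ Fin.elim0 := by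
  simp [batchAvg, Subsingleton.elim (default : Fin 0 → Fin n) Fin.elim0]

theorem batchAvg_succ (b : ℕ) (φ : (Fin (b + 1) → Fin n) → ℝ) :
    batchAvg n (b + 1) φ = (1 / (n : ℝ)) * ∑ i, batchAvg n b fun s => φ (Fin.cons i s) := by
  rw [batchAvg, ← (Fin.consEquiv fun _ => Fin n).sum_comp, Fintype.sum_prod_type]
  simp only [batchAvg, ← Finset.mul_sum, pow_succ']
  rw [mul_assoc]
  rfl

theorem batchAvg_add {b : ℕ} (φ ψ : (Fin b → Fin n) → ℝ) :
    batchAvg n b (fun s => φ s + ψ s) = batchAvg n b φ + batchAvg n b ψ := by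
  simp [batchAvg, Finset.sum_add_distrib, mul_add]

theorem batchAvg_mul_left {b : ℕ} (c : ℝ) (φ : (Fin b → Fin n) → ℝ) :
    batchAvg n b (fun s => c * φ s) = c * batchAvg n b φ := by
  simp only [batchAvg, ← Finset.mul_sum]; ring

theorem batchAvg_mono {b : ℕ} {φ ψ : (Fin b → Fin n) → ℝ} (h : ∀ s, φ s ≤ ψ s) :
    batchAvg n b φ ≤ batchAvg n b ψ :=
  mul_le_mul_of_nonneg_left (Finset.sum_le_sum fun s _ => h s) (by positivity)

theorem batchAvg_const (hn : 1 ≤ n) (b : ℕ) (c : ℝ) : batchAvg n b (fun _ => c) = c := by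
  have : (n : ℝ) ≠ 0 := by positivity
  simp [batchAvg, this]

/-- The indices of a batch are independent and `X` has mean zero, so the cross terms vanish. The
induction splits off one index and lets it join the shift `a`. -/
theorem batchAvg_norm_add_sum_sq (hn : 1 ≤ n) {X : Fin n → Space d} (hX : ∑ i, X i = 0) (b : ℕ)
    (a : Space d) :
    batchAvg n b (fun s => ‖a + ∑ j, X (s j)‖ ^ 2) = ‖a‖ ^ 2 + b * meanSq X := by
  have hn0 : (n : ℝ) ≠ 0 := by positivity
  induction b generalizing a with
  | zero => simp [batchAvg_zero]
  | succ b ih =>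
    have h1 : ∑ i, inner ℝ a (X i) = 0 := by rw [← inner_sum, hX, inner_zero_right]
    simp only [batchAvg_succ, Fin.sum_univ_succ, Fin.cons_zero, Fin.cons_succ, ← add_assoc, ih]
    simp only [norm_add_sq_real, Finset.sum_add_distrib, ← Finset.mul_sum, h1, Finset.sum_const,
      Finset.card_univ, Fintype.card_fin, nsmul_eq_mul]
    rw [Nat.cast_succ, meanSq]
    field_simp
    ring

/-- The error of the mini-batch estimator, shifted by a fixed vector. -/
theorem batchAvg_norm_batch_sub_mean_sq {b : ℕ} (hn : 1 ≤ n) (hb : 1 ≤ b) (D : Fin n → Space d)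
    (a : Space d) :
    batchAvg n b (fun s => ‖(1 / (b : ℝ)) • ∑ j, D (s j) - mean D + a‖ ^ 2) =
      meanVar D / b + ‖a‖ ^ 2 := by
  have hn0 : (n : ℝ) ≠ 0 := by positivity
  have hb0 : (b : ℝ) ≠ 0 := by positivity
  have hX : ∑ i, (D i - mean D) = 0 := by
    rw [Finset.sum_sub_distrib, Finset.sum_const, Finset.card_univ, Fintype.card_fin, mean,
      ← Nat.cast_smul_eq_nsmul ℝ, smul_smul, mul_one_div_cancel hn0, one_smul, sub_self]
  have h1 := batchAvg_norm_add_sum_sq hn hX b ((b : ℝ) • a)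
  have h2 : ∀ s : Fin b → Fin n, ‖(1 / (b : ℝ)) • ∑ j, D (s j) - mean D + a‖ ^ 2 =
      (1 / (b : ℝ)) ^ 2 * ‖(b : ℝ) • a + ∑ j, (D (s j) - mean D)‖ ^ 2 := by
    intro s
    rw [← sq_abs (1 / (b : ℝ)), ← Real.norm_eq_abs, ← mul_pow, ← norm_smul,
      Finset.sum_sub_distrib, Finset.sum_const, Finset.card_univ, Fintype.card_fin,
      ← Nat.cast_smul_eq_nsmul ℝ, smul_add, smul_sub, smul_smul, smul_smul,
      one_div_mul_cancel hb0, one_smul, one_smul, add_comm]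
  simp only [h2, batchAvg_mul_left, h1, meanSq_sub_mean hn, norm_smul, mul_pow, Real.norm_eq_abs,
    sq_abs, meanVar]
  field_simp
  ring

/-! ### The minimization step as a map -/

/-- A minimizer of the subproblem of the method. -/
def mmStep (u : Space d → Space d → EReal) (μ : ℝ) (x g : Space d) : Space d :=
  Classical.epsilon (IsMMStep u μ x g)

variable {f : Fin n → Space d → ℝ} {r : Space d → EReal} {L : ℝ} {u : Space d → Space d → EReal}
  {μ : ℝ} {x g x' : Space d}

theorem isMMStep_mmStep (h : BasicAssumption f r L) (hs : IsSurrogate u r)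
    (hu : SurrogateAssumption u r) (hμ : 0 < μ) (hx : r x ≠ ⊤) (g : Space d) :
    IsMMStep u μ x g (mmStep u μ x g) :=
  Classical.epsilon_spec (exists_isMMStep hμ g (hu.convex_left x) (hu.lsc_left x)
    (fun z => hs.ne_bot h z x) (by rwa [hs.eq_diag]))

theorem IsMMStep.eq_mmStep (h : BasicAssumption f r L) (hs : IsSurrogate u r)
    (hu : SurrogateAssumption u r) (hμ : 0 < μ) (hx : r x ≠ ⊤) (hstep : IsMMStep u μ x g x') :
    x' = mmStep u μ x g :=
  hstep.unique hμ (hu.convex_left x) (fun z => hs.ne_bot h z x) (by rwa [hs.eq_diag])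
    (isMMStep_mmStep h hs hu hμ hx g)

/-! ### Weights -/

/-- The factor between the weighted decrease and the squared stationarity gap. -/
theorem complexity_factor {s A B m : ℝ} (hs : 0 < s) (hA : 0 ≤ A) (hB : 0 < B) (hm : 0 < m)
    (hms : m ≤ s ^ 2 - 4 * A) {N : ℝ} (hN : N = 8 * s * (B ^ 2 + A) / m) :
    0 < N ∧ 2 * B ^ 2 / N + A * (1 / s + 2 / N) ≤ s / 4 := by
  have h0 : 0 < B ^ 2 + A := by positivity
  have hN0 : 0 < N := by rw [hN]; positivity
  refine ⟨hN0, ?_⟩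
  -- By the choice of `N`, `2(B² + A)/N = m/(4s)`; the claim becomes `4A + m ≤ s²`.
  have h1 : 2 * B ^ 2 / N + A * (1 / s + 2 / N) = A / s + m / (4 * s) := by
    rw [hN]; field_simp; ring
  rw [h1, div_add_div _ _ hs.ne' (by positivity), div_le_iff₀ (by positivity)]
  nlinarith

/-- Draw law of batches with coins. -/
def batchCoinLaw (n b m : ℕ) (st : (Fin b → Fin n) × Bool) : ℝ :=
  (1 / (n : ℝ)) ^ b * (if st.2 then 1 / (m : ℝ) else 1 - 1 / (m : ℝ))

theorem sum_batchCoinLaw (n b m : ℕ) (φ : (Fin b → Fin n) × Bool → ℝ) :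
    ∑ st, batchCoinLaw n b m st * φ st = 1 / (m : ℝ) * batchAvg n b (fun s => φ (s, true)) +
      (1 - 1 / (m : ℝ)) * batchAvg n b (fun s => φ (s, false)) := by
  simp only [batchCoinLaw, batchAvg, Fintype.sum_prod_type, Fintype.sum_bool, Finset.mul_sum,
    ← Finset.sum_add_distrib]
  refine Finset.sum_congr rfl fun s _ => ?_
  simp only [if_true, Bool.false_eq_true, if_false]
  ring

theorem IsBatchCoinSequence.isDrawSequence {Ω : Type*} [MeasurableSpace Ω] {P : Measure Ω}
    {b m : ℕ} {I : ℕ → Ω → Fin b → Fin n} {c : ℕ → Ω → Bool} (hm : 1 ≤ m)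
    (h : IsBatchCoinSequence P m I c) :
    IsDrawSequence P (batchCoinLaw n b m) fun k ω => (I k ω, c k ω) where
  nonneg st := by
    have h1 : (1 : ℝ) ≤ m := by exact_mod_cast hm
    have : 1 / (m : ℝ) ≤ 1 := by rw [div_le_one (by positivity)]; exact h1
    unfold batchCoinLaw
    split_ifs
    · positivity
    · exact mul_nonneg (by positivity) (by linarith)
  measurable k := (h.measurable_batch k).prodMk (h.measurable_coin k)
  indep := h.indep
  law k st := by
    obtain ⟨s, t⟩ := st
    simp only [Prod.mk.injEq]
    exact h.law k s t

theorem IsBatchSequence.isDrawSequence {Ω : Type*} [MeasurableSpace Ω] {P : Measure Ω}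
    {b : ℕ} {I : ℕ → Ω → Fin b → Fin n} (h : IsBatchSequence P I) :
    IsDrawSequence P (fun _ : Fin b → Fin n => (1 / (n : ℝ)) ^ b) I where
  nonneg _ := by positivity
  measurable := h.measurable
  indep := h.indep
  law := h.law

end SVRMM

end

noncomputable section

namespace SVRMM

variable {d n b : ℕ} {f : Fin n → Space d → ℝ} {r : Space d → EReal} {L : ℝ}
  {u : Space d → Space d → EReal} {μ : ℝ}

/-! ### The summed bound on the squared stationarity gaps -/

/-- Each iterate takes finitely many values, and the expected squared stationarity gaps of the
iterates sum to at most `C Lu` when `Lu` is a valid constant on a set containing the iterates. -/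
def HasSummedGapBound {Ω : Type*} [MeasurableSpace Ω] (P : Measure Ω) (F : Space d → EReal)
    (r : Space d → EReal) (u : Space d → Space d → EReal) (x : ℕ → Ω → Space d) (C : ℝ → ℝ) :
    Prop :=
  (∀ k, (Set.range (x k)).Finite) ∧
    ∀ (S : Set (Space d)) (Lu : ℝ), 0 ≤ Lu → SubdiffGapOn u r S Lu → ∀ K : ℕ,
      (∀ k ≤ K, ∀ᵐ ω ∂P, x k ω ∈ S) →
        ∑ k ∈ Finset.Icc 1 K, ∫⁻ ω, stationarityGap F (x k ω) ^ 2 ∂P ≤ ENNReal.ofReal (C Lu)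

/-- The weighted squared step length and squared gradient error of one step. -/
def stepCost (f : Fin n → Space d → ℝ) (B N : ℝ) (x g x' : Space d) : ℝ :=
  2 * B ^ 2 / N * ‖x' - x‖ ^ 2 + 2 / N * ‖g - gradient (avg f) x‖ ^ 2

theorem stepCost_nonneg {B N : ℝ} (hN : 0 < N) (x g x' : Space d) : 0 ≤ stepCost f B N x g x' := by
  unfold stepCost; positivity

theorem IsMMStep.stationarityGap_sq_le_stepCost {x g x' : Space d} (hn : 1 ≤ n)
    (h : BasicAssumption f r L)
    (hs : IsSurrogate u r) (hu : SurrogateAssumption u r) (hμ : 0 < μ) (hx : r x ≠ ⊤)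
    (hstep : IsMMStep u μ x g x') {S : Set (Space d)} {Lu : ℝ} (hS : SubdiffGapOn u r S Lu)
    (hxS : x ∈ S) (hxS' : x' ∈ S) {N : ℝ} (hN : 0 < N) :
    stationarityGap (objective f r) x' ^ 2 ≤
      ENNReal.ofReal (N * stepCost f (L + μ + Lu) N x g x') := by
  refine (hstep.stationarityGap_sq_le hn h hs hu hμ hx hS hxS hxS').trans (le_of_eq ?_)
  unfold stepCost
  congr 1
  field_simp

/-- The mean of component gradient differences over a batch. -/
def batchGrad (f : Fin n → Space d → ℝ) (s : Fin b → Fin n) (x w : Space d) : Space d :=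
  (1 / (b : ℝ)) • ∑ j, (gradient (f (s j)) x - gradient (f (s j)) w)

theorem batchGrad_self (s : Fin b → Fin n) (x : Space d) : batchGrad f s x x = 0 := by
  simp [batchGrad]

/-- The mean squared difference of component gradients at two points. -/
def gradSpread (f : Fin n → Space d → ℝ) (x w : Space d) : ℝ :=
  meanSq fun i => gradient (f i) x - gradient (f i) w

theorem gradSpread_nonneg (x w : Space d) : 0 ≤ gradSpread f x w := meanSq_nonneg _

theorem gradSpread_self (x : Space d) : gradSpread f x x = 0 := by simp [gradSpread, meanSq]

theorem BasicAssumption.gradSpread_le (h : BasicAssumption f r L) {c : ℝ} (hc : 0 < c)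
    (x x' w : Space d) : gradSpread f x' w ≤
      (1 + 1 / c) * (L ^ 2 * ‖x' - x‖ ^ 2) + (1 + c) * gradSpread f x w := by
  have h1 := meanSq_add_le hc (fun i => gradient (f i) x' - gradient (f i) x)
    (fun i => gradient (f i) x - gradient (f i) w)
  simp only [sub_add_sub_cancel] at h1
  have h2 := mul_le_mul_of_nonneg_left (h.meanSq_le x' x) (show 0 ≤ 1 + 1 / c by positivity)
  exact h1.trans (add_le_add_left h2 _)

/-- Average squared norm of the batch error, shifted by a fixed vector. -/
theorem BasicAssumption.batchAvg_norm_batchGrad_sq_le (hn : 1 ≤ n) (hb : 1 ≤ b)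
    (h : BasicAssumption f r L) (x w a : Space d) :
    batchAvg n b (fun s => ‖batchGrad f s x w - (gradient (avg f) x - gradient (avg f) w) + a‖ ^ 2)
      ≤ gradSpread f x w / b + ‖a‖ ^ 2 := by
  have h1 := batchAvg_norm_batch_sub_mean_sq hn hb
    (fun i => gradient (f i) x - gradient (f i) w) a
  rw [mean_sub, ← h.gradient_avg, ← h.gradient_avg] at h1
  refine le_trans (le_of_eq h1) (add_le_add_left ?_ _)
  refine div_le_div_of_nonneg_right ?_ (by positivity)
  exact sub_le_self _ (sq_nonneg _)

theorem batchAvg_le_add_mul (hn : 1 ≤ n) {φ ψ : (Fin b → Fin n) → ℝ} {a ν : ℝ}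
    (h : ∀ s, φ s ≤ a + ν * ψ s) : batchAvg n b φ ≤ a + ν * batchAvg n b ψ := by
  refine (batchAvg_mono h).trans (le_of_eq ?_)
  rw [batchAvg_add (fun _ => a), batchAvg_const hn, batchAvg_mul_left]

/-! ### Loop-less SVRG -/

/-- One step of loop-less SVRG on the pair of the iterate and the reference point. -/
def svrgStep (f : Fin n → Space d → ℝ) (u : Space d → Space d → EReal) (μ : ℝ)
    (z : Space d × Space d) (st : (Fin b → Fin n) × Bool) : Space d × Space d :=
  let w := if st.2 then z.1 else z.2
  (mmStep u μ z.1 (batchGrad f st.1 z.1 w + gradient (avg f) w), w)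

/-- `κ` weights the gradient spread in the potential. With `t = m - 1` and `c = 1/(2t)`, the fixed
point of the second condition is `κ = 2tν/β`, and the first reduces to `2t ≤ 2t + 2`. For `m = 1`
the reference point is always fresh and `κ = 0` works. -/
theorem svrg_weights {m : ℕ} (hm : 1 ≤ m) {ν β : ℝ} (hν : 0 ≤ ν) (hb : 0 < β) :
    ∃ c κ : ℝ, 0 < c ∧ 0 ≤ κ ∧
      κ * ((1 + 1 / c) * L ^ 2) ≤ (2 * (m : ℝ) - 1) * L ^ 2 / β / (1 / (2 * (m : ℝ))) * ν ∧
      (1 - 1 / (m : ℝ)) * (ν / β + κ * (1 + c)) ≤ κ := by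
  rcases eq_or_lt_of_le hm with rfl | hm
  · refine ⟨1, 0, one_pos, le_rfl, ?_, by norm_num⟩
    rw [zero_mul]
    norm_num
    positivity
  · have h1 : (1 : ℝ) < m := by exact_mod_cast hm
    obtain ⟨t, ht⟩ : ∃ t : ℝ, t = m - 1 := ⟨_, rfl⟩
    have ht0 : 0 < t := by linarith
    have hmt : (m : ℝ) = t + 1 := by linarith
    rw [hmt]
    refine ⟨1 / (2 * t), 2 * t * ν / β, by positivity, by positivity, ?_, le_of_eq ?_⟩
    · have e1 : 2 * t * ν / β * ((1 + 1 / (1 / (2 * t))) * L ^ 2) =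
          (2 * t) * ((2 * t + 1) * L ^ 2 * ν / β) := by field_simp; ring
      have e2 : (2 * (t + 1) - 1) * L ^ 2 / β / (1 / (2 * (t + 1))) * ν =
          (2 * t + 2) * ((2 * t + 1) * L ^ 2 * ν / β) := by field_simp; ring
      rw [e1, e2]
      refine mul_le_mul_of_nonneg_right (by linarith) (by positivity)
    · field_simp
      ring

/-- When the coin refreshes the reference point, the gradient estimate is exact and no spread is
carried over. Otherwise the batch error is at most the spread over `b`, and Young's inequality
controls the growth of the spread along the step. -/
theorem svrgStep_potential_le (hn : 1 ≤ n) (hb : 1 ≤ b) {m : ℕ} (hm : 1 ≤ m)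
    (h : BasicAssumption f r L) (hs : IsSurrogate u r) (hu : SurrogateAssumption u r)
    (hμ : L / 2 < μ) {B N ν κ c : ℝ} (hc : 0 < c) (hκ : 0 ≤ κ)
    (hN : 0 < N) (hν : ν = 1 / (2 * μ - L) + 2 / N)
    (hw1 : 2 * B ^ 2 / N + κ * ((1 + 1 / c) * L ^ 2) ≤ (2 * μ - L) / 4)
    (hw2 : (1 - 1 / (m : ℝ)) * (ν / b + κ * (1 + c)) ≤ κ)
    {z : Space d × Space d} (hz : r z.1 ≠ ⊤) :
    ∑ st : (Fin b → Fin n) × Bool, batchCoinLaw n b m st *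
      ((objective f r (svrgStep f u μ z st).1).toReal +
        κ * gradSpread f (svrgStep f u μ z st).1 (svrgStep f u μ z st).2 +
        stepCost f B N z.1 (batchGrad f st.1 z.1 (svrgStep f u μ z st).2 +
          gradient (avg f) (svrgStep f u μ z st).2) (svrgStep f u μ z st).1) ≤
      (objective f r z.1).toReal + κ * gradSpread f z.1 z.2 := by
  have hL := h.L_pos
  have hμ0 : 0 < μ := by linarith
  have hs0 : 0 < 2 * μ - L := by linarith
  have hν0 : 0 ≤ ν := by rw [hν]; positivity
  have key : ∀ (s : Fin b → Fin n) (w : Space d),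
      (objective f r (mmStep u μ z.1 (batchGrad f s z.1 w + gradient (avg f) w))).toReal +
        κ * gradSpread f (mmStep u μ z.1 (batchGrad f s z.1 w + gradient (avg f) w)) w +
        stepCost f B N z.1 (batchGrad f s z.1 w + gradient (avg f) w)
          (mmStep u μ z.1 (batchGrad f s z.1 w + gradient (avg f) w)) ≤
      ((objective f r z.1).toReal + κ * (1 + c) * gradSpread f z.1 w) +
        ν * ‖batchGrad f s z.1 w - (gradient (avg f) z.1 - gradient (avg f) w) + 0‖ ^ 2 := by
    intro s w
    have hstep := isMMStep_mmStep h hs hu hμ0 hz (batchGrad f s z.1 w + gradient (avg f) w)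
    generalize mmStep u μ z.1 (batchGrad f s z.1 w + gradient (avg f) w) = x' at *
    have h1 := hstep.objective_le_young hn hμ h hs hu hz
    have h2 := mul_le_mul_of_nonneg_left (h.gradSpread_le hc z.1 x' w) hκ
    have e1 : batchGrad f s z.1 w - (gradient (avg f) z.1 - gradient (avg f) w) + 0 =
        batchGrad f s z.1 w + gradient (avg f) w - gradient (avg f) z.1 := by abel
    have h3 := mul_le_mul_of_nonneg_right hw1 (sq_nonneg ‖x' - z.1‖)
    rw [e1, hν, stepCost]
    linarith
  rw [sum_batchCoinLaw]
  simp only [svrgStep, if_true, Bool.false_eq_true, if_false]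
  have hm1 : (1 : ℝ) ≤ m := by exact_mod_cast hm
  have hp0 : 0 ≤ 1 / (m : ℝ) := by positivity
  have hp1 : 0 ≤ 1 - 1 / (m : ℝ) := by
    rw [sub_nonneg, div_le_one (by positivity)]; exact hm1
  have t1 := batchAvg_mono fun s => key s z.1
  have t2 := batchAvg_le_add_mul hn fun s => key s z.2
  simp only [batchGrad_self, sub_self, add_zero, gradSpread_self, norm_zero, mul_zero,
    ne_eq, OfNat.ofNat_ne_zero, not_false_eq_true, zero_pow, zero_add, batchAvg_const hn] at t1
  have t3 := mul_le_mul_of_nonneg_left (h.batchAvg_norm_batchGrad_sq_le hn hb z.1 z.2 0) hν0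
  rw [norm_zero, zero_pow two_ne_zero, add_zero] at t3
  have t4 := mul_le_mul_of_nonneg_right hw2 (gradSpread_nonneg (f := f) z.1 z.2)
  have t5 := mul_le_mul_of_nonneg_left t1 hp0
  have t6 := mul_le_mul_of_nonneg_left (t2.trans (add_le_add_right t3 _)) hp1
  simp only [batchGrad_self, zero_add, batchAvg_const hn]
  have e : (1 - 1 / (m : ℝ)) * ((objective f r z.1).toReal + κ * (1 + c) * gradSpread f z.1 z.2 +
      ν * (gradSpread f z.1 z.2 / b)) = (1 - 1 / (m : ℝ)) * (objective f r z.1).toReal +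
      (1 - 1 / (m : ℝ)) * (ν / b + κ * (1 + c)) * gradSpread f z.1 z.2 := by ring
  linarith

theorem IsSvrgRun.hasSummedGapBound {Ω : Type*} [MeasurableSpace Ω] {P : Measure Ω}
    [IsProbabilityMeasure P] (hn : 1 ≤ n) (hb : 1 ≤ b) {m : ℕ} (hm : 1 ≤ m)
    (h : BasicAssumption f r L) (hs : IsSurrogate u r) (hu : SurrogateAssumption u r)
    (hμ : L / 2 < μ) {x₀ : Space d} (hx₀ : r x₀ ≠ ⊤) {x : ℕ → Ω → Space d}
    (hcond : 0 < (Method.svrg m).margin n b L μ) (hx : IsSvrgRun P b m f u μ x₀ x) :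
    HasSummedGapBound P (objective f r) r u x fun Lu => (Method.svrg m).complexityConst n b L μ Lu
      ((objective f r x₀).toReal - optimalValue f r) := by
  obtain ⟨I, coin, w, hI, hx0, hw0, hw, hstep⟩ := hx
  have hL := h.L_pos
  have hμ0 : 0 < μ := by linarith
  have hs0 : 0 < 2 * μ - L := by linarith
  have hm1 : (1 : ℝ) ≤ m := by exact_mod_cast hm
  have hb0 : (0 : ℝ) < b := by exact_mod_cast hb
  have hξ := hI.isDrawSequence hm
  have hfin : ∀ k ω, r (x k ω) ≠ ⊤ := by
    intro k ω
    induction k with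
    | zero => rwa [hx0]
    | succ k ih => exact (hstep k ω).ne_top h hs hu ih
  have hZ : IsDrivenBy (svrgStep (b := b) f u μ) (x₀, x₀) (fun k ω => (I k ω, coin k ω))
      fun k ω => (x k ω, w k ω) := by
    refine ⟨fun ω => by rw [hx0, hw0], fun k ω => ?_⟩
    have h1 : x (k + 1) ω = _ := (hstep k ω).eq_mmStep h hs hu hμ0 (hfin k ω)
    rw [h1]
    simp only [svrgStep, hw, batchGrad]
  refine ⟨fun k => ((hZ.finite_range k).image Prod.fst).subset ?_, ?_⟩
  · rintro _ ⟨ω, rfl⟩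
    exact ⟨_, ⟨ω, rfl⟩, rfl⟩
  intro S Lu hLu hS K hK
  have hA : 0 ≤ (Method.svrg m).VUps n b L / (Method.svrg m).rho n b := by
    simp only [Method.VUps, Method.rho]
    have : (0 : ℝ) ≤ 2 * m - 1 := by linarith
    positivity
  obtain ⟨N, hN⟩ : ∃ N, N = 8 * (2 * μ - L) * ((L + μ + Lu) ^ 2 + (Method.svrg m).VUps n b L /
    (Method.svrg m).rho n b) / (Method.svrg m).margin n b L μ := ⟨_, rfl⟩
  obtain ⟨hN0, hbal⟩ := complexity_factor hs0 hA (B := L + μ + Lu) (by positivity) hcond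
    (by simp [Method.margin, Method.V]) hN
  obtain ⟨ν, hν⟩ : ∃ ν, ν = 1 / (2 * μ - L) + 2 / N := ⟨_, rfl⟩
  have hν0 : 0 ≤ ν := by rw [hν]; positivity
  obtain ⟨c, κ, hc, hκ, hw1, hw2⟩ := svrg_weights (L := L) hm hν0 hb0
  rw [← hν] at hbal
  have main := hξ.sum_lintegral_gap_le (F := objective f r) hZ (good := fun z => r z.1 ≠ ⊤) hx₀
    (fun z s hz => (isMMStep_mmStep h hs hu hμ0 hz _).ne_top h hs hu hz)
    (Φ := fun z => (objective f r z.1).toReal + κ * gradSpread f z.1 z.2)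
    (η := fun z st => stepCost f (L + μ + Lu) N z.1 (batchGrad f st.1 z.1 (svrgStep f u μ z st).2 +
          gradient (avg f) (svrgStep f u μ z st).2) (svrgStep f u μ z st).1)
    (c := optimalValue f r)
    (fun z hz => (h.optimalValue_le hz).trans
      (le_add_of_nonneg_right (mul_nonneg hκ (gradSpread_nonneg _ _))))
    (fun z st _ => stepCost_nonneg hN0 _ _ _)
    (fun z hz => svrgStep_potential_le hn hb hm h hs hu hμ hc hκ hN0 hν
      ((add_le_add_right hw1 _).trans hbal) hw2 hz)
    (pos := Prod.fst) (S := S) hN0.le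
    (fun z s hz h1 h2 => (isMMStep_mmStep h hs hu hμ0 hz _).stationarityGap_sq_le_stepCost hn h hs
      hu hμ0 hz hS h1 h2 hN0) hK
  refine main.trans (le_of_eq ?_)
  simp only [gradSpread_self, mul_zero, add_zero, Method.complexityConst]
  rw [hN]
  congr 1
  ring

/-! ### Loop-less SARAH -/

/-- One step of loop-less SARAH on the iterate, the previous iterate and the previous estimate. -/
def sarahStep (f : Fin n → Space d → ℝ) (u : Space d → Space d → EReal) (μ : ℝ)
    (z : Space d × Space d × Space d) (st : (Fin b → Fin n) × Bool) : Space d × Space d × Space d :=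
  let v := if st.2 then gradient (avg f) z.1 else batchGrad f st.1 z.1 z.2.1 + z.2.2
  (mmStep u μ z.1 v, z.1, v)

/-- The error of the recursive estimate together with the squared length of the last step. -/
def sarahError (f : Fin n → Space d → ℝ) (β : ℝ) (z : Space d × Space d × Space d) : ℝ :=
  ‖z.2.2 - gradient (avg f) z.2.1‖ ^ 2 + β * ‖z.1 - z.2.1‖ ^ 2

/-- Without refresh, the new batch noise has mean zero and the squared errors add: the expected new
error is at most the old one plus `L²/b` times the squared last step, which is exactly `sarahError`.
-/
theorem sarahStep_potential_le (hn : 1 ≤ n) (hb : 1 ≤ b) {m : ℕ} (hm : 1 ≤ m)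
    (h : BasicAssumption f r L) (hs : IsSurrogate u r) (hu : SurrogateAssumption u r)
    (hμ : L / 2 < μ) {B N ν κ : ℝ} (hκ : 0 ≤ κ)
    (hN : 0 < N) (hν : ν = 1 / (2 * μ - L) + 2 / N)
    (hw1 : 2 * B ^ 2 / N + κ * (L ^ 2 / b) ≤ (2 * μ - L) / 4)
    (hw2 : (1 - 1 / (m : ℝ)) * (ν + κ) ≤ κ)
    {z : Space d × Space d × Space d} (hz : r z.1 ≠ ⊤) :
    ∑ st : (Fin b → Fin n) × Bool, batchCoinLaw n b m st *
      ((objective f r (sarahStep f u μ z st).1).toReal +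
        κ * sarahError f (L ^ 2 / b) (sarahStep f u μ z st) +
        stepCost f B N z.1 (sarahStep f u μ z st).2.2 (sarahStep f u μ z st).1) ≤
      (objective f r z.1).toReal + κ * sarahError f (L ^ 2 / b) z := by
  have hL := h.L_pos
  have hμ0 : 0 < μ := by linarith
  have hs0 : 0 < 2 * μ - L := by linarith
  have hν0 : 0 ≤ ν := by rw [hν]; positivity
  have key : ∀ v : Space d, (objective f r (mmStep u μ z.1 v)).toReal +
        κ * sarahError f (L ^ 2 / b) (mmStep u μ z.1 v, z.1, v) +
        stepCost f B N z.1 v (mmStep u μ z.1 v) ≤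
      (objective f r z.1).toReal + (ν + κ) * ‖v - gradient (avg f) z.1‖ ^ 2 := by
    intro v
    have hstep := isMMStep_mmStep h hs hu hμ0 hz v
    generalize mmStep u μ z.1 v = x' at *
    have h1 := hstep.objective_le_young hn hμ h hs hu hz
    have h3 := mul_le_mul_of_nonneg_right hw1 (sq_nonneg ‖x' - z.1‖)
    rw [hν, stepCost, sarahError]
    linarith
  rw [sum_batchCoinLaw]
  simp only [sarahStep, if_true, Bool.false_eq_true, if_false]
  have hm1 : (1 : ℝ) ≤ m := by exact_mod_cast hm
  have hp0 : 0 ≤ 1 / (m : ℝ) := by positivity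
  have hp1 : 0 ≤ 1 - 1 / (m : ℝ) := by
    rw [sub_nonneg, div_le_one (by positivity)]; exact hm1
  have t1 := batchAvg_mono (b := b) fun _ : Fin b → Fin n => key (gradient (avg f) z.1)
  have t2 := batchAvg_le_add_mul hn fun s : Fin b → Fin n => key (batchGrad f s z.1 z.2.1 + z.2.2)
  simp only [sub_self, norm_zero, ne_eq, OfNat.ofNat_ne_zero, not_false_eq_true, zero_pow,
    mul_zero, add_zero, batchAvg_const hn] at t1
  have t3 := h.batchAvg_norm_batchGrad_sq_le hn hb z.1 z.2.1 (z.2.2 - gradient (avg f) z.2.1)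
  have e0 : ∀ s : Fin b → Fin n, batchGrad f s z.1 z.2.1 - (gradient (avg f) z.1 -
      gradient (avg f) z.2.1) + (z.2.2 - gradient (avg f) z.2.1) =
      batchGrad f s z.1 z.2.1 + z.2.2 - gradient (avg f) z.1 := fun s => by abel
  simp only [e0] at t3
  have t4 : gradSpread f z.1 z.2.1 / b + ‖z.2.2 - gradient (avg f) z.2.1‖ ^ 2 ≤
      sarahError f (L ^ 2 / b) z := by
    have := div_le_div_of_nonneg_right (h.meanSq_le z.1 z.2.1) (show (0 : ℝ) ≤ b by positivity)
    rw [sarahError, gradSpread, div_mul_eq_mul_div]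
    linarith
  have t5 := mul_le_mul_of_nonneg_left (t3.trans t4) (add_nonneg hν0 hκ)
  have hE : 0 ≤ sarahError f (L ^ 2 / b) z := by unfold sarahError; positivity
  have t6 := mul_le_mul_of_nonneg_right hw2 hE
  have t7 := mul_le_mul_of_nonneg_left t1 hp0
  have t8 := mul_le_mul_of_nonneg_left (t2.trans (add_le_add_right t5 _)) hp1
  simp only [batchAvg_const hn]
  linarith

theorem IsSarahRun.hasSummedGapBound {Ω : Type*} [MeasurableSpace Ω] {P : Measure Ω}
    [IsProbabilityMeasure P] (hn : 1 ≤ n) (hb : 1 ≤ b) {m : ℕ} (hm : 1 ≤ m)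
    (h : BasicAssumption f r L) (hs : IsSurrogate u r) (hu : SurrogateAssumption u r)
    (hμ : L / 2 < μ) {x₀ : Space d} (hx₀ : r x₀ ≠ ⊤) {x : ℕ → Ω → Space d}
    (hcond : 0 < (Method.sarah m).margin n b L μ) (hx : IsSarahRun P b m f u μ x₀ x) :
    HasSummedGapBound P (objective f r) r u x fun Lu => (Method.sarah m).complexityConst n b L μ Lu
      ((objective f r x₀).toReal - optimalValue f r) := by
  obtain ⟨I, coin, w, v, hI, hx0, hw0, hw, hv0, hv, hstep⟩ := hx
  have hL := h.L_pos
  have hμ0 : 0 < μ := by linarith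
  have hs0 : 0 < 2 * μ - L := by linarith
  have hm1 : (1 : ℝ) ≤ m := by exact_mod_cast hm
  have hb0 : (0 : ℝ) < b := by exact_mod_cast hb
  have hξ := hI.isDrawSequence hm
  have hfin : ∀ k ω, r (x k ω) ≠ ⊤ := by
    intro k ω
    induction k with
    | zero => rwa [hx0]
    | succ k ih => exact (hstep k ω).ne_top h hs hu ih
  have hZ : IsDrivenBy (sarahStep (b := b) f u μ) (x₀, x₀, gradient (avg f) x₀)
      (fun k ω => (I k ω, coin k ω)) fun k ω => (x k ω, w k ω, v k ω) := by
    refine ⟨fun ω => by rw [hx0, hw0, hv0], fun k ω => ?_⟩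
    have h1 : x (k + 1) ω = _ := (hstep k ω).eq_mmStep h hs hu hμ0 (hfin k ω)
    rw [h1]
    simp only [sarahStep, hw, hv, batchGrad]
  refine ⟨fun k => ((hZ.finite_range k).image Prod.fst).subset ?_, ?_⟩
  · rintro _ ⟨ω, rfl⟩
    exact ⟨_, ⟨ω, rfl⟩, rfl⟩
  intro S Lu hLu hS K hK
  have hA0 : (Method.sarah m).VUps n b L / (Method.sarah m).rho n b = (m - 1) * (L ^ 2 / b) := by
    simp only [Method.VUps, Method.rho]
    field_simp
  have hA : 0 ≤ (Method.sarah m).VUps n b L / (Method.sarah m).rho n b := by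
    rw [hA0]
    exact mul_nonneg (by linarith) (by positivity)
  obtain ⟨N, hN⟩ : ∃ N, N = 8 * (2 * μ - L) * ((L + μ + Lu) ^ 2 + (Method.sarah m).VUps n b L /
    (Method.sarah m).rho n b) / (Method.sarah m).margin n b L μ := ⟨_, rfl⟩
  -- The margin also subtracts `4V = 4L²/b`, so it lies below `s² - 4A`.
  obtain ⟨hN0, hbal⟩ := complexity_factor hs0 hA (B := L + μ + Lu) (by positivity) hcond
    (by
      have : 0 ≤ L ^ 2 / (b : ℝ) := by positivity
      simp only [Method.margin, Method.V]
      linarith) hN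
  obtain ⟨ν, hν⟩ : ∃ ν, ν = 1 / (2 * μ - L) + 2 / N := ⟨_, rfl⟩
  have hν0 : 0 ≤ ν := by rw [hν]; positivity
  -- `κ = (m - 1)ν` is the fixed point of `(1 - 1/m)(ν + κ) = κ`, and `κ L²/b = ν V_Υ/ρ`.
  have hκ : 0 ≤ (m - 1) * ν := mul_nonneg (by linarith) hν0
  rw [← hν, hA0] at hbal
  have main := hξ.sum_lintegral_gap_le (F := objective f r) hZ (good := fun z => r z.1 ≠ ⊤) hx₀
    (fun z s hz => (isMMStep_mmStep h hs hu hμ0 hz _).ne_top h hs hu hz)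
    (Φ := fun z => (objective f r z.1).toReal + (m - 1) * ν * sarahError f (L ^ 2 / b) z)
    (η := fun z st => stepCost f (L + μ + Lu) N z.1 (sarahStep f u μ z st).2.2
      (sarahStep f u μ z st).1)
    (c := optimalValue f r)
    (fun z hz => (h.optimalValue_le hz).trans (le_add_of_nonneg_right (mul_nonneg hκ (by
      unfold sarahError; positivity))))
    (fun z st _ => stepCost_nonneg hN0 _ _ _)
    (fun z hz => sarahStep_potential_le hn hb hm h hs hu hμ hκ hN0 hν
      (by linarith) (by field_simp; linarith) hz)
    (pos := Prod.fst) (S := S) hN0.le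
    (fun z s hz h1 h2 => (isMMStep_mmStep h hs hu hμ0 hz _).stationarityGap_sq_le_stepCost hn h hs
      hu hμ0 hz hS h1 h2 hN0) hK
  refine main.trans (le_of_eq ?_)
  simp only [sarahError, sub_self, norm_zero, ne_eq, OfNat.ofNat_ne_zero, not_false_eq_true,
    zero_pow, mul_zero, add_zero, Method.complexityConst]
  rw [hN]
  congr 1
  ring

end SVRMM

end

noncomputable section

namespace SVRMM

variable {d n b : ℕ} {f : Fin n → Space d → ℝ} {r : Space d → EReal} {L : ℝ}
  {u : Space d → Space d → EReal} {μ : ℝ}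

/-! ### Indices avoided by a batch -/

theorem batchAvg_sum {ι : Type*} (T : Finset ι) (φ : ι → (Fin b → Fin n) → ℝ) :
    batchAvg n b (fun s => ∑ i ∈ T, φ i s) = ∑ i ∈ T, batchAvg n b (φ i) := by
  simp only [batchAvg, ← Finset.mul_sum]
  rw [Finset.sum_comm]

theorem batchAvg_mul_right (φ : (Fin b → Fin n) → ℝ) (c : ℝ) :
    batchAvg n b (fun s => φ s * c) = batchAvg n b φ * c := by
  simp only [mul_comm _ c, batchAvg_mul_left]

theorem batchAvg_prod (φ : Fin n → ℝ) :
    batchAvg n b (fun s => ∏ j, φ (s j)) = ((1 / (n : ℝ)) * ∑ i, φ i) ^ b := by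
  rw [batchAvg, mul_pow, ← Fintype.sum_pow]

/-- The indicator that index `i` does not occur in the batch `s`. -/
def avoids (s : Fin b → Fin n) (i : Fin n) : ℝ := ∏ j, if s j = i then 0 else 1

theorem avoids_of_mem {s : Fin b → Fin n} {i : Fin n} (h : i ∈ Set.range s) : avoids s i = 0 := by
  obtain ⟨j, hj⟩ := h
  exact Finset.prod_eq_zero (Finset.mem_univ j) (by simp [hj])

theorem avoids_of_notMem {s : Fin b → Fin n} {i : Fin n} (h : i ∉ Set.range s) :
    avoids s i = 1 :=
  Finset.prod_eq_one fun j _ => if_neg fun hj => h ⟨j, hj⟩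

theorem avoids_sq (s : Fin b → Fin n) (i : Fin n) : avoids s i ^ 2 = avoids s i := by
  by_cases h : i ∈ Set.range s
  · simp [avoids_of_mem h]
  · simp [avoids_of_notMem h]

theorem batchAvg_avoids (hn : 1 ≤ n) (i : Fin n) :
    batchAvg n b (fun s => avoids s i) = (1 - 1 / (n : ℝ)) ^ b := by
  have hn0 : (n : ℝ) ≠ 0 := by positivity
  have h1 : ∑ k : Fin n, (if k = i then (0 : ℝ) else 1) = n - 1 := by
    have : ∀ k : Fin n, (if k = i then (0 : ℝ) else 1) = 1 - if k = i then 1 else 0 := fun k => by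
      split_ifs <;> norm_num
    simp [this]
  simp only [avoids]
  rw [batchAvg_prod (fun k => if k = i then (0 : ℝ) else 1), h1]
  congr 1
  field_simp

theorem batchAvg_avoids_mul (hn : 1 ≤ n) {i k : Fin n} (hik : i ≠ k) :
    batchAvg n b (fun s => avoids s i * avoids s k) = (1 - 2 / (n : ℝ)) ^ b := by
  have hn0 : (n : ℝ) ≠ 0 := by positivity
  have h1 : ∑ l : Fin n, (if l = i then (0 : ℝ) else 1) * (if l = k then 0 else 1) = n - 2 := by
    have : ∀ l : Fin n, (if l = i then (0 : ℝ) else 1) * (if l = k then 0 else 1) =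
        1 - (if l = i then 1 else 0) - (if l = k then 1 else 0) := fun l => by
      by_cases h1 : l = i
      · subst h1; simp [hik]
      · simp only [h1, if_false]; split_ifs <;> norm_num
    simp only [this, Finset.sum_sub_distrib, Finset.sum_ite_eq', Finset.mem_univ, if_true,
      Finset.sum_const, Finset.card_univ, Fintype.card_fin, nsmul_eq_mul]
    ring
  simp only [avoids, ← Finset.prod_mul_distrib]
  rw [batchAvg_prod (fun l => (if l = i then (0 : ℝ) else 1) * (if l = k then 0 else 1)), h1]
  congr 1
  field_simp

theorem batchAvg_meanSq_avoids (hn : 1 ≤ n) (D : Fin n → Space d) :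
    batchAvg n b (fun s => meanSq fun i => avoids s i • D i) =
      (1 - 1 / (n : ℝ)) ^ b * meanSq D := by
  simp only [meanSq, norm_smul, mul_pow, Real.norm_eq_abs, sq_abs, avoids_sq]
  rw [batchAvg_mul_left, batchAvg_sum]
  simp only [batchAvg_mul_right, batchAvg_avoids hn, ← Finset.mul_sum]
  ring

theorem batchAvg_inner_mean_avoids (hn : 1 ≤ n) (D : Fin n → Space d) (v : Space d) :
    batchAvg n b (fun s => inner ℝ (mean fun i => avoids s i • D i) v) =
      (1 - 1 / (n : ℝ)) ^ b * inner ℝ (mean D) v := by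
  simp only [mean, real_inner_smul_left, sum_inner]
  rw [batchAvg_mul_left, batchAvg_sum]
  simp only [batchAvg_mul_right, batchAvg_avoids hn, ← Finset.mul_sum]
  ring

/-- In the double sum, pairs of distinct indices survive with probability `(1 - 2/n)^b` and diagonal
ones with `(1 - 1/n)^b`; the excess on the diagonal gives the `meanSq` term. -/
theorem batchAvg_norm_mean_avoids_sq (hn : 1 ≤ n) (D : Fin n → Space d) :
    batchAvg n b (fun s => ‖mean fun i => avoids s i • D i‖ ^ 2) =
      (1 - 2 / (n : ℝ)) ^ b * ‖mean D‖ ^ 2 +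
        ((1 - 1 / (n : ℝ)) ^ b - (1 - 2 / (n : ℝ)) ^ b) / n * meanSq D := by
  have hn0 : (n : ℝ) ≠ 0 := by positivity
  have h1 : ∀ X : Fin n → Space d,
      ‖mean X‖ ^ 2 = (1 / (n : ℝ)) ^ 2 * ∑ i, ∑ k, inner ℝ (X i) (X k) := by
    intro X
    rw [mean, norm_smul, mul_pow, Real.norm_eq_abs, sq_abs, ← real_inner_self_eq_norm_sq, sum_inner]
    simp only [inner_sum]
  have h2 : ∀ i k : Fin n, batchAvg n b (fun s => avoids s i * avoids s k) =
      (1 - 2 / (n : ℝ)) ^ b +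
        if i = k then (1 - 1 / (n : ℝ)) ^ b - (1 - 2 / (n : ℝ)) ^ b else 0 := by
    intro i k
    split_ifs with hik
    · subst hik
      simp only [← pow_two, avoids_sq, batchAvg_avoids hn]
      ring
    · rw [batchAvg_avoids_mul hn hik, add_zero]
  simp only [h1, real_inner_smul_left, real_inner_smul_right]
  rw [batchAvg_mul_left, batchAvg_sum]
  simp only [batchAvg_sum, ← mul_assoc, batchAvg_mul_right, h2, add_mul, ite_mul, zero_mul,
    Finset.sum_add_distrib, Finset.sum_ite_eq', Finset.mem_univ, if_true, ← Finset.mul_sum,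
    real_inner_self_eq_norm_sq]
  rw [meanSq]
  field_simp

theorem batchAvg_meanVar_avoids (hn : 1 ≤ n) (D : Fin n → Space d) :
    batchAvg n b (fun s => meanVar fun i => avoids s i • D i) =
      ((1 - 1 / (n : ℝ)) ^ b - (1 - 2 / (n : ℝ)) ^ b) * (1 - 1 / (n : ℝ)) * meanSq D +
        (1 - 2 / (n : ℝ)) ^ b * meanVar D := by
  have h1 := batchAvg_add (b := b) (fun s => meanVar fun i => avoids s i • D i)
    (fun s => ‖mean fun i => avoids s i • D i‖ ^ 2)
  simp only [meanVar, sub_add_cancel, batchAvg_meanSq_avoids hn,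
    batchAvg_norm_mean_avoids_sq hn] at h1 ⊢
  linear_combination -h1

/-- This is Jensen's inequality: the thinned mean averages to `q • mean D`, so its average squared
norm is at least `q² ‖mean D‖²`. -/
theorem batchAvg_meanVar_avoids_le (hn : 1 ≤ n) (D : Fin n → Space d) :
    batchAvg n b (fun s => meanVar fun i => avoids s i • D i) ≤
      (1 - 1 / (n : ℝ)) ^ b * (1 - (1 - 1 / (n : ℝ)) ^ b) * meanSq D +
        ((1 - 1 / (n : ℝ)) ^ b) ^ 2 * meanVar D := by
  obtain ⟨q, hq⟩ : ∃ q : ℝ, q = (1 - 1 / (n : ℝ)) ^ b := ⟨_, rfl⟩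
  have h1 : ∀ s : Fin b → Fin n, (meanVar fun i => avoids s i • D i) ≤
      (q ^ 2 * ‖mean D‖ ^ 2 + (-2 * q) * inner ℝ (mean fun i => avoids s i • D i) (mean D)) +
        meanSq fun i => avoids s i • D i := by
    intro s
    have := sq_nonneg ‖(mean fun i => avoids s i • D i) - q • mean D‖
    rw [norm_sub_sq_real, norm_smul, mul_pow, Real.norm_eq_abs, sq_abs, inner_smul_right] at this
    rw [meanVar]
    linarith
  refine (batchAvg_mono h1).trans (le_of_eq ?_)
  rw [batchAvg_add, batchAvg_add (fun _ => _), batchAvg_const hn, batchAvg_mul_left,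
    batchAvg_inner_mean_avoids hn, batchAvg_meanSq_avoids hn, real_inner_self_eq_norm_sq, ← hq,
    meanVar]
  ring

/-- Unbiasedness is read off by comparing the second moments with shift `v` and without shift. -/
theorem batchAvg_inner_batch_sub_mean (hn : 1 ≤ n) (hb : 1 ≤ b) (D : Fin n → Space d)
    (v : Space d) :
    batchAvg n b (fun s => inner ℝ ((1 / (b : ℝ)) • ∑ j, D (s j) - mean D) v) = 0 := by
  have h1 := batchAvg_norm_batch_sub_mean_sq hn hb D v
  have h0 := batchAvg_norm_batch_sub_mean_sq hn hb D 0
  simp only [add_zero, norm_zero, ne_eq, OfNat.ofNat_ne_zero, not_false_eq_true, zero_pow] at h0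
  simp only [norm_add_sq_real] at h1
  rw [batchAvg_add, batchAvg_add, batchAvg_mul_left, batchAvg_const hn, h0] at h1
  linarith

/-! ### SAGA -/

/-- One step of SAGA on the iterate and the table of stored points. -/
def sagaStep (f : Fin n → Space d → ℝ) (u : Space d → Space d → EReal) (μ : ℝ)
    (z : Space d × (Fin n → Space d)) (s : Fin b → Fin n) : Space d × (Fin n → Space d) :=
  (mmStep u μ z.1 ((1 / (b : ℝ)) • ∑ j, (gradient (f (s j)) z.1 - gradient (f (s j)) (z.2 (s j))) +
    mean fun i => gradient (f i) (z.2 i)), fun i => avoids s i • z.2 i + (1 - avoids s i) • z.1)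

/-- The gradient estimate used in a step of SAGA. -/
def sagaGrad (f : Fin n → Space d → ℝ) (z : Space d × (Fin n → Space d)) (s : Fin b → Fin n) :
    Space d :=
  (1 / (b : ℝ)) • ∑ j, (gradient (f (s j)) z.1 - gradient (f (s j)) (z.2 (s j))) +
    mean fun i => gradient (f i) (z.2 i)

/-- The differences between component gradients at the iterate and at the stored points. -/
def sagaDiff (f : Fin n → Space d → ℝ) (z : Space d × (Fin n → Space d)) (i : Fin n) : Space d :=
  gradient (f i) z.1 - gradient (f i) (z.2 i)

/-- In terms of gradient differences, a step first erases the entries hit by the batch and then adds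
the increments caused by the move of the iterate. -/
theorem sagaDiff_sagaStep (z : Space d × (Fin n → Space d)) (s : Fin b → Fin n) (i : Fin n) :
    sagaDiff f (sagaStep f u μ z s) i =
      (gradient (f i) (sagaStep f u μ z s).1 - gradient (f i) z.1) +
        avoids s i • sagaDiff f z i := by
  by_cases h : i ∈ Set.range s
  · simp [sagaDiff, sagaStep, avoids_of_mem h]
  · simp [sagaDiff, sagaStep, avoids_of_notMem h]

theorem BasicAssumption.sagaGrad_sub (h : BasicAssumption f r L)
    (z : Space d × (Fin n → Space d)) (s : Fin b → Fin n) :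
    sagaGrad f z s - gradient (avg f) z.1 =
      (1 / (b : ℝ)) • ∑ j, sagaDiff f z (s j) - mean (sagaDiff f z) := by
  unfold sagaDiff
  rw [mean_sub, h.gradient_avg, sagaGrad]
  abel

/-- The part of the SAGA potential that measures the differences of gradients. -/
def sagaPotential (a g : ℝ) (D : Fin n → Space d) : ℝ := a * meanVar D + g * meanSq D

theorem sagaPotential_nonneg (hn : 1 ≤ n) {a g : ℝ} (ha : 0 ≤ a) (hg : 0 ≤ g)
    (D : Fin n → Space d) : 0 ≤ sagaPotential a g D :=
  add_nonneg (mul_nonneg ha (meanVar_nonneg hn D)) (mul_nonneg hg (meanSq_nonneg D))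

/-- Here `X` will be the gradient increments of the step and `Y` the thinned differences. The
variance weight `a` is charged only for the spread of `X` about its mean, which is why `Γ₂ ‖mean
X‖²` is subtracted. -/
theorem sagaPotential_add_le (hn : 1 ≤ n) {a g c : ℝ} (ha : 0 ≤ a) (hg : 0 ≤ g) (hc : 0 < c)
    {Γ₁ Γ₂ : ℝ} (h1 : (1 + 1 / c) * (a + g) ≤ Γ₁) (h2 : Γ₂ ≤ (1 + 1 / c) * a)
    (X Y : Fin n → Space d) :
    sagaPotential a g (fun i => X i + Y i) ≤
      (Γ₁ * meanSq X - Γ₂ * ‖mean X‖ ^ 2) + (1 + c) * sagaPotential a g Y := by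
  have e1 := mul_le_mul_of_nonneg_left (meanVar_add_le hn hc X Y) ha
  have e2 := mul_le_mul_of_nonneg_left (meanSq_add_le hc X Y) hg
  have e3 := mul_le_mul_of_nonneg_right h1 (meanSq_nonneg X)
  have e4 := mul_le_mul_of_nonneg_right h2 (sq_nonneg ‖mean X‖)
  unfold sagaPotential
  have e5 : a * ((1 + 1 / c) * meanVar X + (1 + c) * meanVar Y) =
      (1 + 1 / c) * a * meanSq X - (1 + 1 / c) * a * ‖mean X‖ ^ 2 + (1 + c) * (a * meanVar Y) := by
    rw [meanVar]; ring
  linarith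

/-- Decrease of the SAGA potential in one step. -/
theorem sagaStep_potential_le (hn : 1 ≤ n) (hb : 1 ≤ b)
    (h : BasicAssumption f r L) (hs : IsSurrogate u r) (hu : SurrogateAssumption u r)
    (hμ : 0 < μ) {B N μ₀ σ A₁ A₂ Γ₁ Γ₂ a g c : ℝ}
    (hw : IsSagaWeight σ ((1 - 1 / (n : ℝ)) ^ b) A₁ A₂ Γ₁ Γ₂ a g c)
    (hvar : ∀ D : Fin n → Space d, batchAvg n b (fun s => meanVar fun i => avoids s i • D i) ≤
      A₁ * meanSq D + A₂ * meanVar D)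
    (hsmooth : ∀ x y : Space d, avg f y - avg f x - inner ℝ (gradient (avg f) x) (y - x) +
      Γ₁ / L * meanSq (fun i => gradient (f i) y - gradient (f i) x) -
      Γ₂ / L * ‖mean fun i => gradient (f i) y - gradient (f i) x‖ ^ 2 ≤ μ₀ * ‖y - x‖ ^ 2)
    (hw1 : μ₀ + 2 * B ^ 2 / N ≤ μ) (hw2 : (1 / μ + 2 / N) / b ≤ σ / L)
    {z : Space d × (Fin n → Space d)} (hz : r z.1 ≠ ⊤) :
    ∑ s : Fin b → Fin n, (1 / (n : ℝ)) ^ b *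
      ((objective f r (sagaStep f u μ z s).1).toReal +
        1 / L * sagaPotential a g (sagaDiff f (sagaStep f u μ z s)) +
        stepCost f B N z.1 (sagaGrad f z s) (sagaStep f u μ z s).1) ≤
      (objective f r z.1).toReal + 1 / L * sagaPotential a g (sagaDiff f z) := by
  obtain ⟨ha, hg, hc, k1, k2, k3, k4⟩ := hw
  have hL := h.L_pos
  -- The step with the exact gradient does not depend on the batch.
  obtain ⟨y, hy⟩ : ∃ y, y = mmStep u μ z.1 (gradient (avg f) z.1) := ⟨_, rfl⟩
  have key : ∀ s : Fin b → Fin n, (objective f r (sagaStep f u μ z s).1).toReal +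
        1 / L * sagaPotential a g (sagaDiff f (sagaStep f u μ z s)) +
        stepCost f B N z.1 (sagaGrad f z s) (sagaStep f u μ z s).1 ≤
      (((objective f r z.1).toReal + (1 / μ + 2 / N) *
        ‖(1 / (b : ℝ)) • ∑ j, sagaDiff f z (s j) - mean (sagaDiff f z)‖ ^ 2) +
      (-1) * inner ℝ ((1 / (b : ℝ)) • ∑ j, sagaDiff f z (s j) - mean (sagaDiff f z)) (y - z.1)) +
      (1 + c) / L * sagaPotential a g fun i => avoids s i • sagaDiff f z i := by
    intro s
    have hstep : IsMMStep u μ z.1 (sagaGrad f z s) (sagaStep f u μ z s).1 :=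
      isMMStep_mmStep h hs hu hμ hz _
    have hstep' : IsMMStep u μ z.1 (gradient (avg f) z.1) y := by
      rw [hy]; exact isMMStep_mmStep h hs hu hμ hz _
    have d1 := hstep.objective_le h hs hu hz
    have d2 := hstep.norm_sub_le hμ (hu.convex_left z.1) (fun y => hs.ne_bot h y z.1)
      (by rwa [hs.eq_diag]) hstep'
    have d3 := hsmooth z.1 (sagaStep f u μ z s).1
    have d4 := sagaPotential_add_le hn ha hg hc k3 k4
      (fun i => gradient (f i) (sagaStep f u μ z s).1 - gradient (f i) z.1)
      (fun i => avoids s i • sagaDiff f z i)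
    simp only [← sagaDiff_sagaStep] at d4
    have d5 := mul_le_mul_of_nonneg_left d4 (show 0 ≤ 1 / L by positivity)
    generalize (sagaStep f u μ z s).1 = x' at *
    rw [← h.sagaGrad_sub, stepCost]
    generalize sagaGrad f z s - gradient (avg f) z.1 = e at *
    have d6 := real_inner_le_norm (-e) (x' - y)
    rw [norm_neg, inner_neg_left] at d6
    have d7 : ‖e‖ * ‖x' - y‖ ≤ 1 / μ * ‖e‖ ^ 2 := by
      calc _ ≤ ‖e‖ * (‖e‖ / μ) := mul_le_mul_of_nonneg_left d2 (norm_nonneg _)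
        _ = _ := by ring
    -- The last term averages to zero over batches, and `‖x' - y‖ ≤ ‖e‖/μ` bounds the other one.
    -- Unlike with Young's inequality, no part of `μ ‖x' - z.1‖²` is spent on the noise.
    have d8 : inner ℝ e (x' - z.1) = inner ℝ e (x' - y) + inner ℝ e (y - z.1) := by
      rw [← inner_add_right, sub_add_sub_cancel]
    have d9 := mul_le_mul_of_nonneg_right hw1 (sq_nonneg ‖x' - z.1‖)
    have d10 : 1 / L * (Γ₁ * (meanSq fun i => gradient (f i) x' - gradient (f i) z.1) -
        Γ₂ * ‖mean fun i => gradient (f i) x' - gradient (f i) z.1‖ ^ 2 +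
        (1 + c) * sagaPotential a g fun i => avoids s i • sagaDiff f z i) =
        Γ₁ / L * (meanSq fun i => gradient (f i) x' - gradient (f i) z.1) -
        Γ₂ / L * ‖mean fun i => gradient (f i) x' - gradient (f i) z.1‖ ^ 2 +
        (1 + c) / L * sagaPotential a g fun i => avoids s i • sagaDiff f z i := by ring
    rw [d10] at d5
    linarith
  rw [← Finset.mul_sum]
  refine (batchAvg_mono key).trans ?_
  have n1 := batchAvg_norm_batch_sub_mean_sq hn hb (sagaDiff f z) 0
  simp only [add_zero, norm_zero, ne_eq, OfNat.ofNat_ne_zero, not_false_eq_true, zero_pow] at n1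
  rw [batchAvg_add, batchAvg_add, batchAvg_add (fun _ => _), batchAvg_const hn, batchAvg_mul_left,
    batchAvg_mul_left, batchAvg_mul_left, batchAvg_inner_batch_sub_mean hn hb, n1]
  simp only [sagaPotential]
  rw [batchAvg_add, batchAvg_mul_left, batchAvg_mul_left, batchAvg_meanSq_avoids hn]
  generalize sagaDiff f z = D at *
  have v1 := mul_le_mul_of_nonneg_left (hvar D) ha
  have v2 := mul_le_mul_of_nonneg_right hw2 (meanVar_nonneg hn D)
  have v3 := mul_le_mul_of_nonneg_right k1 (meanVar_nonneg hn D)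
  have v4 := mul_le_mul_of_nonneg_right k2 (meanSq_nonneg D)
  have v5 := mul_le_mul_of_nonneg_left (add_le_add v3 v4) (show 0 ≤ 1 / L by positivity)
  have v6 := mul_le_mul_of_nonneg_left v1 (show 0 ≤ (1 + c) / L by positivity)
  have v7 : (1 / μ + 2 / N) * (meanVar D / b) = (1 / μ + 2 / N) / b * meanVar D := by ring
  rw [v7]
  have v8 : 1 / L * ((σ + (1 + c) * (a * A₂)) * meanVar D +
      (1 + c) * (a * A₁ + g * (1 - 1 / (n : ℝ)) ^ b) * meanSq D) =
      σ / L * meanVar D + (1 + c) / L * (a * (A₁ * meanSq D + A₂ * meanVar D)) +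
      (1 + c) / L * (g * ((1 - 1 / (n : ℝ)) ^ b * meanSq D)) := by ring
  rw [v8] at v5
  linarith

/-- Balance of the weights for SAGA, where `t ^ 2` is the normalized variance constant. -/
theorem saga_balance {B m N t : ℝ} (ht : 0 ≤ t) (hL : 0 < L) (hB : μ ≤ B)
    (hm : m = (2 * μ - L) ^ 2 - 4 * t ^ 2) (hm0 : 0 < m) (hμ : L / 2 < μ)
    (hN : N = 8 * (2 * μ - L) * (B ^ 2 + t ^ 2) / m) :
    0 < N ∧ t + L / 2 + 2 * B ^ 2 / N ≤ μ ∧ 1 / μ + 2 / N ≤ 1 / (t + L / 2) := by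
  have hμ0 : 0 < μ := by linarith
  have hB0 : 0 < B := by linarith
  obtain ⟨s, hs⟩ : ∃ s, s = 2 * μ - L := ⟨_, rfl⟩
  rw [← hs] at hm hN
  have hs0 : 0 < s := by linarith
  have hts : 2 * t < s := by
    refine lt_of_pow_lt_pow_left₀ 2 hs0.le ?_
    linarith
  have hN0 : 0 < N := by rw [hN]; positivity
  have hmf : m = (s - 2 * t) * (s + 2 * t) := by rw [hm]; ring
  have hN' : 1 / N = (s - 2 * t) * (s + 2 * t) / (8 * s * (B ^ 2 + t ^ 2)) := by
    rw [hN, hmf, one_div_div]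
  have hp : 0 < s - 2 * t := by linarith
  refine ⟨hN0, ?_, ?_⟩
  -- The available room is `μ - (t + L/2) = (s - 2t)/2`, and the margin supplies this factor in
  -- `1/N`.
  · have h1 : 2 * B ^ 2 / N ≤ (s - 2 * t) / 2 := by
      rw [show 2 * B ^ 2 / N = 2 * B ^ 2 * (1 / N) by ring, hN', ← mul_div_assoc,
        div_le_iff₀ (by positivity)]
      have h2 : 0 ≤ (s - 2 * t) * (4 * s * t ^ 2 + 2 * B ^ 2 * (s - 2 * t)) := by positivity
      linarith
    linarith
  · have hμ1 : 0 < t + L / 2 := by linarith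
    have h1 : 2 / N ≤ (s - 2 * t) / (2 * (μ * (t + L / 2))) := by
      rw [show 2 / N = 2 * (1 / N) by ring, hN', ← mul_div_assoc, div_le_div_iff₀ (by positivity)
        (by positivity)]
      have h2 : μ * (t + L / 2) ≤ B ^ 2 := by
        rw [pow_two]
        exact mul_le_mul hB (by linarith) hμ1.le hB0.le
      have h3 : (s + 2 * t) * (μ * (t + L / 2)) ≤ 2 * s * (B ^ 2 + t ^ 2) :=
        mul_le_mul (by linarith) (h2.trans (le_add_of_nonneg_right (sq_nonneg t)))
          (by positivity) (by positivity)
      have h4 := mul_le_mul_of_nonneg_left h3 (mul_pos four_pos hp).le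
      linarith
    have h5 : 1 / μ + (s - 2 * t) / (2 * (μ * (t + L / 2))) = 1 / (t + L / 2) := by
      rw [hs]; field_simp; ring
    linarith

theorem IsSagaRun.hasSummedGapBound {Ω : Type*} [MeasurableSpace Ω] {P : Measure Ω}
    [IsProbabilityMeasure P] (hn : 1 ≤ n) (hb : 1 ≤ b) (hbn : b ≤ n)
    (h : BasicAssumption f r L) (hs : IsSurrogate u r) (hu : SurrogateAssumption u r)
    (hμ : L / 2 < μ) {x₀ : Space d} (hx₀ : r x₀ ≠ ⊤) {x : ℕ → Ω → Space d}
    (hcond : 0 < Method.saga.margin n b L μ) (hx : IsSagaRun P b f u μ x₀ x) :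
    HasSummedGapBound P (objective f r) r u x fun Lu => Method.saga.complexityConst n b L μ Lu
      ((objective f r x₀).toReal - optimalValue f r) := by
  obtain ⟨I, w, hI, hx0, hw0, hw, hstep⟩ := hx
  have hL := h.L_pos
  have hμ0 : 0 < μ := by linarith
  have hb0 : (0 : ℝ) < b := by exact_mod_cast hb
  have hn0 : (0 : ℝ) < n := by exact_mod_cast hn
  have hbn' : (b : ℝ) ≤ n := by exact_mod_cast hbn
  have hξ := hI.isDrawSequence
  have hfin : ∀ k ω, r (x k ω) ≠ ⊤ := by
    intro k ω
    induction k with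
    | zero => rwa [hx0]
    | succ k ih => exact (hstep k ω).ne_top h hs hu ih
  have hZ : IsDrivenBy (sagaStep (b := b) f u μ) (x₀, fun _ => x₀) I
      fun k ω => (x k ω, fun i => w k i ω) := by
    refine ⟨fun ω => by simp only [hx0, hw0], fun k ω => ?_⟩
    have h1 : x (k + 1) ω = _ := (hstep k ω).eq_mmStep h hs hu hμ0 (hfin k ω)
    refine Prod.ext h1 (funext fun i => ?_)
    by_cases hi : i ∈ Set.range (I k ω)
    · simp [sagaStep, (hw k i ω).1 hi, avoids_of_mem hi]
    · simp [sagaStep, (hw k i ω).2 hi, avoids_of_notMem hi]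
  refine ⟨fun k => ((hZ.finite_range k).image Prod.fst).subset ?_, ?_⟩
  · rintro _ ⟨ω, rfl⟩
    exact ⟨_, ⟨ω, rfl⟩, rfl⟩
  intro S Lu hLu hS K hK
  obtain ⟨y, hy⟩ : ∃ y, y = Real.sqrt (2 * n * (2 * n - b) / b ^ 3) := ⟨_, rfl⟩
  have hy0 : 0 ≤ y := hy ▸ Real.sqrt_nonneg _
  have hnb : (0 : ℝ) ≤ 2 * n - b := by linarith
  have hysq : y ^ 2 = 2 * n * (2 * n - b) / b ^ 3 := by
    rw [hy, Real.sq_sqrt (by positivity)]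
  -- So the margin is positive exactly when `μ > L(y + 1/2)`, and `t = L y` in `saga_balance`.
  have hA : Method.saga.VUps n b L / Method.saga.rho n b = (L * y) ^ 2 := by
    simp only [Method.VUps, Method.rho]
    rw [mul_pow, hysq]
    field_simp
  obtain ⟨N, hN⟩ : ∃ N, N = 8 * (2 * μ - L) * ((L + μ + Lu) ^ 2 + Method.saga.VUps n b L /
    Method.saga.rho n b) / Method.saga.margin n b L μ := ⟨_, rfl⟩
  obtain ⟨hN0, bal1, bal2⟩ := saga_balance (B := L + μ + Lu) (mul_nonneg hL.le hy0) hL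
    (by linarith) (by rw [Method.margin, hA, Method.V, zero_add]) hcond hμ (hA ▸ hN)
  obtain ⟨A₁, A₂, Γ₁, Γ₂, a, g, c, hΓ₁, hΓ₂, hwt, hAA, hSS⟩ := exists_saga_parameters hb hbn hy
  have hvar : ∀ D : Fin n → Space d, batchAvg n b (fun s => meanVar fun i => avoids s i • D i) ≤
      A₁ * meanSq D + A₂ * meanVar D := by
    intro D
    rcases hAA with ⟨rfl, rfl⟩ | ⟨rfl, rfl⟩
    · exact batchAvg_meanVar_avoids_le hn D
    · exact (batchAvg_meanVar_avoids hn D).le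
  have hμ₀ : L * y + L / 2 = (y + 1 / 2) * L := by ring
  have hsmooth : ∀ x y' : Space d, avg f y' - avg f x - inner ℝ (gradient (avg f) x) (y' - x) +
      Γ₁ / L * meanSq (fun i => gradient (f i) y' - gradient (f i) x) -
      Γ₂ / L * ‖mean fun i => gradient (f i) y' - gradient (f i) x‖ ^ 2 ≤
      (L * y + L / 2) * ‖y' - x‖ ^ 2 := by
    intro x y'
    rw [hμ₀]
    rcases hSS with hSS | hSS
    · exact (h.avg_add_meanSq_le hn hΓ₁ hΓ₂ x y').trans (by gcongr)
    · exact (h.avg_add_meanSq_le' hn hΓ₁ hΓ₂ x y').trans (by gcongr)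
  have hw2 : (1 / μ + 2 / N) / b ≤ 1 / (b * (y + 1 / 2)) / L := by
    refine (div_le_div_of_nonneg_right bal2 hb0.le).trans (le_of_eq ?_)
    rw [hμ₀]
    field_simp
  have main := hξ.sum_lintegral_gap_le (F := objective f r) hZ (good := fun z => r z.1 ≠ ⊤) hx₀
    (fun z s hz => (isMMStep_mmStep h hs hu hμ0 hz _).ne_top h hs hu hz)
    (Φ := fun z => (objective f r z.1).toReal + 1 / L * sagaPotential a g (sagaDiff f z))
    (η := fun z s => stepCost f (L + μ + Lu) N z.1 (sagaGrad f z s) (sagaStep f u μ z s).1)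
    (c := optimalValue f r)
    (fun z hz => (h.optimalValue_le hz).trans (le_add_of_nonneg_right
      (mul_nonneg (by positivity) (sagaPotential_nonneg hn hwt.1 hwt.2.1 _))))
    (fun z st _ => stepCost_nonneg hN0 _ _ _)
    (fun z hz => sagaStep_potential_le hn hb h hs hu hμ0 hwt hvar hsmooth bal1 hw2 hz)
    (pos := Prod.fst) (S := S) hN0.le
    (fun z s hz h1 h2 => (isMMStep_mmStep h hs hu hμ0 hz _).stationarityGap_sq_le_stepCost hn h hs
      hu hμ0 hz hS h1 h2 hN0) hK
  refine main.trans (le_of_eq ?_)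
  have hD0 : sagaDiff f (x₀, fun _ => x₀) = fun _ => 0 := by
    funext i; simp [sagaDiff]
  rw [hD0]
  simp only [sagaPotential, meanVar, meanSq, mean, norm_zero, ne_eq, OfNat.ofNat_ne_zero,
    not_false_eq_true, zero_pow, Finset.sum_const_zero, smul_zero, sub_zero, mul_zero, add_zero,
    Method.complexityConst]
  rw [hN]
  congr 1
  ring

end SVRMM

end

noncomputable section

namespace SVRMM

/-! ### From the summed bound to the complexity statements -/

theorem exists_le_ofReal_div_of_sum_le {a : ℕ → ℝ≥0∞} {C : ℝ} {K : ℕ} (hK : 1 ≤ K)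
    (h : ∑ k ∈ Finset.Icc 1 K, a k ≤ ENNReal.ofReal C) :
    ∃ k ∈ Finset.Icc 1 K, a k ≤ ENNReal.ofReal (C / K) := by
  obtain ⟨k, hk, hmin⟩ := Finset.exists_min_image (Finset.Icc 1 K) a ⟨1, by simp [hK]⟩
  refine ⟨k, hk, ?_⟩
  have hK0 : (0 : ℝ) < K := by exact_mod_cast hK
  have h1 := Finset.card_nsmul_le_sum (Finset.Icc 1 K) a (a k) hmin
  rw [Nat.card_Icc, Nat.add_sub_cancel, nsmul_eq_mul] at h1
  rw [ENNReal.ofReal_div_of_pos hK0, ENNReal.ofReal_natCast,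
    ENNReal.le_div_iff_mul_le (Or.inl (by exact_mod_cast hK0.ne'))
      (Or.inl (ENNReal.natCast_ne_top K)), mul_comm]
  exact h1.trans h

/-- Integrating `2εt ≤ ε² + t²` replaces the Cauchy–Schwarz inequality and asks for no measurability
of `φ`, which will be the stationarity gap. -/
theorem lintegral_le_of_lintegral_sq_le {Ω : Type*} [MeasurableSpace Ω] {P : Measure Ω}
    [IsProbabilityMeasure P] {φ : Ω → ℝ≥0∞} {ε : ℝ} (hε : 0 < ε)
    (h : ∫⁻ ω, φ ω ^ 2 ∂P ≤ ENNReal.ofReal (ε ^ 2)) : ∫⁻ ω, φ ω ∂P ≤ ENNReal.ofReal ε := by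
  have h1 : ∀ t : ℝ≥0∞, 2 * ENNReal.ofReal ε * t ≤ ENNReal.ofReal ε ^ 2 + t ^ 2 := by
    intro t
    induction t using ENNReal.recTopCoe with
    | top => simp
    | coe t =>
      rw [ENNReal.ofReal]
      exact_mod_cast two_mul_le_add_sq ε.toNNReal t
  have h0 : 2 * ENNReal.ofReal ε ≠ 0 := by simp [hε]
  have ht : 2 * ENNReal.ofReal ε ≠ ⊤ := ENNReal.mul_ne_top ENNReal.ofNat_ne_top ENNReal.ofReal_ne_top
  have h2 := lintegral_mono (μ := P) fun ω => h1 (φ ω)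
  rw [lintegral_const_mul' _ _ ht, lintegral_add_left measurable_const, lintegral_const,
    measure_univ, mul_one] at h2
  rw [ENNReal.ofReal_pow hε.le] at h
  refine (ENNReal.mul_le_mul_iff_right h0 ht).1 (h2.trans ((add_le_add_right h _).trans ?_))
  rw [mul_assoc, two_mul, pow_two]

theorem SubdiffGapOn.mono {d : ℕ} {u : Space d → Space d → EReal} {r : Space d → EReal}
    {S : Set (Space d)} {Lu Lu' : ℝ} (h : SubdiffGapOn u r S Lu) (hle : Lu ≤ Lu') :
    SubdiffGapOn u r S Lu' := fun x hx y hy ν hν => by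
  obtain ⟨ζ, hζ, hζ'⟩ := h x hx y hy ν hν
  exact ⟨ζ, hζ, hζ'.trans (mul_le_mul_of_nonneg_right hle (norm_nonneg _))⟩

theorem Method.IsRun.hasSummedGapBound {Ω : Type*} [MeasurableSpace Ω] {P : Measure Ω}
    [IsProbabilityMeasure P] {d n b : ℕ} (hn : 1 ≤ n) (hb : 1 ≤ b)
    {f : Fin n → Space d → ℝ} {r : Space d → EReal} {u : Space d → Space d → EReal} {L μ : ℝ}
    {x₀ : Space d} {M : Method} (hM : M.Admissible n b) (h : BasicAssumption f r L)
    (hs : IsSurrogate u r) (hu : SurrogateAssumption u r) (hμ : L / 2 < μ)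
    (hcond : 0 < M.margin n b L μ) (hx₀ : r x₀ ≠ ⊤) {x : ℕ → Ω → Space d}
    (hx : M.IsRun P b f u μ x₀ x) :
    HasSummedGapBound P (objective f r) r u x fun Lu => M.complexityConst n b L μ Lu
      ((objective f r x₀).toReal - optimalValue f r) := by
  cases M with
  | saga => exact IsSagaRun.hasSummedGapBound hn hb hM h hs hu hμ hx₀ hcond hx
  | svrg m => exact IsSvrgRun.hasSummedGapBound hn hb hM h hs hu hμ hx₀ hcond hx
  | sarah m => exact IsSarahRun.hasSummedGapBound hn hb hM h hs hu hμ hx₀ hcond hx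

end SVRMM

end

/-! ### The iteration complexity theorem. -/

theorem mainTheorem2 {Ω : Type*} [MeasurableSpace Ω] (P : Measure Ω) [IsProbabilityMeasure P]
    {d n b : ℕ} (hn : 1 ≤ n) (hb : 1 ≤ b)
    (f : Fin n → SVRMM.Space d → ℝ) (r : SVRMM.Space d → EReal)
    (u : SVRMM.Space d → SVRMM.Space d → EReal) (L μ : ℝ) (x₀ : SVRMM.Space d)
    (M : SVRMM.Method) (hM : M.Admissible n b)
    (hbasic : SVRMM.BasicAssumption f r L)
    (hsurr : SVRMM.IsSurrogate u r) (hu : SVRMM.SurrogateAssumption u r)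
    (hgap : SVRMM.SubdiffGapAssumption u r)
    (hμ : L / 2 < μ) (hcond : 0 < M.margin n b L μ)
    (hx₀ : r x₀ ≠ ⊤)
    (x : ℕ → Ω → SVRMM.Space d) (hx : M.IsRun P b f u μ x₀ x) :
    -- for every horizon, the iterates stay in a bounded set, on which some `Lu` is available
    (∀ K : ℕ, ∃ (S : Set (SVRMM.Space d)) (Lu : ℝ), Bornology.IsBounded S ∧
      (∀ k ≤ K, ∀ ω, x k ω ∈ S) ∧ 0 ≤ Lu ∧ SVRMM.SubdiffGapOn u r S Lu) ∧
    -- whenever `Lu` is a valid constant on a set `S` containing the iterates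
    (∀ (S : Set (SVRMM.Space d)) (Lu : ℝ), 0 ≤ Lu → SVRMM.SubdiffGapOn u r S Lu →
      -- the explicit bound
      (∀ K : ℕ, 1 ≤ K → (∀ k ≤ K, ∀ᵐ ω ∂P, x k ω ∈ S) →
        SVRMM.minExpSqGap P (SVRMM.objective f r) x K ≤
          ENNReal.ofReal (M.complexityConst n b L μ Lu
            ((SVRMM.objective f r x₀).toReal - SVRMM.optimalValue f r) / K)) ∧
      ((∀ k, ∀ᵐ ω ∂P, x k ω ∈ S) →
        -- the rate `O(1/K)`
        ((fun K : ℕ => (SVRMM.minExpSqGap P (SVRMM.objective f r) x K).toReal)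
          =O[atTop] fun K : ℕ => 1 / (K : ℝ)) ∧
        -- `O(1/ε²)` iterations suffice for an `ε`-stationary point in expectation
        (∀ ε : ℝ, 0 < ε → ∀ K : ℕ, 1 ≤ K →
          M.complexityConst n b L μ Lu
            ((SVRMM.objective f r x₀).toReal - SVRMM.optimalValue f r) / ε ^ 2 ≤ K →
          ∃ k ∈ Finset.Icc 1 K,
            ∫⁻ ω, SVRMM.stationarityGap (SVRMM.objective f r) (x k ω) ^ 2 ∂P
              ≤ ENNReal.ofReal (ε ^ 2) ∧
            ∫⁻ ω, SVRMM.stationarityGap (SVRMM.objective f r) (x k ω) ∂P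
              ≤ ENNReal.ofReal ε))) := by
  obtain ⟨hfin, hsum⟩ := hx.hasSummedGapBound hn hb hM hbasic hsurr hu hμ hcond hx₀
  refine ⟨fun K => ?_, fun S Lu hLu hS => ⟨fun K hK hKS => ?_, fun hall => ⟨?_, ?_⟩⟩⟩
  · have hS : Bornology.IsBounded (⋃ k ∈ Finset.range (K + 1), Set.range (x k)) :=
      (Set.Finite.biUnion (Finset.finite_toSet _) fun k _ => hfin k).isBounded
    obtain ⟨Lu, hLu⟩ := hgap _ hS
    -- The constant provided by the assumption may be negative; enlarging it keeps it valid.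
    exact ⟨_, max Lu 0, hS, fun k hk ω => Set.mem_biUnion
      (Finset.mem_range.2 (Nat.lt_succ_of_le hk)) ⟨ω, rfl⟩, le_max_right _ _,
      hLu.mono (le_max_left _ _)⟩
  · obtain ⟨k, hk, hle⟩ := SVRMM.exists_le_ofReal_div_of_sum_le hK (hsum S Lu hLu hS K hKS)
    exact iInf₂_le_of_le k hk hle
  · refine Asymptotics.IsBigO.of_bound |M.complexityConst n b L μ Lu
      ((SVRMM.objective f r x₀).toReal - SVRMM.optimalValue f r)| ?_
    filter_upwards [eventually_ge_atTop 1] with K hK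
    obtain ⟨k, hk, hle⟩ := SVRMM.exists_le_ofReal_div_of_sum_le hK
      (hsum S Lu hLu hS K fun k _ => hall k)
    have h1 : SVRMM.minExpSqGap P (SVRMM.objective f r) x K ≤ _ := iInf₂_le_of_le k hk hle
    rw [Real.norm_of_nonneg ENNReal.toReal_nonneg, Real.norm_of_nonneg (by positivity),
      mul_one_div]
    refine ENNReal.toReal_le_of_le_ofReal (by positivity) (h1.trans ?_)
    exact ENNReal.ofReal_le_ofReal (div_le_div_of_nonneg_right (le_abs_self _) (by positivity))
  · intro ε hε K hK hCK
    obtain ⟨k, hk, hle⟩ := SVRMM.exists_le_ofReal_div_of_sum_le hK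
      (hsum S Lu hLu hS K fun k _ => hall k)
    have hK0 : (0 : ℝ) < K := by exact_mod_cast hK
    have h1 : ∫⁻ ω, SVRMM.stationarityGap (SVRMM.objective f r) (x k ω) ^ 2 ∂P ≤
        ENNReal.ofReal (ε ^ 2) := by
      refine hle.trans (ENNReal.ofReal_le_ofReal ?_)
      rw [div_le_iff₀ (by positivity)] at hCK ⊢
      linarith
    exact ⟨k, hk, h1, SVRMM.lintegral_le_of_lintegral_sq_le hε h1⟩
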